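/- **Model.** Let $n,d$ be even, let the points $\{1,\dots,n\}$ be partitioned into $C_1,C_2$ with $|C_1|=|C_2|$ and the features $\{1,\dots,d\}$ into $D_1,D_2$ with $|D_1|=|D_2|$. In the Boolean Block Model with $P=\begin{pmatrix}p&q\\q&p\end{pmatrix}$ the data set $X\in\{0,1\}^{n\times d}$ has independent entries, and the entry of a point of $C_i$ on a feature of $D_j$ equals $1$ with probability $P(i,j)$. **Algorithms.** Two distinct data points, chosen uniformly at random, are the initial centers. In each iteration, every point is first assigned to a center at smallest Hamming distance (ties are broken uniformly and independently at random); then, independently for each center and each feature, the new coordinate of the center is $1$ with probability $\rho(x)$ and $0$ otherwise, where $x$ is the fraction of ones on that feature among the points assigned to the center (the center of an empty cluster is kept). The algorithm stops when an iteration does not change the clusters, and at the latest after $T$ iterations; it outputs the last clusters. For $k$-modes, $\rho(x)=0,\tfrac12,1$ according as $x<\tfrac12$, $x=\tfrac12$, $x>\tfrac12$; for SoftModes$(t)$, $\rho(x)=x^t/(x^t+(1-x)^t)$. The accuracy of an output is the fraction of correctly classified points under the better of the two matchings of output clusters with $C_1,C_2$; the mean accuracy on a data set $X$ is the expectation of the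 accuracy over the internal randomness of the algorithm (seeding, ties, rounding), with $X$ fixed. **Theorem.** There is an absolute constant $\kappa$ such that the following holds for all constants $0<p<\tfrac12$. Here $K\in\mathbb N$ and $\varepsilon>0$ are arbitrary, the number $T$ of iterations is any integer with $2\le T\le n^K$, the partitions are arbitrary as above, $d\ge(\log n)^{\kappa}$, and "$n$ large" means $n\ge N$ with $N$ depending only on $p,q,K,\varepsilon$ (and on $t$ in (2)). 1. Let $0\le q<p$. There is $\eta>0$, depending only on $p,q,K,\varepsilon$, such that for $n$ large and $d\le e^{\eta n}$: with probability at least $1-\varepsilon$ over the data and the algorithm, the accuracy of $k$-modes is at most $0.51$; and with probability at least $1-\varepsilon$ over the data, the mean accuracy of $k$-modes is at most $0.51$. 2. Let $0\le q<p$ and let $t\ge1$ be real. For $n$ large, with probability at least $1-\varepsilon$ over the data, the mean accuracy of SoftModes$(t)$ is at least $0.74$. 3. There is $q_0>0$, depending only on $p$, such that for all $0\le q<\min(p,q_0)$ and $n$ large, with probability at least $1-\varepsilon$ over the data and the algorithm, SoftModes$(1)$ misclassifies no point (while (1) still applies to $k$-modes). -/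

import Mathlib

namespace BooleanBlock

/-! ### Finite probability -/

/-- The product law: coordinates are independent, coordinate `i` has law `μ i`. -/
noncomputable def piPMF {ι : Type} [Fintype ι] [DecidableEq ι] {β : ι → Type}
    [∀ i, Fintype (β i)] (μ : ∀ i, PMF (β i)) : PMF (∀ i, β i) :=
  PMF.ofFintype (fun f => ∏ i, μ i (f i)) (by
    have h : ∀ i, ∑ b, μ i b = 1 := fun i =>
      (tsum_fintype (fun b => μ i b)).symm.trans (μ i).tsum_coe
    rw [← Fintype.piFinset_univ, ← Finset.prod_univ_sum]
    simp [h])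

/-- The law on a finite set described by a point of the standard simplex. -/
noncomputable def simplexPMF {A : Type} [Fintype A] (x : stdSimplex ℝ A) : PMF A :=
  PMF.ofFintype (fun a => ENNReal.ofReal (x.1 a)) (by
    rw [← ENNReal.ofReal_sum_of_nonneg (fun a _ => x.2.1 a), x.2.2, ENNReal.ofReal_one])

/-- A random bit that is `true` (that is, 1) with probability `p`. -/
noncomputable def coin (p : unitInterval) : PMF Bool :=
  simplexPMF ⟨fun b => if b then (p : ℝ) else 1 - p, by
    constructor
    · intro b
      cases b
      · simpa using p.2.2
      · simpa using p.2.1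
    · simp⟩

/-- The probability of an event, as a real number. -/
noncomputable def prob {α : Type} (μ : PMF α) (E : Set α) : ℝ :=
  (μ.toOuterMeasure E).toReal

/-- The expectation of a real random variable on a finite probability space. -/
noncomputable def expect {α : Type} [Fintype α] (μ : PMF α) (f : α → ℝ) : ℝ :=
  ∑ a, (μ a).toReal * f a

/-! ### The Boolean Block Model -/

/-- `n` points and `d` features, with the points partitioned into the clusters
`C ⁻¹' {i}` and the features into the blocks `D ⁻¹' {j}`: all entries are independent, and
the entry of a point of cluster `i` on a feature of block `j` is 1 with probability `P i j`. -/
noncomputable def bbm {n d k : ℕ} (C : Fin n → Fin k) (D : Fin d → Fin k)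
    (P : Matrix (Fin k) (Fin k) unitInterval) : PMF (Fin n → Fin d → Bool) :=
  piPMF fun i => piPMF fun j => coin (P (C i) (D j))

/-! ### Rounding functions -/

/-- Plurality rounding: the uniform law on the set of largest coordinates. -/
noncomputable def pluralityRound {A : Type} [Fintype A] (x : stdSimplex ℝ A) :
    stdSimplex ℝ A :=
  open Classical in
  ⟨fun a => if ∀ b, x.1 b ≤ x.1 a
      then 1 / ((Finset.univ.filter fun a' => ∀ b, x.1 b ≤ x.1 a').card : ℝ) else 0, by
    constructor
    · intro a
      dsimp only
      split_ifs
      · positivity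
      · exact le_rfl
    · have hA : Nonempty A := by
        by_contra h
        rw [not_nonempty_iff] at h
        have := x.2.2
        simp at this
      obtain ⟨a, ha⟩ := Finite.exists_max x.1
      have hc : ((Finset.univ.filter fun a' => ∀ b, x.1 b ≤ x.1 a').card : ℝ) ≠ 0 := by
        rw [Nat.cast_ne_zero]
        exact Finset.card_ne_zero_of_mem (Finset.mem_filter.2 ⟨Finset.mem_univ a, ha⟩)
      rw [← Finset.sum_filter, Finset.sum_const, nsmul_eq_mul, mul_one_div_cancel hc]⟩

/-- Soft rounding with parameter `t`: coordinates are proportional to `x a ^ t`. -/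
noncomputable def softRound (t : ℝ) {A : Type} [Fintype A] (x : stdSimplex ℝ A) :
    stdSimplex ℝ A :=
  ⟨fun a => x.1 a ^ t / ∑ b, x.1 b ^ t, by
    constructor
    · intro a
      exact div_nonneg (Real.rpow_nonneg (x.2.1 a) t)
        (Finset.sum_nonneg fun b _ => Real.rpow_nonneg (x.2.1 b) t)
    · have hpos : 0 < ∑ b, x.1 b ^ t := by
        obtain ⟨a, -, ha⟩ : ∃ a ∈ Finset.univ, x.1 a ≠ 0 :=
          Finset.exists_ne_zero_of_sum_ne_zero (by rw [x.2.2]; exact one_ne_zero)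
        exact Finset.sum_pos' (fun b _ => Real.rpow_nonneg (x.2.1 b) t)
          ⟨a, Finset.mem_univ a, Real.rpow_pos_of_pos (lt_of_le_of_ne (x.2.1 a) ha.symm) t⟩
      rw [← Finset.sum_div, div_self hpos.ne']⟩

/-! ### The algorithm -/

section Algorithm

variable {n d k : ℕ} {A : Fin d → Type} [∀ j, DecidableEq (A j)]

/-- The indices of the centers that are nearest to the point `x` in Hamming distance. -/
def nearest (c : Fin k → ∀ j, A j) (x : ∀ j, A j) : Finset (Fin k) :=
  Finset.univ.filter fun i => ∀ i', hammingDist x (c i) ≤ hammingDist x (c i')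

theorem nearest_nonempty [NeZero k] (c : Fin k → ∀ j, A j) (x : ∀ j, A j) :
    (nearest c x).Nonempty := by
  obtain ⟨i, hi⟩ := Finite.exists_min fun i => hammingDist x (c i)
  exact ⟨i, Finset.mem_filter.2 ⟨Finset.mem_univ i, hi⟩⟩

variable [∀ j, Fintype (A j)]

/-- Every point goes to a nearest center, ties being broken uniformly at random and
independently for the different points. -/
noncomputable def assign [NeZero k] (X : Fin n → ∀ j, A j) (c : Fin k → ∀ j, A j) :
    PMF (Fin n → Fin k) :=
  piPMF fun a => PMF.uniformOfFinset (nearest c (X a)) (nearest_nonempty c (X a))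

/-- The points of the cluster with index `i`. -/
def cluster (σ : Fin n → Fin k) (i : Fin k) : Finset (Fin n) :=
  Finset.univ.filter fun a => σ a = i

/-- The empirical distribution of the feature `j` on a nonempty set of points. -/
noncomputable def histogram (X : Fin n → ∀ j, A j) (S : Finset (Fin n)) (hS : S.Nonempty)
    (j : Fin d) : stdSimplex ℝ (A j) :=
  ⟨fun z => ((S.filter fun a => X a j = z).card : ℝ) / S.card, by
    constructor
    · intro z
      positivity
    · have hc : (S.card : ℝ) ≠ 0 := Nat.cast_ne_zero.2 (Finset.card_ne_zero.2 hS)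
      rw [← Finset.sum_div, ← Nat.cast_sum,
        ← Finset.card_eq_sum_card_fiberwise (fun a _ => Finset.mem_univ (X a j)),
        div_self hc]⟩

/-- The new centers: each coordinate of each center is sampled independently from the rounded
empirical distribution of that coordinate on the cluster. The center of an empty cluster, for
which there is no empirical distribution, is left as it is. -/
noncomputable def update (ρ : ∀ j, stdSimplex ℝ (A j) → stdSimplex ℝ (A j))
    (X : Fin n → ∀ j, A j) (c : Fin k → ∀ j, A j) (σ : Fin n → Fin k) :
    PMF (Fin k → ∀ j, A j) :=
  piPMF fun i => piPMF fun j =>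
    if h : (cluster σ i).Nonempty then simplexPMF (ρ j (histogram X (cluster σ i) h j))
    else PMF.pure (c i j)

/-- The state of the algorithm: the current clusters (`none` before the first iteration), the
current centers, and whether the algorithm has terminated. -/
structure State (n k : ℕ) {d : ℕ} (A : Fin d → Type) where
  clusters : Option (Fin n → Fin k)
  centers : Fin k → ∀ j, A j
  halted : Bool

/-- One iteration of the main loop. The algorithm terminates as soon as an iteration does not
change the clusters; after that nothing happens any more. -/
noncomputable def iteration [NeZero k] (ρ : ∀ j, stdSimplex ℝ (A j) → stdSimplex ℝ (A j))
    (X : Fin n → ∀ j, A j) (s : State n k A) : PMF (State n k A) :=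
  if s.halted then PMF.pure s
  else (assign X s.centers).bind fun σ =>
    (update ρ X s.centers σ).map fun c => ⟨some σ, c, decide (s.clusters = some σ)⟩

/-- The state after at most `T` iterations, for given seeds. -/
noncomputable def stateAfter [NeZero k] (ρ : ∀ j, stdSimplex ℝ (A j) → stdSimplex ℝ (A j))
    (X : Fin n → ∀ j, A j) (seeds : Fin k → ∀ j, A j) : ℕ → PMF (State n k A)
  | 0 => PMF.pure ⟨none, seeds, false⟩
  | T + 1 => (stateAfter ρ X seeds T).bind (iteration ρ X)

/-- `k` distinct data points, chosen uniformly at random. -/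
noncomputable def seeding (h : k ≤ n) : PMF (Fin k ↪ Fin n) :=
  haveI : Nonempty (Fin k ↪ Fin n) := ⟨Fin.castLEEmb h⟩
  PMF.uniformOfFintype (Fin k ↪ Fin n)

/-- The clustering that the algorithm with rounding functions `ρ` and random seeding outputs on
the data set `X` after at most `T` iterations (for `T = 0`, a dummy value). -/
noncomputable def output [NeZero k] (ρ : ∀ j, stdSimplex ℝ (A j) → stdSimplex ℝ (A j))
    (h : k ≤ n) (X : Fin n → ∀ j, A j) (T : ℕ) : PMF (Fin n → Fin k) :=
  (seeding h).bind fun s =>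
    (stateAfter ρ X (fun i => X (s i)) T).map fun st => st.clusters.getD fun _ => 0

/-- The `k`-modes algorithm. -/
noncomputable def kModes [NeZero k] (h : k ≤ n) (X : Fin n → ∀ j, A j) (T : ℕ) :
    PMF (Fin n → Fin k) :=
  output (fun _ => pluralityRound) h X T

/-- The algorithm `SoftModes(t)`. -/
noncomputable def softModes [NeZero k] (t : ℝ) (h : k ≤ n) (X : Fin n → ∀ j, A j) (T : ℕ) :
    PMF (Fin n → Fin k) :=
  output (fun _ => softRound t) h X T

end Algorithm

/-! ### Quality of a clustering -/

/-- The fraction of correctly classified points, under the best matching of the labels of the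
computed clusters `σ` with those of the planted clusters `C`. -/
noncomputable def accuracy {n k : ℕ} (C σ : Fin n → Fin k) : ℝ :=
  ⨆ π : Equiv.Perm (Fin k), ((Finset.univ.filter fun a => π (σ a) = C a).card : ℝ) / n

/-- The computed clusters are the planted ones, up to the names of the clusters. -/
def MisclassifiesNoPoint {n k : ℕ} (C σ : Fin n → Fin k) : Prop :=
  ∃ π : Equiv.Perm (Fin k), ∀ a, π (σ a) = C a

/-- All parts of the partition of `Fin m` that is given by the labelling `L` have the same
size. -/
def Balanced {m k : ℕ} (L : Fin m → Fin k) : Prop :=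
  ∀ i i', (cluster L i).card = (cluster L i').card

end BooleanBlock

namespace BooleanBlock

/-! ### Expectations and probabilities on finite spaces -/

/-! Everything is decided in the first two iterations, and the analysis splits according to whether
the two seeds lie in different planted clusters or in the same one.

Different planted clusters. Distances between data points concentrate around `meanDist` times `d`,
which is larger by `(p - q)² d` for points of different clusters. Once `d` is of larger order than
`log n`, this holds for all pairs at once (`prob_not_regular_le`), and the first assignment
reproduces the planted clusters (`Regular.separates`).

Same planted cluster. For fixed seeds `b, b'` the difference `gap b b'` of the distances from a
random point to the seeds is a sum of independent terms over the features, so by the central limit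
theorem (`exists_normal_approx`) the probability `firstProb` of joining the first seed is governed
by the quotient of the mean and the standard deviation of the gap. In the seeds' own cluster this
quotient is bounded, so both seeds attract a constant fraction of that cluster. In the other cluster
the quotient is different: the normalizations differ by the strict inequality between arithmetic and
geometric mean (`sqrt_limitVar_lt`), and the resulting linear form in the seeds has
anticoncentration, again by the central limit theorem. When `q = 0` the gap has negligible variance
on the other cluster, which then goes almost entirely to one seed. All this is collected in
`GoodSeeds` and `exists_goodSeeds`.

`k`-modes. All entries are biased towards 0. In the first clusters zeros are therefore in the
majority on every feature: clearly so if the clusters are the planted ones, and for seeds from one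
planted cluster because a single feature moves the gap by at most 2, so that the assignment hardly
depends on it (`expect_choiceProb_mul_le`). Both centers become the zero vector, every point is at a
tie, and the next clusters are a fair random labelling, in which zeros are again in the majority.
From the second iteration on the algorithm thus draws random labellings of accuracy about 1/2. The
bound on `d` pays for the union over features, the bound on `T` for the union over iterations
(`le_prob_kModes_run`).

`SoftModes(t)`. With probability at least 1/2 the seeds are in different planted clusters. The new
centers then have ones with frequencies near `softFun t p` and `softFun t q` on the two blocks;
strict monotonicity of `softFun t` makes them classify all points correctly (`exists_soft_drift`),
the clusters repeat and the run halts. In the other half of the cases accuracy 1/2 is free, which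
gives a mean of about 3/4.

`SoftModes(1)`. Here rounding is linear, so the expected distance from a point to a new center is,
up to a term common to both centers, its average distance to the points of that cluster, which is
affine in the share of its own planted cluster with slope `-(p - q)² d`. For seeds from one planted
cluster the two values of `firstProb` differ by a constant, so the shares differ by a constant
(`goodSplit_of_overlap`), the first centers separate the planted clusters, and the second iteration
finds them (`Regular.prob_not_solved_le`). -/

theorem prob_nonneg {α : Type} (μ : PMF α) (S : Set α) : 0 ≤ prob μ S :=
  ENNReal.toReal_nonneg

section Finite

variable {α β : Type} [Fintype α] [Fintype β]

theorem sum_toReal (μ : PMF α) : ∑ a, (μ a).toReal = 1 := by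
  rw [← ENNReal.toReal_sum fun a _ => μ.apply_ne_top a,
    (tsum_fintype (fun a => μ a)).symm.trans μ.tsum_coe, ENNReal.toReal_one]

theorem expect_const (μ : PMF α) (c : ℝ) : expect μ (fun _ => c) = c := by
  rw [expect, ← Finset.sum_mul, sum_toReal, one_mul]

theorem expect_add (μ : PMF α) (f g : α → ℝ) :
    expect μ (fun a => f a + g a) = expect μ f + expect μ g := by
  simp only [expect, mul_add, Finset.sum_add_distrib]

theorem expect_sub (μ : PMF α) (f g : α → ℝ) :
    expect μ (fun a => f a - g a) = expect μ f - expect μ g := by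
  simp only [expect, mul_sub, Finset.sum_sub_distrib]

theorem expect_neg (μ : PMF α) (f : α → ℝ) : expect μ (fun a => - f a) = - expect μ f := by
  simp only [expect, mul_neg, Finset.sum_neg_distrib]

theorem expect_const_mul (μ : PMF α) (c : ℝ) (f : α → ℝ) :
    expect μ (fun a => c * f a) = c * expect μ f := by
  simp only [expect, Finset.mul_sum]
  exact Finset.sum_congr rfl fun a _ => by ring

theorem expect_mul_const (μ : PMF α) (c : ℝ) (f : α → ℝ) :
    expect μ (fun a => f a * c) = expect μ f * c := by
  simp only [expect, Finset.sum_mul, mul_assoc]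

theorem expect_sum {ι : Type} (s : Finset ι) (μ : PMF α) (f : ι → α → ℝ) :
    expect μ (fun a => ∑ i ∈ s, f i a) = ∑ i ∈ s, expect μ (f i) := by
  simp only [expect, Finset.mul_sum]
  exact Finset.sum_comm

theorem expect_mono (μ : PMF α) {f g : α → ℝ} (h : ∀ a, f a ≤ g a) :
    expect μ f ≤ expect μ g :=
  Finset.sum_le_sum fun a _ => mul_le_mul_of_nonneg_left (h a) ENNReal.toReal_nonneg

theorem expect_nonneg (μ : PMF α) {f : α → ℝ} (h : ∀ a, 0 ≤ f a) : 0 ≤ expect μ f :=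
  Finset.sum_nonneg fun a _ => mul_nonneg ENNReal.toReal_nonneg (h a)

theorem expect_le_const (μ : PMF α) {f : α → ℝ} {c : ℝ} (h : ∀ a, f a ≤ c) :
    expect μ f ≤ c :=
  (expect_mono μ h).trans_eq (expect_const μ c)

theorem abs_expect_le (μ : PMF α) (f : α → ℝ) : |expect μ f| ≤ expect μ (fun a => |f a|) := by
  refine (Finset.abs_sum_le_sum_abs _ _).trans (Finset.sum_le_sum fun a _ => ?_)
  rw [abs_mul, abs_of_nonneg ENNReal.toReal_nonneg]

theorem expect_pure (a : α) (f : α → ℝ) : expect (PMF.pure a) f = f a := by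
  classical
  rw [expect, Finset.sum_eq_single a]
  · simp
  · intro b _ hb
    simp [PMF.pure_apply, hb]
  · simp

theorem expect_bind (μ : PMF α) (κ : α → PMF β) (f : β → ℝ) :
    expect (μ.bind κ) f = expect μ fun a => expect (κ a) f := by
  simp only [expect, PMF.bind_apply, tsum_fintype, Finset.mul_sum]
  rw [Finset.sum_comm]
  refine Finset.sum_congr rfl fun b _ => ?_
  rw [ENNReal.toReal_sum fun a _ => ENNReal.mul_ne_top (μ.apply_ne_top a) ((κ a).apply_ne_top b),
    Finset.sum_mul]
  exact Finset.sum_congr rfl fun a _ => by rw [ENNReal.toReal_mul, mul_assoc]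

theorem expect_map (μ : PMF α) (g : α → β) (f : β → ℝ) :
    expect (μ.map g) f = expect μ fun a => f (g a) := by
  rw [← PMF.bind_pure_comp, expect_bind]
  simp only [Function.comp, expect_pure]

theorem expect_congr_support (μ : PMF α) {f g : α → ℝ} (h : ∀ a, μ a ≠ 0 → f a = g a) :
    expect μ f = expect μ g := by
  refine Finset.sum_congr rfl fun a _ => ?_
  by_cases ha : μ a = 0
  · simp [ha]
  · rw [h a ha]

theorem expect_comm (μ : PMF α) (ν : PMF β) (f : α → β → ℝ) :
    (expect μ fun a => expect ν fun b => f a b) = expect ν fun b => expect μ fun a => f a b := by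
  simp only [expect, Finset.mul_sum]
  rw [Finset.sum_comm]
  exact Finset.sum_congr rfl fun b _ => Finset.sum_congr rfl fun a _ => by ring

open Classical in
theorem prob_eq_expect (μ : PMF α) (S : Set α) :
    prob μ S = expect μ fun a => if a ∈ S then 1 else 0 := by
  rw [prob, expect, PMF.toOuterMeasure_apply_fintype, ENNReal.toReal_sum]
  · refine Finset.sum_congr rfl fun a _ => ?_
    by_cases h : a ∈ S <;> simp [h]
  · intro a _
    by_cases h : a ∈ S <;> simp [h, μ.apply_ne_top]

theorem prob_le_expect (μ : PMF α) (S : Set α) {f : α → ℝ} (h0 : ∀ a, 0 ≤ f a)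
    (h1 : ∀ a ∈ S, 1 ≤ f a) : prob μ S ≤ expect μ f := by
  classical
  rw [prob_eq_expect]
  refine expect_mono μ fun a => ?_
  split_ifs with h
  exacts [h1 a h, h0 a]

theorem expect_le_prob (μ : PMF α) (S : Set α) {f : α → ℝ} (h0 : ∀ a, f a ≤ 1)
    (h1 : ∀ a ∉ S, f a ≤ 0) : expect μ f ≤ prob μ S := by
  classical
  rw [prob_eq_expect]
  refine expect_mono μ fun a => ?_
  split_ifs with h
  exacts [h0 a, h1 a h]

theorem prob_mono (μ : PMF α) {S T : Set α} (h : S ⊆ T) : prob μ S ≤ prob μ T := by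
  classical
  rw [prob_eq_expect, prob_eq_expect]
  refine expect_mono μ fun a => ?_
  by_cases ha : a ∈ S
  · simp [ha, h ha]
  · simp only [ha, if_false]
    split_ifs <;> norm_num

theorem prob_le_one (μ : PMF α) (S : Set α) : prob μ S ≤ 1 := by
  classical
  rw [prob_eq_expect]
  exact expect_le_const μ fun a => by split_ifs <;> norm_num

theorem prob_compl (μ : PMF α) (S : Set α) : prob μ Sᶜ = 1 - prob μ S := by
  classical
  rw [prob_eq_expect, prob_eq_expect, eq_sub_iff_add_eq, ← expect_add]
  refine (congrArg _ (funext fun a => ?_)).trans (expect_const μ 1)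
  by_cases h : a ∈ S <;> simp [h]

theorem prob_union_le (μ : PMF α) (S T : Set α) : prob μ (S ∪ T) ≤ prob μ S + prob μ T := by
  classical
  rw [prob_eq_expect, prob_eq_expect, prob_eq_expect, ← expect_add]
  refine expect_mono μ fun a => ?_
  by_cases h : a ∈ S <;> by_cases h' : a ∈ T <;> simp [h, h']

theorem prob_exists_le {ι : Type} [Fintype ι] (μ : PMF α) (S : ι → Set α) :
    prob μ {a | ∃ i, a ∈ S i} ≤ ∑ i, prob μ (S i) := by
  classical
  simp only [prob_eq_expect, ← expect_sum]
  refine expect_mono μ fun a => ?_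
  have h0 : ∀ i ∈ Finset.univ, (0 : ℝ) ≤ if a ∈ S i then 1 else 0 := fun i _ => by
    split_ifs <;> norm_num
  split_ifs with h
  · obtain ⟨i, hi⟩ := h
    exact (if_pos hi).symm.le.trans (Finset.single_le_sum h0 (Finset.mem_univ i))
  · exact Finset.sum_nonneg h0

theorem prob_exists_le_card {ι : Type} [Fintype ι] (μ : PMF α) (S : ι → Set α) {e : ℝ}
    (h : ∀ i, prob μ (S i) ≤ e) : prob μ {a | ∃ i, a ∈ S i} ≤ Fintype.card ι * e := by
  refine (prob_exists_le μ S).trans ((Finset.sum_le_sum fun i _ => h i).trans_eq ?_)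
  simp

theorem prob_ge_le_expect_div (μ : PMF α) {f : α → ℝ} (h0 : ∀ a, 0 ≤ f a) {t : ℝ} (ht : 0 < t) :
    prob μ {a | t ≤ f a} ≤ expect μ f / t := by
  rw [div_eq_mul_inv, ← expect_mul_const]
  refine prob_le_expect μ _ (fun a => by have := h0 a; positivity) fun a ha => ?_
  rw [← div_eq_mul_inv, le_div_iff₀ ht, one_mul]
  exact ha

theorem prob_bind (μ : PMF α) (κ : α → PMF β) (S : Set β) :
    prob (μ.bind κ) S = expect μ fun a => prob (κ a) S := by
  classical
  simp only [prob_eq_expect, expect_bind]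

theorem prob_map (μ : PMF α) (g : α → β) (S : Set β) :
    prob (μ.map g) S = prob μ (g ⁻¹' S) := by
  classical
  simp only [prob_eq_expect, expect_map, Set.mem_preimage]

theorem prob_eq_one_of_support (μ : PMF α) (S : Set α) (h : ∀ a, μ a ≠ 0 → a ∈ S) :
    prob μ S = 1 := by
  classical
  rw [prob_eq_expect, expect_congr_support μ (g := fun _ => 1) fun a ha => if_pos (h a ha),
    expect_const]

/-- Sampling `a` from `μ` and then `b` from `κ a`. -/
noncomputable def jointPMF (μ : PMF α) (κ : α → PMF β) : PMF (α × β) :=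
  μ.bind fun a => (κ a).map (Prod.mk a)

theorem expect_jointPMF (μ : PMF α) (κ : α → PMF β) (f : α × β → ℝ) :
    expect (jointPMF μ κ) f = expect μ fun a => expect (κ a) fun b => f (a, b) := by
  simp only [jointPMF, expect_bind, expect_map]

theorem toReal_eq_expect [DecidableEq α] (μ : PMF α) (a : α) :
    (μ a).toReal = expect μ fun b => if b = a then 1 else 0 := by
  simp [expect]

theorem jointPMF_apply_toReal (μ : PMF α) (κ : α → PMF β) (a : α) (b : β) :
    (jointPMF μ κ (a, b)).toReal = (μ a).toReal * (κ a b).toReal := by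
  classical
  rw [toReal_eq_expect, expect_jointPMF, expect, Finset.sum_eq_single a]
  · simp [toReal_eq_expect (κ a) b]
  · intro a' _ h
    simp [h, expect]
  · simp

end Finite

/-! ### Product laws -/

section Product

variable {ι : Type} [Fintype ι] [DecidableEq ι] {β : ι → Type} [∀ i, Fintype (β i)]

theorem piPMF_apply (μ : ∀ i, PMF (β i)) (x : ∀ i, β i) : piPMF μ x = ∏ i, μ i (x i) := rfl

theorem piPMF_apply_toReal (μ : ∀ i, PMF (β i)) (x : ∀ i, β i) :
    (piPMF μ x).toReal = ∏ i, (μ i (x i)).toReal := by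
  rw [piPMF_apply, ENNReal.toReal_prod]

theorem expect_piPMF_prod (μ : ∀ i, PMF (β i)) (g : ∀ i, β i → ℝ) :
    expect (piPMF μ) (fun x => ∏ i, g i (x i)) = ∏ i, expect (μ i) (g i) := by
  simp only [expect, piPMF_apply_toReal, ← Finset.prod_mul_distrib]
  rw [Finset.prod_univ_sum, Fintype.piFinset_univ]

theorem expect_piPMF_eval (μ : ∀ i, PMF (β i)) (i : ι) (g : β i → ℝ) :
    expect (piPMF μ) (fun x => g (x i)) = expect (μ i) g := by
  have h := expect_piPMF_prod μ (fun j b => if h : j = i then g (h ▸ b) else 1)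
  rw [Finset.prod_eq_single i] at h
  · simp only [dite_true] at h
    rw [← h]
    congr 1
    funext x
    rw [Finset.prod_eq_single i]
    · simp
    · intro j _ hj
      simp [hj]
    · simp
  · intro j _ hj
    simp [hj, expect_const]
  · simp

theorem support_piPMF {μ : ∀ i, PMF (β i)} {x : ∀ i, β i} (h : piPMF μ x ≠ 0) (i : ι) :
    μ i (x i) ≠ 0 := by
  rw [piPMF_apply] at h
  exact fun h0 => h (Finset.prod_eq_zero (Finset.mem_univ i) h0)

/-- Conditioning on one coordinate. The conditional law is again a product, with a point mass in
that place, so all facts about `piPMF` apply to it. -/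
theorem expect_piPMF_update (μ : ∀ i, PMF (β i)) (i : ι) (F : (∀ i, β i) → ℝ) :
    expect (piPMF μ) F =
      expect (μ i) fun b => expect (piPMF (Function.update μ i (PMF.pure b))) F := by
  classical
  simp only [expect, Finset.mul_sum]
  rw [Finset.sum_comm]
  refine Finset.sum_congr rfl fun x _ => ?_
  rw [Finset.sum_eq_single (x i)]
  · rw [← mul_assoc, piPMF_apply_toReal, piPMF_apply_toReal,
      ← Finset.mul_prod_erase _ _ (Finset.mem_univ i),
      ← Finset.mul_prod_erase Finset.univ (fun j => (Function.update μ i (PMF.pure (x i)) j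
        (x j)).toReal) (Finset.mem_univ i)]
    simp only [Function.update_self, PMF.pure_apply_self, ENNReal.toReal_one, one_mul]
    congr 2
    refine Finset.prod_congr rfl fun j hj => ?_
    rw [Function.update_of_ne (Finset.ne_of_mem_erase hj)]
  · intro b _ hb
    rw [piPMF_apply_toReal, Finset.prod_eq_zero (Finset.mem_univ i)]
    · simp
    · simp [PMF.pure_apply, hb.symm]
  · simp

/-- For fixed centers the label of a point depends on that point only, so data and labels together
form one family of independent pairs, to which the tail bounds below apply. -/
theorem expect_piPMF_bind {γ : ι → Type} [∀ i, Fintype (γ i)] (μ : ∀ i, PMF (β i))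
    (κ : ∀ i, β i → PMF (γ i)) (F : (∀ i, β i) → (∀ i, γ i) → ℝ) :
    (expect (piPMF μ) fun x => expect (piPMF fun i => κ i (x i)) fun y => F x y) =
      expect (piPMF fun i => jointPMF (μ i) (κ i)) fun z =>
        F (fun i => (z i).1) (fun i => (z i).2) := by
  let e : ((∀ i, β i) × (∀ i, γ i)) ≃ (∀ i, β i × γ i) :=
    ⟨fun w i => (w.1 i, w.2 i), fun z => (fun i => (z i).1, fun i => (z i).2),
      fun _ => rfl, fun _ => rfl⟩
  simp only [expect, Finset.mul_sum]
  rw [← Fintype.sum_prod_type']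
  refine Fintype.sum_equiv e _ _ fun w => ?_
  simp only [e, Equiv.coe_fn_mk, piPMF_apply_toReal, jointPMF_apply_toReal,
    Finset.prod_mul_distrib]
  ring

/-- The data matrix read by columns. Concentration over features treats a column as one random
variable, concentration over points a row. -/
theorem expect_piPMF_swap {κ : Type} [Fintype κ] [DecidableEq κ] {γ : ι → κ → Type}
    [∀ i j, Fintype (γ i j)] (μ : ∀ i j, PMF (γ i j)) (F : (∀ i j, γ i j) → ℝ) :
    expect (piPMF fun i => piPMF fun j => μ i j) F =
      expect (piPMF fun j => piPMF fun i => μ i j) fun y => F fun i j => y j i := by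
  simp only [expect]
  refine Fintype.sum_equiv (Equiv.piComm γ) _ _ fun x => ?_
  simp only [piPMF_apply_toReal]
  rw [Finset.prod_comm]
  rfl

theorem prob_piPMF_bind {γ : ι → Type} [∀ i, Fintype (γ i)] (μ : ∀ i, PMF (β i))
    (κ : ∀ i, β i → PMF (γ i)) (R : (∀ i, β i) → (∀ i, γ i) → Prop) :
    (expect (piPMF μ) fun x => prob (piPMF fun i => κ i (x i)) {y | R x y}) =
      prob (piPMF fun i => jointPMF (μ i) (κ i))
        {z | R (fun i => (z i).1) (fun i => (z i).2)} := by
  classical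
  simp only [prob_eq_expect]
  exact expect_piPMF_bind μ κ fun x y => if y ∈ {y | R x y} then 1 else 0

theorem prob_piPMF_swap {κ : Type} [Fintype κ] [DecidableEq κ] {γ : ι → κ → Type}
    [∀ i j, Fintype (γ i j)] (μ : ∀ i j, PMF (γ i j)) (R : (∀ i j, γ i j) → Prop) :
    prob (piPMF fun i => piPMF fun j => μ i j) {x | R x} =
      prob (piPMF fun j => piPMF fun i => μ i j) {y | R fun i j => y j i} := by
  classical
  simp only [prob_eq_expect]
  exact expect_piPMF_swap μ fun x => if x ∈ {x | R x} then 1 else 0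

/-! ### Tail bounds -/

/-- From `exp y ≤ 1 + y + y²` for `|y| ≤ 1`, followed by `1 + y ≤ exp y`. -/
theorem expect_exp_le {α : Type} [Fintype α] (μ : PMF α) {g : α → ℝ} {l : ℝ}
    (hg : ∀ a, |g a| ≤ 1) (h0 : expect μ g ≤ 0) (hl0 : 0 ≤ l) (hl1 : l ≤ 1) :
    expect μ (fun a => Real.exp (l * g a)) ≤ Real.exp (l ^ 2 * expect μ fun a => g a ^ 2) := by
  have h1 : expect μ (fun a => Real.exp (l * g a)) ≤
      expect μ fun a => 1 + l * g a + l ^ 2 * g a ^ 2 := by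
    refine expect_mono μ fun a => ?_
    have hb : |l * g a| ≤ 1 := by
      rw [abs_mul, abs_of_nonneg hl0]
      nlinarith [hg a, abs_nonneg (g a)]
    have := (abs_le.1 (Real.abs_exp_sub_one_sub_id_le hb)).2
    nlinarith
  rw [expect_add, expect_add, expect_const, expect_const_mul, expect_const_mul] at h1
  have h2 := Real.add_one_le_exp (l ^ 2 * expect μ fun a => g a ^ 2)
  nlinarith

/-- Bernstein's inequality, in the form in which the exponent has not been optimized. -/
theorem prob_sum_ge_le (μ : ∀ i, PMF (β i)) {g : ∀ i, β i → ℝ} {l v t : ℝ}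
    (hg : ∀ i b, |g i b| ≤ 1) (h0 : ∀ i, expect (μ i) (g i) ≤ 0)
    (hv : ∑ i, expect (μ i) (fun b => g i b ^ 2) ≤ v) (hl0 : 0 ≤ l) (hl1 : l ≤ 1) :
    prob (piPMF μ) {x | t ≤ ∑ i, g i (x i)} ≤ Real.exp (-(l * t) + l ^ 2 * v) := by
  have h1 : prob (piPMF μ) {x | t ≤ ∑ i, g i (x i)} ≤
      expect (piPMF μ) fun x => Real.exp (-(l * t)) * ∏ i, Real.exp (l * g i (x i)) := by
    refine prob_le_expect _ _ (fun x => by positivity) fun x hx => ?_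
    rw [← Real.exp_sum, ← Real.exp_add, ← Finset.mul_sum]
    refine Real.one_le_exp ?_
    rw [Set.mem_ofPred_eq] at hx
    have := mul_le_mul_of_nonneg_left hx hl0
    linarith
  refine h1.trans ?_
  rw [expect_const_mul, expect_piPMF_prod μ fun i b => Real.exp (l * g i b), Real.exp_add]
  refine mul_le_mul_of_nonneg_left ?_ (Real.exp_pos _).le
  calc ∏ i, expect (μ i) (fun b => Real.exp (l * g i b))
      ≤ ∏ i, Real.exp (l ^ 2 * expect (μ i) fun b => g i b ^ 2) :=
        Finset.prod_le_prod (fun i _ => expect_nonneg _ fun b => (Real.exp_pos _).le)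
          fun i _ => expect_exp_le (μ i) (hg i) (h0 i) hl0 hl1
    _ = Real.exp (l ^ 2 * ∑ i, expect (μ i) fun b => g i b ^ 2) := by
        rw [← Real.exp_sum, Finset.mul_sum]
    _ ≤ Real.exp (l ^ 2 * v) := Real.exp_le_exp.2 (mul_le_mul_of_nonneg_left hv (sq_nonneg l))

/-- Hoeffding's inequality. -/
theorem hoeffding (μ : ∀ i, PMF (β i)) {g : ∀ i, β i → ℝ} {θ : ℝ}
    (hg : ∀ i b, |g i b| ≤ 1) (hθ0 : 0 ≤ θ) (hθ1 : θ ≤ 1) :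
    prob (piPMF μ) {x | ∑ i, expect (μ i) (g i) + θ * Fintype.card ι ≤ ∑ i, g i (x i)} ≤
      Real.exp (-(θ ^ 2 * Fintype.card ι / 16)) := by
  have he : ∀ i, |expect (μ i) (g i)| ≤ 1 := fun i =>
    (abs_expect_le _ _).trans (expect_le_const _ (hg i))
  have hb : ∀ i b, |(g i b - expect (μ i) (g i)) / 2| ≤ 1 := fun i b => by
    have h1 := abs_le.1 (hg i b)
    have h2 := abs_le.1 (he i)
    rw [abs_le]
    constructor <;> linarith
  -- Centered and halved, the variables are again bounded by 1, with total variance at most the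
  -- number `N` of coordinates. The exponent is then `-(θ/4)(θ/2)N + (θ/4)²N = -θ²N/16`.
  have h := prob_sum_ge_le μ (g := fun i b => (g i b - expect (μ i) (g i)) / 2) (l := θ / 4)
    (v := Fintype.card ι) (t := θ / 2 * Fintype.card ι) hb
    (fun i => by simp only [div_eq_mul_inv, expect_mul_const, expect_sub, expect_const]; simp)
    ((Finset.sum_le_sum fun i _ => expect_le_const (c := 1) _ fun b => by
      have := hb i b
      rw [← sq_abs]
      nlinarith [abs_nonneg ((g i b - expect (μ i) (g i)) / 2)]).trans_eq (by simp))
    (by linarith) (by linarith)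
  refine (prob_mono _ fun x hx => ?_).trans (h.trans_eq ?_)
  · simp only [Set.mem_ofPred_eq, ← Finset.sum_div, Finset.sum_sub_distrib] at hx ⊢
    linarith
  · congr 1
    ring

theorem hoeffding_lower (μ : ∀ i, PMF (β i)) {g : ∀ i, β i → ℝ} {θ : ℝ}
    (hg : ∀ i b, |g i b| ≤ 1) (hθ0 : 0 ≤ θ) (hθ1 : θ ≤ 1) :
    prob (piPMF μ) {x | ∑ i, g i (x i) ≤ ∑ i, expect (μ i) (g i) - θ * Fintype.card ι} ≤
      Real.exp (-(θ ^ 2 * Fintype.card ι / 16)) := by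
  refine (prob_mono _ fun x hx => ?_).trans (hoeffding μ (g := fun i b => - g i b)
    (by simpa using hg) hθ0 hθ1)
  simp only [Set.mem_ofPred_eq, expect_neg, Finset.sum_neg_distrib] at hx ⊢
  linarith

theorem hoeffding_abs (μ : ∀ i, PMF (β i)) {g : ∀ i, β i → ℝ} {θ : ℝ}
    (hg : ∀ i b, |g i b| ≤ 1) (hθ0 : 0 ≤ θ) (hθ1 : θ ≤ 1) :
    prob (piPMF μ) {x | θ * Fintype.card ι ≤ |∑ i, g i (x i) - ∑ i, expect (μ i) (g i)|} ≤
      2 * Real.exp (-(θ ^ 2 * Fintype.card ι / 16)) := by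
  refine (prob_mono _ fun x hx => ?_).trans ((prob_union_le _ _ _).trans
    ((add_le_add (hoeffding μ hg hθ0 hθ1) (hoeffding_lower μ hg hθ0 hθ1)).trans_eq
      (two_mul _).symm))
  rw [Set.mem_ofPred_eq] at hx
  rcases le_abs.1 hx with h | h
  · left
    simp only [Set.mem_ofPred_eq]
    linarith
  · right
    simp only [Set.mem_ofPred_eq]
    linarith

end Product

end BooleanBlock

namespace BooleanBlock

/-! ### The standard normal distribution function -/

section Gaussian

open MeasureTheory ProbabilityTheory Filter Topology

/-- The standard normal distribution function. -/
noncomputable def normalCDF (x : ℝ) : ℝ := (gaussianReal 0 1).real (Set.Iic x)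

theorem normalCDF_sub {x y : ℝ} (h : x ≤ y) :
    normalCDF y - normalCDF x = (gaussianReal 0 1).real (Set.Ioc x y) := by
  rw [normalCDF, normalCDF, ← measureReal_sdiff (Set.Iic_subset_Iic.2 h) measurableSet_Iic]
  congr 1
  ext z
  simp [and_comm]

theorem gaussianReal_Ioc (x y : ℝ) :
    (gaussianReal 0 1).real (Set.Ioc x y) = ∫ z in Set.Ioc x y, gaussianPDFReal 0 1 z := by
  rw [Measure.real, gaussianReal_apply_eq_integral 0 one_ne_zero, ENNReal.toReal_ofReal]
  exact integral_nonneg fun z => gaussianPDFReal_nonneg 0 1 z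

theorem normalCDF_sub_le {x y : ℝ} (h : x ≤ y) : normalCDF y - normalCDF x ≤ y - x := by
  rw [normalCDF_sub h, gaussianReal_Ioc]
  have h1 : ∀ z, gaussianPDFReal 0 1 z ≤ 1 := fun z => by
    rw [gaussianPDFReal]
    have h2 : (√(2 * Real.pi * (1 : NNReal)))⁻¹ ≤ 1 := by
      apply inv_le_one_of_one_le₀
      rw [Real.one_le_sqrt]
      have := Real.pi_gt_three
      push_cast
      linarith
    have h3 : Real.exp (-(z - 0) ^ 2 / (2 * (1 : NNReal))) ≤ 1 := by
      rw [Real.exp_le_one_iff]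
      push_cast
      nlinarith [sq_nonneg (z - 0)]
    exact mul_le_one₀ h2 (Real.exp_pos _).le h3
  calc ∫ z in Set.Ioc x y, gaussianPDFReal 0 1 z ≤ ∫ z in Set.Ioc x y, (1 : ℝ) :=
        setIntegral_mono (integrable_gaussianPDFReal 0 1).integrableOn
          (integrableOn_const (by simp)) h1
    _ = y - x := by simp [h]

/-- On `[-M, M]` the density is at least its value at `M`. This turns a difference of normalized
means into a difference of probabilities. -/
theorem exists_le_normalCDF_sub (M : ℝ) :
    ∃ c > 0, ∀ x y, -M ≤ x → x ≤ y → y ≤ M → c * (y - x) ≤ normalCDF y - normalCDF x := by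
  refine ⟨gaussianPDFReal 0 1 M, gaussianPDFReal_pos 0 1 M one_ne_zero, fun x y hx h hy => ?_⟩
  rw [normalCDF_sub h, gaussianReal_Ioc]
  calc gaussianPDFReal 0 1 M * (y - x) = ∫ z in Set.Ioc x y, gaussianPDFReal 0 1 M := by
        simp [h, mul_comm]
    _ ≤ ∫ z in Set.Ioc x y, gaussianPDFReal 0 1 z := by
        refine setIntegral_mono_on (integrableOn_const (by simp))
          (integrable_gaussianPDFReal 0 1).integrableOn measurableSet_Ioc fun z hz => ?_
        simp only [gaussianPDFReal]
        refine mul_le_mul_of_nonneg_left (Real.exp_le_exp.2 ?_) (by positivity)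
        have : (z - 0) ^ 2 ≤ (M - 0) ^ 2 := by
          rw [sub_zero, sub_zero]
          exact sq_le_sq' (by linarith [hz.1]) (by linarith [hz.2])
        push_cast
        linarith

theorem normalCDF_mono : Monotone normalCDF := fun _ _ h =>
  measureReal_mono (Set.Iic_subset_Iic.2 h)

theorem normalCDF_strictMono : StrictMono normalCDF := fun x y h => by
  obtain ⟨c, hc, H⟩ := exists_le_normalCDF_sub (max |x| |y|)
  have h1 := H x y (by linarith [neg_abs_le x, le_max_left |x| |y|]) h.le
    ((le_abs_self y).trans (le_max_right _ _))
  nlinarith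

theorem normalCDF_nonneg (x : ℝ) : 0 ≤ normalCDF x := measureReal_nonneg

theorem normalCDF_le_one (x : ℝ) : normalCDF x ≤ 1 := measureReal_le_one

theorem normalCDF_continuous : Continuous normalCDF := by
  have : LipschitzWith 1 normalCDF := LipschitzWith.of_le_add_mul 1 fun x y => by
    rcases le_total x y with h | h
    · have := normalCDF_mono h
      have := dist_nonneg (x := x) (y := y)
      simp only [NNReal.coe_one, one_mul]
      linarith
    · have := normalCDF_sub_le h
      rw [Real.dist_eq, abs_of_nonneg (by linarith)]
      simp only [NNReal.coe_one, one_mul]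
      linarith
  exact this.continuous

theorem exists_normalCDF_eq {u : ℝ} (h0 : 0 < u) (h1 : u < 1) : ∃ x, normalCDF x = u := by
  have e : normalCDF = cdf (gaussianReal 0 1) := funext fun x => (cdf_eq_real _ x).symm
  have hb := tendsto_cdf_atBot (gaussianReal 0 1)
  have ht := tendsto_cdf_atTop (gaussianReal 0 1)
  rw [← e] at hb ht
  obtain ⟨x, hx⟩ := (hb.eventually (ge_mem_nhds h0)).exists
  obtain ⟨y, hy⟩ := (ht.eventually (le_mem_nhds h1)).exists
  exact mem_range_of_exists_le_of_exists_ge normalCDF_continuous ⟨x, hx⟩ ⟨y, hy⟩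

/-- Closeness of characteristic functions implies closeness of distribution functions. -/
theorem exists_charFun_close {τ : ℝ} (hτ : 0 < τ) :
    ∃ δ > 0, ∀ ν : Measure ℝ, IsProbabilityMeasure ν →
      (∀ t, |t| ≤ 1 / δ → ‖charFun ν t - charFun (gaussianReal 0 1) t‖ ≤ δ * |t| ^ 3) →
      ∀ x, ν.real (Set.Iic x) ≤ normalCDF x + τ ∧ normalCDF x - τ ≤ ν.real (Set.Iio x) := by
  -- Compactness: a sequence of counterexamples for `δ = 1/(k+1)` has characteristic functions
  -- converging pointwise, hence converges weakly by Lévy's theorem. Pólya's argument on a finite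
  -- grid of quantiles makes the convergence of distribution functions uniform, a contradiction.
  by_contra! H
  have hk : ∀ k : ℕ, (0 : ℝ) < 1 / (k + 1) := fun k => by positivity
  choose ν hν hchar x hx using fun k : ℕ => H _ (hk k)
  have hlim : ∀ t, Tendsto (fun k => charFun (ν k) t) atTop
      (𝓝 (charFun (gaussianReal 0 1) t)) := by
    intro t
    rw [tendsto_iff_norm_sub_tendsto_zero]
    have h0 : Tendsto (fun k : ℕ => 1 / ((k : ℝ) + 1) * |t| ^ 3) atTop (𝓝 0) := by
      simpa using tendsto_one_div_add_atTop_nhds_zero_nat.mul_const (|t| ^ 3)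
    refine squeeze_zero' (Eventually.of_forall fun k => norm_nonneg _) ?_ h0
    obtain ⟨m, hm⟩ := exists_nat_ge |t|
    filter_upwards [eventually_ge_atTop m] with k hkm
    refine hchar k t ?_
    have : (m : ℝ) ≤ k := Nat.cast_le.2 hkm
    rw [one_div_one_div]
    linarith
  let P : ℕ → ProbabilityMeasure ℝ := fun k => ⟨ν k, hν k⟩
  let G : ProbabilityMeasure ℝ := ⟨gaussianReal 0 1, inferInstance⟩
  have hweak : Tendsto P atTop (𝓝 G) := ProbabilityMeasure.tendsto_of_tendsto_charFun hlim
  have hset : ∀ E : Set ℝ, gaussianReal 0 1 (frontier E) = 0 →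
      Tendsto (fun k => (ν k).real E) atTop (𝓝 ((gaussianReal 0 1).real E)) := fun E hE => by
    have h1 := ProbabilityMeasure.tendsto_measure_of_null_frontier_of_tendsto' hweak
      (E := E) hE
    exact (ENNReal.tendsto_toReal (measure_ne_top _ _)).comp h1
  have hnull : ∀ a : ℝ, gaussianReal 0 1 {a} = 0 := fun a =>
    gaussianReal_absolutelyContinuous 0 one_ne_zero Real.volume_singleton
  have hIic : ∀ y, Tendsto (fun k => (ν k).real (Set.Iic y)) atTop (𝓝 (normalCDF y)) :=
    fun y => hset _ (by rw [frontier_Iic]; exact hnull y)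
  have hIio : ∀ y, Tendsto (fun k => (ν k).real (Set.Iio y)) atTop (𝓝 (normalCDF y)) :=
    fun y => by
      have h1 := hset (Set.Iio y) (by rw [frontier_Iio]; exact hnull y)
      have h2 : (gaussianReal 0 1).real (Set.Iio y) = normalCDF y := by
        rw [normalCDF, ← Set.Iio_union_right, measureReal_union (by simp) (by simp)]
        simp [Measure.real, hnull y]
      rwa [h2] at h1
  obtain ⟨m, hm⟩ := exists_nat_gt (2 / τ)
  have hm0 : (0 : ℝ) < m := lt_trans (by positivity) hm
  have hmτ : 2 / (m : ℝ) < τ := by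
    rw [div_lt_iff₀ hτ] at hm
    rw [div_lt_iff₀ hm0]
    linarith
  -- The grid consists of the quantiles at `i/m` for `0 < i < m`; the value at `i = 0` is a dummy.
  have hgrid : ∀ i : Fin m, ∃ y, i.1 ≠ 0 → normalCDF y = i.1 / m := fun i => by
    by_cases hi : i.1 = 0
    · exact ⟨0, fun h => absurd hi h⟩
    · obtain ⟨y, hy⟩ := exists_normalCDF_eq (u := i.1 / m)
        (div_pos (by exact_mod_cast Nat.pos_of_ne_zero hi) hm0)
        ((div_lt_one hm0).2 (by exact_mod_cast i.2))
      exact ⟨y, fun _ => hy⟩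
  choose y hy using hgrid
  have hm1 : (0 : ℝ) < 1 / m := by positivity
  have hev : ∀ᶠ k in atTop, ∀ i : Fin m, (ν k).real (Set.Iic (y i)) < normalCDF (y i) + 1 / m ∧
      normalCDF (y i) - 1 / m < (ν k).real (Set.Iio (y i)) := by
    rw [eventually_all]
    intro i
    exact ((hIic (y i)).eventually (gt_mem_nhds (by linarith))).and
      ((hIio (y i)).eventually (lt_mem_nhds (by linarith)))
  obtain ⟨k, hk⟩ := hev.exists
  have := hν k
  have h2m : 2 / (m : ℝ) = 1 / m + 1 / m := by ring
  have hfl := Nat.floor_le (mul_nonneg hm0.le (normalCDF_nonneg (x k)))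
  have hfl' := Nat.lt_floor_add_one (m * normalCDF (x k))
  -- Now `x k` lies between the quantiles at `i/m` and `(i+1)/m`, and monotonicity costs `1/m` on
  -- top of the error `1/m` at the grid points. At the ends of the grid the bounds 0 and 1 take the
  -- place of the missing quantiles.
  set i := ⌊(m : ℝ) * normalCDF (x k)⌋₊ with hi
  have hlo : (i : ℝ) / m ≤ normalCDF (x k) := by
    rw [div_le_iff₀ hm0]; linarith
  have hhi : normalCDF (x k) < (i : ℝ) / m + 1 / m := by
    rw [← add_div, lt_div_iff₀ hm0]; linarith
  refine absurd (hx k ?_) (not_lt.2 ?_)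
  · by_cases him : i + 1 < m
    · have h1 := (hk ⟨i + 1, him⟩).1
      have h2 := hy ⟨i + 1, him⟩ (Nat.succ_ne_zero i)
      simp only [Nat.cast_add, Nat.cast_one, add_div] at h2
      have h3 : x k ≤ y ⟨i + 1, him⟩ := (normalCDF_strictMono.lt_iff_lt.1 (by linarith)).le
      have h4 := measureReal_mono (μ := ν k) (Set.Iic_subset_Iic.2 h3)
      linarith
    · have h1 : (m : ℝ) ≤ i + 1 := by exact_mod_cast not_lt.1 him
      have h2 : 1 ≤ (i : ℝ) / m + 1 / m := by rw [← add_div, le_div_iff₀ hm0]; linarith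
      have h3 : (ν k).real (Set.Iic (x k)) ≤ 1 := measureReal_le_one
      linarith
  · by_cases hi0 : i = 0
    · have h3 : 0 ≤ (ν k).real (Set.Iio (x k)) := measureReal_nonneg
      rw [hi0] at hhi
      simp only [Nat.cast_zero, zero_div] at hhi
      linarith
    · by_cases him : i < m
      · have h1 := (hk ⟨i, him⟩).2
        have h2 := hy ⟨i, him⟩ hi0
        simp only at h2
        have h3 : y ⟨i, him⟩ ≤ x k := normalCDF_strictMono.le_iff_le.1 (by linarith)
        have h4 := measureReal_mono (μ := ν k) (Set.Iio_subset_Iio h3)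
        linarith
      · have h1 : (m : ℝ) ≤ i := by exact_mod_cast not_lt.1 him
        have h2 : normalCDF (x k) = 1 := le_antisymm (normalCDF_le_one _)
          (((one_le_div hm0).2 h1).trans hlo)
        have h3 := normalCDF_strictMono (lt_add_one (x k))
        linarith [normalCDF_le_one (x k + 1)]

end Gaussian

end BooleanBlock

namespace BooleanBlock

/-! ### The central limit theorem for bounded independent variables -/

section CLT

open MeasureTheory ProbabilityTheory Filter Topology

/-- Replace one factor at a time; the remaining factors lie in the unit disc and do not enlarge the
error. -/
theorem norm_prod_sub_prod_le {ι : Type} (s : Finset ι) (a b : ι → ℂ)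
    (ha : ∀ i ∈ s, ‖a i‖ ≤ 1) (hb : ∀ i ∈ s, ‖b i‖ ≤ 1) :
    ‖∏ i ∈ s, a i - ∏ i ∈ s, b i‖ ≤ ∑ i ∈ s, ‖a i - b i‖ := by
  classical
  induction s using Finset.induction_on with
  | empty => simp
  | insert i s hi ih =>
    rw [Finset.prod_insert hi, Finset.prod_insert hi, Finset.sum_insert hi]
    have h1 : a i * ∏ j ∈ s, a j - b i * ∏ j ∈ s, b j =
        (a i - b i) * ∏ j ∈ s, a j + b i * (∏ j ∈ s, a j - ∏ j ∈ s, b j) := by ring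
    rw [h1]
    refine (norm_add_le _ _).trans (add_le_add ?_ ?_)
    · rw [norm_mul]
      refine mul_le_of_le_one_right (norm_nonneg _) ?_
      rw [norm_prod]
      exact Finset.prod_le_one (fun _ _ => norm_nonneg _)
        fun j hj => ha j (Finset.mem_insert_of_mem hj)
    · rw [norm_mul]
      exact (mul_le_of_le_one_left (norm_nonneg _) (hb i (Finset.mem_insert_self i s))).trans
        (ih (fun j hj => ha j (Finset.mem_insert_of_mem hj))
          fun j hj => hb j (Finset.mem_insert_of_mem hj))

/-- The characteristic function of a function on a finite probability space. -/
noncomputable def charSum {α : Type} [Fintype α] (μ : PMF α) (g : α → ℝ) (u : ℝ) : ℂ :=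
  ∑ a, ((μ a).toReal : ℂ) * Complex.exp (u * g a * Complex.I)

theorem norm_charSum_le {α : Type} [Fintype α] (μ : PMF α) (g : α → ℝ) (u : ℝ) :
    ‖charSum μ g u‖ ≤ 1 := by
  refine (norm_sum_le _ _).trans ((Finset.sum_le_sum fun a _ => ?_).trans_eq (sum_toReal μ))
  rw [norm_mul, ← Complex.ofReal_mul, Complex.norm_exp_ofReal_mul_I, mul_one, Complex.norm_real,
    Real.norm_of_nonneg ENNReal.toReal_nonneg]

/-- Both functions agree with `1 - u²w/2`, where `w` is the variance, up to third order in `u`: the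
cubic Taylor remainder contributes `3|u|³w`, and the expansion of the Gaussian factor `|u|³w`. -/
theorem norm_charSum_sub_le {α : Type} [Fintype α] (μ : PMF α) {g : α → ℝ} {u : ℝ}
    (hg : ∀ a, |g a| ≤ 1) (h0 : expect μ g = 0) (hu : |u| ≤ 1) :
    ‖charSum μ g u - Complex.exp (-(u ^ 2 * expect μ (fun a => g a ^ 2) / 2 : ℝ))‖ ≤
      4 * |u| ^ 3 * expect μ fun a => g a ^ 2 := by
  set w := expect μ fun a => g a ^ 2 with hw
  have hw0 : 0 ≤ w := expect_nonneg μ fun a => sq_nonneg _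
  have hw1 : w ≤ 1 := expect_le_const μ fun a => by
    rw [← sq_abs]
    nlinarith [hg a, abs_nonneg (g a)]
  have hu0 := abs_nonneg u
  set R : α → ℂ := fun a => Complex.exp (u * g a * Complex.I) -
    (1 + u * g a * Complex.I - u ^ 2 * g a ^ 2 / 2) with hR
  have hRb : ∀ a, ‖R a‖ ≤ 3 * |u| ^ 3 * g a ^ 2 := fun a => by
    have h1 := Complex.norm_exp_sub_sum_le_norm_mul_exp (u * g a * Complex.I) 3
    have h2 : ∑ m ∈ Finset.range 3, (u * g a * Complex.I : ℂ) ^ m / m.factorial =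
        1 + u * g a * Complex.I - u ^ 2 * g a ^ 2 / 2 := by
      simp only [Finset.sum_range_succ, Finset.sum_range_zero, Nat.factorial]
      push_cast
      linear_combination (u * g a : ℂ) ^ 2 / 2 * Complex.I_sq
    rw [h2] at h1
    have hn : ‖(u * g a * Complex.I : ℂ)‖ = |u| * |g a| := by simp
    rw [hn] at h1
    refine h1.trans ?_
    have hga := hg a
    have hga0 := abs_nonneg (g a)
    have h3 : Real.exp (|u| * |g a|) ≤ 3 :=
      (Real.exp_le_exp.2 (mul_le_one₀ hu hga0 hga)).trans Real.exp_one_lt_three.le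
    calc (|u| * |g a|) ^ 3 * Real.exp (|u| * |g a|) ≤ (|u| * |g a|) ^ 3 * 3 := by gcongr
      _ = 3 * |u| ^ 3 * (|g a| ^ 2 * |g a|) := by ring
      _ ≤ 3 * |u| ^ 3 * (|g a| ^ 2 * 1) := by gcongr
      _ = 3 * |u| ^ 3 * g a ^ 2 := by rw [sq_abs, mul_one]
  have hsum : charSum μ g u = (1 - (u ^ 2 * w / 2 : ℝ)) + ∑ a, ((μ a).toReal : ℂ) * R a := by
    have e1 : (∑ a, ((μ a).toReal : ℂ)) = 1 := by exact_mod_cast sum_toReal μ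
    have e2 : (∑ a, ((μ a).toReal : ℂ) * g a) = 0 := by exact_mod_cast h0
    have e3 : (∑ a, ((μ a).toReal : ℂ) * g a ^ 2) = w := by
      rw [hw, expect]
      push_cast
      rfl
    have e4 : ∀ a, ((μ a).toReal : ℂ) * Complex.exp (u * g a * Complex.I) =
        ((μ a).toReal : ℂ) + u * Complex.I * (((μ a).toReal : ℂ) * g a) -
        u ^ 2 / 2 * (((μ a).toReal : ℂ) * g a ^ 2) + ((μ a).toReal : ℂ) * R a := fun a => by
      simp only [hR]
      ring
    rw [charSum, Finset.sum_congr rfl fun a _ => e4 a, Finset.sum_add_distrib,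
      Finset.sum_sub_distrib, Finset.sum_add_distrib, ← Finset.mul_sum, ← Finset.mul_sum, e1, e2,
      e3]
    push_cast
    ring
  have hRsum : ‖∑ a, ((μ a).toReal : ℂ) * R a‖ ≤ 3 * |u| ^ 3 * w := by
    rw [hw, ← expect_const_mul]
    refine (norm_sum_le _ _).trans (Finset.sum_le_sum fun a _ => ?_)
    rw [norm_mul, Complex.norm_real, Real.norm_of_nonneg ENNReal.toReal_nonneg]
    exact mul_le_mul_of_nonneg_left (hRb a) ENNReal.toReal_nonneg
  have hu2 : u ^ 2 ≤ 1 := by rw [← sq_abs]; nlinarith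
  have hy : |-(u ^ 2 * w / 2)| ≤ 1 := by
    rw [abs_neg, abs_of_nonneg (by positivity)]
    nlinarith [sq_nonneg u]
  have hE : ‖Complex.exp (-(u ^ 2 * w / 2 : ℝ)) - (1 - (u ^ 2 * w / 2 : ℝ))‖ ≤ |u| ^ 3 * w := by
    have h1 := Real.abs_exp_sub_one_sub_id_le hy
    have h2 : Complex.exp (-(u ^ 2 * w / 2 : ℝ)) - (1 - (u ^ 2 * w / 2 : ℝ)) =
        ((Real.exp (-(u ^ 2 * w / 2)) - 1 - -(u ^ 2 * w / 2) : ℝ) : ℂ) := by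
      push_cast
      ring
    rw [h2, Complex.norm_real, Real.norm_eq_abs]
    refine h1.trans ?_
    have h3 : (-(u ^ 2 * w / 2)) ^ 2 = |u| ^ 3 * w * (|u| * w / 4) := by
      rw [← sq_abs u]
      ring
    rw [h3]
    refine mul_le_of_le_one_right (by positivity) ?_
    nlinarith
  calc ‖charSum μ g u - Complex.exp (-(u ^ 2 * w / 2 : ℝ))‖
      = ‖∑ a, ((μ a).toReal : ℂ) * R a -
          (Complex.exp (-(u ^ 2 * w / 2 : ℝ)) - (1 - (u ^ 2 * w / 2 : ℝ)))‖ := by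
        rw [hsum]
        congr 1
        ring
    _ ≤ 3 * |u| ^ 3 * w + |u| ^ 3 * w := (norm_sub_le _ _).trans (add_le_add hRsum hE)
    _ = 4 * |u| ^ 3 * w := by ring

variable {ι : Type} [Fintype ι] [DecidableEq ι] {β : ι → Type} [∀ i, Fintype (β i)]

theorem charSum_piPMF (μ : ∀ i, PMF (β i)) (g : ∀ i, β i → ℝ) (u : ℝ) :
    charSum (piPMF μ) (fun x => ∑ i, g i (x i)) u = ∏ i, charSum (μ i) (g i) u := by
  simp only [charSum, piPMF_apply_toReal]
  rw [Finset.prod_univ_sum, Fintype.piFinset_univ]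
  refine Finset.sum_congr rfl fun x _ => ?_
  rw [Finset.prod_mul_distrib, ← Complex.exp_sum]
  push_cast
  rw [Finset.mul_sum, Finset.sum_mul]

theorem norm_charSum_piPMF_sub_le (μ : ∀ i, PMF (β i)) {g : ∀ i, β i → ℝ} {u : ℝ}
    (hg : ∀ i a, |g i a| ≤ 1) (h0 : ∀ i, expect (μ i) (g i) = 0) (hu : |u| ≤ 1) :
    ‖charSum (piPMF μ) (fun x => ∑ i, g i (x i)) u -
      Complex.exp (-(u ^ 2 * (∑ i, expect (μ i) fun a => g i a ^ 2) / 2 : ℝ))‖ ≤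
      4 * |u| ^ 3 * ∑ i, expect (μ i) fun a => g i a ^ 2 := by
  have h1 : Complex.exp (-(u ^ 2 * (∑ i, expect (μ i) fun a => g i a ^ 2) / 2 : ℝ)) =
      ∏ i, Complex.exp (-(u ^ 2 * expect (μ i) (fun a => g i a ^ 2) / 2 : ℝ)) := by
    rw [← Complex.exp_sum]
    push_cast
    rw [Finset.mul_sum, Finset.sum_div, Finset.sum_neg_distrib]
  rw [charSum_piPMF, h1, Finset.mul_sum]
  refine (norm_prod_sub_prod_le _ _ _ (fun i _ => norm_charSum_le _ _ _) fun i _ => ?_).trans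
    (Finset.sum_le_sum fun i _ => norm_charSum_sub_le (μ i) (hg i) (h0 i) hu)
  rw [← Complex.ofReal_neg, Complex.norm_exp_ofReal, Real.exp_le_one_iff, neg_nonpos]
  have := expect_nonneg (μ i) fun a => sq_nonneg (g i a)
  positivity

/-- The law of a real random variable on a finite probability space. -/
theorem exists_law {α : Type} [Fintype α] (μ : PMF α) (Y : α → ℝ) :
    ∃ ν : Measure ℝ, IsProbabilityMeasure ν ∧ (∀ t, charFun ν t = charSum μ Y t) ∧
      (∀ x, ν.real (Set.Iic x) = prob μ {a | Y a ≤ x}) ∧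
      ∀ x, ν.real (Set.Iio x) = prob μ {a | Y a < x} := by
  let _ : MeasurableSpace α := ⊤
  have hY : Measurable Y := measurable_from_top
  refine ⟨μ.toMeasure.map Y, Measure.isProbabilityMeasure_map hY.aemeasurable, fun t => ?_,
    fun x => ?_, fun x => ?_⟩
  · rw [charFun_apply_real, integral_map hY.aemeasurable (by fun_prop), PMF.integral_eq_sum]
    simp only [charSum, Complex.real_smul]
  · rw [Measure.real, Measure.map_apply hY measurableSet_Iic,
      PMF.toMeasure_apply_eq_toOuterMeasure]
    rfl
  · rw [Measure.real, Measure.map_apply hY measurableSet_Iio,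
      PMF.toMeasure_apply_eq_toOuterMeasure]
    rfl

/-- The central limit theorem for sums of bounded independent variables, uniformly in the
variables. -/
theorem exists_normal_approx {τ : ℝ} (hτ : 0 < τ) :
    ∃ V > 0, ∀ (ι : Type) [Fintype ι] [DecidableEq ι] (β : ι → Type) [∀ i, Fintype (β i)]
      (μ : ∀ i, PMF (β i)) (g : ∀ i, β i → ℝ), (∀ i b, |g i b| ≤ 1) →
      (∀ i, expect (μ i) (g i) = 0) → ∀ v, ∑ i, expect (μ i) (fun b => g i b ^ 2) = v → V ≤ v →
      ∀ z, prob (piPMF μ) {x | ∑ i, g i (x i) ≤ z} ≤ normalCDF (z / √v) + τ ∧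
        normalCDF (z / √v) - τ ≤ prob (piPMF μ) {x | ∑ i, g i (x i) < z} := by
  obtain ⟨δ, hδ, H⟩ := exists_charFun_close hτ
  -- `√v ≥ 1/δ` brings `t/√v` into the range `|u| ≤ 1` of the expansion, and `√v ≥ 4/δ` makes its
  -- error `(4/√v)|t|³` at most `δ|t|³`.
  refine ⟨(4 / δ) ^ 2 + (1 / δ) ^ 2, by positivity, ?_⟩
  intro ι _ _ β _ μ g hg h0 v hv hV z
  have hv0 : 0 < v := lt_of_lt_of_le (by positivity) hV
  have hs : 0 < √v := Real.sqrt_pos.2 hv0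
  have hs1 : 4 / δ ≤ √v := Real.le_sqrt_of_sq_le (by nlinarith [sq_nonneg (1 / δ)])
  have hs2 : 1 / δ ≤ √v := Real.le_sqrt_of_sq_le (by nlinarith [sq_nonneg (4 / δ)])
  obtain ⟨ν, hν, hc, hle, hlt⟩ := exists_law (piPMF μ) fun x => (∑ i, g i (x i)) / √v
  have key := H ν hν (fun t ht => ?_) (z / √v)
  · rw [hle, hlt] at key
    simpa only [div_le_div_iff_of_pos_right hs, div_lt_div_iff_of_pos_right hs] using key
  · have hu : |t / √v| ≤ 1 := by
      rw [abs_div, abs_of_pos hs, div_le_one hs]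
      exact ht.trans hs2
    have h1 := norm_charSum_piPMF_sub_le μ hg h0 hu
    have h2 : charFun ν t = charSum (piPMF μ) (fun x => ∑ i, g i (x i)) (t / √v) := by
      rw [hc]
      simp only [charSum]
      refine Finset.sum_congr rfl fun x _ => ?_
      congr 2
      push_cast
      ring
    have h3 : charFun (gaussianReal 0 1) t =
        Complex.exp (-((t / √v) ^ 2 * (∑ i, expect (μ i) fun a => g i a ^ 2) / 2 : ℝ)) := by
      rw [charFun_gaussianReal, hv, div_pow, Real.sq_sqrt hv0.le, div_mul_cancel₀ _ hv0.ne']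
      congr 1
      push_cast
      ring
    rw [h2, h3]
    refine h1.trans ?_
    rw [hv, abs_div, abs_of_pos hs, div_pow]
    have h4 : 4 * (|t| ^ 3 / √v ^ 3) * v = 4 / √v * |t| ^ 3 := by
      have : v = √v ^ 2 := (Real.sq_sqrt hv0.le).symm
      nth_rewrite 2 [this]
      field_simp
    rw [h4]
    refine mul_le_mul_of_nonneg_right ?_ (by positivity)
    rw [div_le_iff₀ hs]
    rwa [div_le_iff₀' hδ] at hs1

end CLT

end BooleanBlock

namespace BooleanBlock

theorem prob_bind_ge {α β : Type} [Fintype α] [Fintype β] (μ : PMF α) (κ : α → PMF β)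
    {S : Set α} {T : Set β} {e : ℝ} (he : 0 ≤ e) (h : ∀ a ∈ S, 1 - e ≤ prob (κ a) T) :
    prob μ S - e ≤ prob (μ.bind κ) T := by
  classical
  rw [prob_bind, prob_eq_expect, sub_eq_add_neg, ← expect_const μ (-e), ← expect_add]
  refine expect_mono μ fun a => ?_
  split_ifs with ha
  · linarith [h a ha]
  · linarith [prob_nonneg (κ a) T]

/-! ### Hamming distances of Boolean vectors -/

/-- The numerical value of a bit. -/
def bit (b : Bool) : ℝ := if b then 1 else 0

@[simp] theorem bit_true : bit true = 1 := rfl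

@[simp] theorem bit_false : bit false = 0 := by simp [bit]

theorem bit_mem (b : Bool) : 0 ≤ bit b ∧ bit b ≤ 1 := by cases b <;> simp

/-- The distance of `x` to `u` minus the distance of `x` to `v`, as a sum over features. -/
def gap {d : ℕ} (u v x : Fin d → Bool) : ℝ :=
  ∑ j, (bit (u j) - bit (v j)) * (1 - 2 * bit (x j))

theorem hammingDist_eq_sum {d : ℕ} (x y : Fin d → Bool) :
    (hammingDist x y : ℝ) = ∑ j, if x j = y j then (0 : ℝ) else 1 := by
  simp [hammingDist, Finset.sum_ite]

theorem gap_eq {d : ℕ} (u v x : Fin d → Bool) :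
    gap u v x = hammingDist x u - hammingDist x v := by
  rw [hammingDist_eq_sum, hammingDist_eq_sum, ← Finset.sum_sub_distrib]
  refine Finset.sum_congr rfl fun j _ => ?_
  cases u j <;> cases v j <;> cases x j <;> norm_num

theorem gap_swap {d : ℕ} (u v x : Fin d → Bool) : gap v u x = - gap u v x := by
  rw [gap_eq, gap_eq]
  ring

theorem fin_two_eq_or {i k k' : Fin 2} (h : k ≠ k') : i = k ∨ i = k' := by omega

theorem nearest_of_gap_neg {d : ℕ} (c : Fin 2 → Fin d → Bool) (x : Fin d → Bool) {k k' : Fin 2}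
    (hk : k ≠ k') (h : gap (c k) (c k') x < 0) : nearest c x = {k} := by
  rw [gap_eq, sub_neg, Nat.cast_lt] at h
  ext i
  rw [nearest, Finset.mem_filter, Finset.mem_singleton]
  constructor
  · rintro ⟨-, hi⟩
    rcases fin_two_eq_or (i := i) hk with rfl | rfl
    · rfl
    · exact absurd (hi k) (not_le.2 h)
  · rintro rfl
    refine ⟨Finset.mem_univ _, fun i' => ?_⟩
    rcases fin_two_eq_or (i := i') hk with rfl | rfl
    · exact le_rfl
    · exact h.le

theorem nearest_of_gap_zero {d : ℕ} (c : Fin 2 → Fin d → Bool) (x : Fin d → Bool)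
    (h : gap (c 0) (c 1) x = 0) : nearest c x = Finset.univ := by
  rw [gap_eq, sub_eq_zero, Nat.cast_inj] at h
  ext i
  simp only [nearest, Finset.mem_filter, Finset.mem_univ, true_and, iff_true]
  intro i'
  fin_cases i <;> fin_cases i' <;> simp [h]

/-! ### One point in the assignment step -/

/-- The law of the label of the point `x` for given centers. -/
noncomputable def choice {d : ℕ} (c : Fin 2 → Fin d → Bool) (x : Fin d → Bool) : PMF (Fin 2) :=
  PMF.uniformOfFinset (nearest c x) (nearest_nonempty c x)

theorem expect_choice_of_eq {d : ℕ} {c : Fin 2 → Fin d → Bool} {x : Fin d → Bool} {k : Fin 2}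
    (h : nearest c x = {k}) (f : Fin 2 → ℝ) : expect (choice c x) f = f k := by
  rw [expect_congr_support (choice c x) (g := fun _ => f k), expect_const]
  intro i hi
  rw [choice, PMF.uniformOfFinset_apply] at hi
  rw [h] at hi
  simp only [Finset.mem_singleton] at hi
  have : i = k := by
    by_contra hne
    simp [hne] at hi
  rw [this]

theorem expect_choice_of_univ {d : ℕ} {c : Fin 2 → Fin d → Bool} {x : Fin d → Bool}
    (h : nearest c x = Finset.univ) (f : Fin 2 → ℝ) :
    expect (choice c x) f = (f 0 + f 1) / 2 := by
  simp only [expect, choice, PMF.uniformOfFinset_apply, h, Fin.sum_univ_two]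
  simp
  ring

/-! ### Runs of the algorithm -/

section Runs

variable {n d : ℕ}

/-- States as triples. -/
def stateEquiv (n k : ℕ) {d : ℕ} (A : Fin d → Type) :
    State n k A ≃ Option (Fin n → Fin k) × (Fin k → ∀ j, A j) × Bool :=
  ⟨fun s => (s.clusters, s.centers, s.halted), fun w => ⟨w.1, w.2.1, w.2.2⟩, fun _ => rfl,
    fun _ => rfl⟩

noncomputable instance (n k : ℕ) {d : ℕ} (A : Fin d → Type) [∀ j, Fintype (A j)] :
    Fintype (State n k A) :=
  open Classical in Fintype.ofEquiv _ (stateEquiv n k A).symm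

variable (ρ : Fin d → stdSimplex ℝ Bool → stdSimplex ℝ Bool) (X : Fin n → Fin d → Bool)

theorem prob_iteration {s : State n 2 fun _ : Fin d => Bool} (hs : s.halted = false)
    (J : Set (State n 2 fun _ : Fin d => Bool)) :
    prob (iteration ρ X s) J = expect (assign X s.centers) fun σ =>
      prob (update ρ X s.centers σ) {c | ⟨some σ, c, decide (s.clusters = some σ)⟩ ∈ J} := by
  rw [iteration, if_neg (by simp [hs]), prob_bind]
  congr 1
  funext σ
  rw [prob_map]
  rfl

theorem iteration_of_halted {s : State n 2 fun _ : Fin d => Bool} (hs : s.halted = true) :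
    iteration ρ X s = PMF.pure s := by
  rw [iteration, if_pos hs]

theorem prob_pure_of_mem {α : Type} [Fintype α] {a : α} {S : Set α} (h : a ∈ S) :
    prob (PMF.pure a) S = 1 := by
  classical
  rw [prob_eq_expect, expect_pure, if_pos h]

theorem stateAfter_one (seeds : Fin 2 → Fin d → Bool) :
    stateAfter ρ X seeds 1 = iteration ρ X ⟨none, seeds, false⟩ := by
  rw [stateAfter, stateAfter, PMF.pure_bind]

/-- An almost invariant set of states is left within `m` steps with small probability. -/
theorem prob_stateAfter_add (seeds : Fin 2 → Fin d → Bool)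
    {J : Set (State n 2 fun _ : Fin d => Bool)} {e : ℝ} (he : 0 ≤ e)
    (h : ∀ s ∈ J, 1 - e ≤ prob (iteration ρ X s) J) (T m : ℕ) :
    prob (stateAfter ρ X seeds T) J - m * e ≤ prob (stateAfter ρ X seeds (T + m)) J := by
  induction m with
  | zero => simp
  | succ m ih =>
    have h1 := prob_bind_ge (stateAfter ρ X seeds (T + m)) (iteration ρ X) he h
    rw [← add_assoc]
    refine le_trans ?_ h1
    push_cast
    linarith

/-- The centers `c` classify the data set as `τ` does, without ties. -/
def Separates (c : Fin 2 → Fin d → Bool) (τ : Fin n → Fin 2) : Prop :=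
  ∀ a, nearest c (X a) = {τ a}

variable {X}

theorem Separates.expect_assign {c : Fin 2 → Fin d → Bool} {τ : Fin n → Fin 2}
    (h : Separates X c τ) (f : (Fin n → Fin 2) → ℝ) : expect (assign X c) f = f τ := by
  rw [expect_congr_support (assign X c) (g := fun _ => f τ), expect_const]
  intro σ hσ
  congr 1
  funext a
  have h1 := support_piPMF hσ a
  rw [Ne, PMF.uniformOfFinset_apply] at h1
  by_contra hne
  refine h1 (if_neg ?_)
  rw [h a, Finset.mem_singleton]
  exact hne

variable (X)

/-- The states in which the planted clusters have been found. -/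
def Solved (C : Fin n → Fin 2) : Set (State n 2 fun _ : Fin d => Bool) :=
  {s | ∃ π : Equiv.Perm (Fin 2), s.clusters = some (fun a => π (C a)) ∧
    (s.halted = true ∨ Separates X s.centers fun a => π (C a))}

/-- If the run has not halted, the centers reproduce the same clusters, so this iteration halts with
them. The error is written `1 - 0` to match the almost invariant sets of `prob_stateAfter_add`. -/
theorem prob_iteration_solved (C : Fin n → Fin 2) :
    ∀ s ∈ Solved (d := d) X C, 1 - 0 ≤ prob (iteration ρ X s) (Solved X C) := by
  intro s hs
  rw [sub_zero]
  by_cases hh : s.halted = true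
  · rw [iteration_of_halted ρ X hh, prob_pure_of_mem hs]
  · obtain ⟨π, hc, h⟩ := hs
    have hsep := h.resolve_left hh
    rw [prob_iteration ρ X (by simpa using hh), hsep.expect_assign]
    refine (prob_eq_one_of_support _ _ fun c _ => ?_).ge
    exact ⟨π, rfl, Or.inl (by simp [hc])⟩

theorem prob_stateAfter_solved (C : Fin n → Fin 2) (seeds : Fin 2 → Fin d → Bool) {m T : ℕ}
    (h : m ≤ T) :
    prob (stateAfter ρ X seeds m) (Solved X C) ≤ prob (stateAfter ρ X seeds T) (Solved X C) := by
  have h1 := prob_stateAfter_add ρ X seeds le_rfl (prob_iteration_solved ρ X C) m (T - m)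
  rwa [mul_zero, sub_zero, Nat.add_sub_cancel' h] at h1

/-- If the seeds classify the data correctly, the run is successful as soon as the first centers
do, too. -/
theorem le_prob_stateAfter_of_separates (C : Fin n → Fin 2) (seeds : Fin 2 → Fin d → Bool)
    (π : Equiv.Perm (Fin 2)) (h : Separates X seeds fun a => π (C a)) {T : ℕ} (hT : 1 ≤ T) :
    prob (update ρ X seeds fun a => π (C a)) {c | Separates X c fun a => π (C a)} ≤
      prob (stateAfter ρ X seeds T) (Solved X C) := by
  refine le_trans ?_ (prob_stateAfter_solved ρ X C seeds hT)
  rw [stateAfter_one, prob_iteration ρ X rfl, h.expect_assign]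
  exact prob_mono _ fun c hc => ⟨π, rfl, Or.inr hc⟩

/-- If the first centers classify the data correctly, and centers computed from the correct
clusters do so, too, with probability at least `1 - e`, then the run is successful. -/
theorem le_prob_stateAfter_of_update (C : Fin n → Fin 2) (seeds : Fin 2 → Fin d → Bool) {e : ℝ}
    (he : 0 ≤ e)
    (h : ∀ (π : Equiv.Perm (Fin 2)) (c : Fin 2 → Fin d → Bool),
      1 - e ≤ prob (update ρ X c fun a => π (C a)) {c' | Separates X c' fun a => π (C a)})
    {T : ℕ} (hT : 2 ≤ T) :
    (expect (assign X seeds) fun σ => prob (update ρ X seeds σ)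
      {c | ∃ π : Equiv.Perm (Fin 2), Separates X c fun a => π (C a)}) - e ≤
      prob (stateAfter ρ X seeds T) (Solved X C) := by
  refine le_trans ?_ (prob_stateAfter_solved ρ X C seeds hT)
  have h1 := prob_bind_ge (stateAfter ρ X seeds 1) (iteration ρ X)
    (S := {s | s.halted = false ∧ ∃ π : Equiv.Perm (Fin 2),
      Separates X s.centers fun a => π (C a)}) (T := Solved X C) he (fun s hs => ?_)
  · refine le_trans (sub_le_sub_right ?_ e) h1
    rw [stateAfter_one, prob_iteration ρ X rfl]
    refine expect_mono _ fun σ => prob_mono _ fun c hc => ⟨?_, hc⟩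
    simp
  · obtain ⟨hh, π, hsep⟩ := hs
    rw [prob_iteration ρ X hh, hsep.expect_assign]
    refine (h π s.centers).trans (prob_mono _ fun c hc => ⟨π, rfl, Or.inr hc⟩)

/-! ### Runs of `k`-modes -/

/-- Zeros are in the majority on every feature of every cluster. -/
def ZeroModes (σ : Fin n → Fin 2) : Prop :=
  ∀ k j, ∑ a, (if σ a = k then bit (X a j) - 1 / 2 else 0) < 0

variable {X}

/-- A strict majority leaves no tie for plurality rounding, so the new centers are deterministic. -/
theorem ZeroModes.update_support {σ : Fin n → Fin 2} (h : ZeroModes X σ)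
    (c c' : Fin 2 → Fin d → Bool)
    (hc : update (fun _ => pluralityRound) X c σ c' ≠ 0) : c' = fun _ _ => false := by
  funext k j
  have h1 := support_piPMF (support_piPMF hc k) j
  have h2 := h k j
  rw [← Finset.sum_filter] at h2
  change ∑ a ∈ cluster σ k, _ < (0 : ℝ) at h2
  -- Strictness also excludes an empty cluster, whose center would have been kept.
  have hne : (cluster σ k).Nonempty := by
    rw [Finset.nonempty_iff_ne_empty]
    rintro he
    rw [he] at h2
    simp at h2
  rw [dif_pos hne] at h1
  by_contra hcon
  have hcon' : c' k j = true := by simpa using hcon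
  rw [hcon'] at h1
  refine h1 ?_
  have hcard : (0 : ℝ) < (cluster σ k).card := Nat.cast_pos.2 hne.card_pos
  have htrue : (((cluster σ k).filter fun a => X a j = true).card : ℝ) =
      ∑ a ∈ cluster σ k, bit (X a j) := by
    simp [bit]
  have hfalse : (((cluster σ k).filter fun a => X a j = false).card : ℝ) =
      (cluster σ k).card - ∑ a ∈ cluster σ k, bit (X a j) := by
    rw [eq_sub_iff_add_eq, ← htrue, ← Nat.cast_add, add_comm]
    congr 1
    have := Finset.card_filter_add_card_filter_not (s := cluster σ k) fun a => X a j = true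
    simpa using this
  rw [Finset.sum_sub_distrib, Finset.sum_const, nsmul_eq_mul] at h2
  have hlt : (histogram X (cluster σ k) hne j).1 true <
      (histogram X (cluster σ k) hne j).1 false := by
    simp only [histogram, htrue, hfalse]
    rw [div_lt_div_iff_of_pos_right hcard]
    linarith
  have hnot : ¬ ∀ b, (histogram X (cluster σ k) hne j).1 b ≤
      (histogram X (cluster σ k) hne j).1 true := fun hall => absurd (hall false) (not_le.2 hlt)
  simp only [simplexPMF, PMF.ofFintype_apply, pluralityRound, if_neg hnot, ENNReal.ofReal_zero]

variable (X)

theorem le_prob_iteration_zero (Q : Set (Fin n → Fin 2))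
    {s : State n 2 fun _ : Fin d => Bool} (hs : s.halted = false)
    (hc : s.centers = fun _ _ => false) :
    1 - prob (assign X fun _ _ => false) {σ | ¬ (σ ∈ Q ∧ ZeroModes X σ)} ≤
      prob (iteration (fun _ => pluralityRound) X s)
        {s | ∃ σ ∈ Q, s.clusters = some σ ∧ (s.halted = true ∨ s.centers = fun _ _ => false)} := by
  classical
  rw [prob_iteration _ X hs, hc, ← prob_compl, prob_eq_expect]
  refine expect_mono _ fun σ => ?_
  split_ifs with h
  · have h' : σ ∈ Q ∧ ZeroModes X σ := by
      by_contra hcon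
      exact h hcon
    refine (prob_eq_one_of_support _ _ fun c hc => ?_).ge
    exact ⟨σ, h'.1, rfl, Or.inr (h'.2.update_support _ c hc)⟩
  · exact prob_nonneg _ _

/-- From zero centers every iteration draws its labels from the same law, whatever the past, and
falls out of the good states with probability at most `e`. The first iteration only has to produce
zero centers; its clusters may be accurate, which is why the count begins with the second one and `T
≥ 2` is needed. -/
theorem le_prob_kModes_run (Q : Set (Fin n → Fin 2)) (seeds : Fin 2 → Fin d → Bool) {T : ℕ}
    (hT : 2 ≤ T) :
    prob (assign X seeds) {σ | ZeroModes X σ} -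
      T * prob (assign X fun _ _ => false) {σ | ¬ (σ ∈ Q ∧ ZeroModes X σ)} ≤
      prob (stateAfter (fun _ => pluralityRound) X seeds T) {s | ∃ σ ∈ Q, s.clusters = some σ} := by
  classical
  set e := prob (assign X fun _ _ => false) {σ | ¬ (σ ∈ Q ∧ ZeroModes X σ)} with he
  have he0 : 0 ≤ e := prob_nonneg _ _
  set J : Set (State n 2 fun _ : Fin d => Bool) :=
    {s | ∃ σ ∈ Q, s.clusters = some σ ∧ (s.halted = true ∨ s.centers = fun _ _ => false)} with hJ
  have hstep : ∀ s ∈ J, 1 - e ≤ prob (iteration (fun _ => pluralityRound) X s) J := by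
    intro s hs
    by_cases hh : s.halted = true
    · rw [iteration_of_halted _ X hh, prob_pure_of_mem hs]
      linarith
    · obtain ⟨σ, -, -, h⟩ := hs
      exact le_prob_iteration_zero X Q (by simpa using hh) (h.resolve_left hh)
  have h1 : prob (assign X seeds) {σ | ZeroModes X σ} ≤
      prob (stateAfter (fun _ => pluralityRound) X seeds 1)
        {s | s.halted = false ∧ s.centers = fun _ _ => false} := by
    rw [stateAfter_one, prob_iteration _ X rfl, prob_eq_expect]
    refine expect_mono _ fun σ => ?_
    split_ifs with h
    · refine (prob_eq_one_of_support _ _ fun c hc => ?_).ge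
      exact ⟨by simp, ZeroModes.update_support h _ c hc⟩
    · exact prob_nonneg _ _
  have h2 := prob_bind_ge (stateAfter (fun _ => pluralityRound) X seeds 1)
    (iteration (fun _ => pluralityRound) X) (T := J) he0
    (fun s (hs : s ∈ {s | s.halted = false ∧ s.centers = fun _ _ => false}) =>
      le_prob_iteration_zero X Q hs.1 hs.2)
  have h3 := prob_stateAfter_add _ X seeds he0 hstep 2 (T - 2)
  have h4 : prob (stateAfter (fun _ => pluralityRound) X seeds (2 + (T - 2))) J ≤
      prob (stateAfter (fun _ => pluralityRound) X seeds T) {s | ∃ σ ∈ Q, s.clusters = some σ} := by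
    rw [Nat.add_sub_cancel' hT]
    exact prob_mono _ fun s ⟨σ, hσ, hc, _⟩ => ⟨σ, hσ, hc⟩
  -- One failure `e` for entering the good states in the second iteration and `T - 2` for staying
  -- there.
  have h5 : ((T - 2 : ℕ) : ℝ) * e + e ≤ T * e := by
    rw [Nat.cast_sub hT]
    push_cast
    nlinarith
  have h6 : stateAfter (fun _ => pluralityRound) X seeds 2 =
      (stateAfter (fun _ => pluralityRound) X seeds 1).bind
        (iteration (fun _ => pluralityRound) X) := rfl
  rw [h6] at h3
  linarith

end Runs

end BooleanBlock

namespace BooleanBlock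

/-! ### Asymptotics -/

section Asymptotics

open Filter Topology

theorem exists_log_sq_large (c : ℝ) :
    ∃ N : ℕ, ∀ n d : ℕ, N ≤ n → Real.log n ^ 2 ≤ d → c ≤ d := by
  have h : Tendsto (fun n : ℕ => Real.log n ^ 2) atTop atTop :=
    (tendsto_pow_atTop two_ne_zero).comp (Real.tendsto_log_atTop.comp tendsto_natCast_atTop_atTop)
  obtain ⟨N, hN⟩ := eventually_atTop.1 (h.eventually_ge_atTop c)
  exact ⟨N, fun n d hn hd => (hN n hn).trans hd⟩

theorem exists_sq_mul_exp_neg_le {c ε : ℝ} (hc : 0 < c) (hε : 0 < ε) :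
    ∃ N : ℕ, ∀ n d : ℕ, N ≤ n → Real.log n ^ 2 ≤ d → (n : ℝ) ^ 2 * Real.exp (-(c * d)) ≤ ε := by
  have h1 : Tendsto (fun n : ℕ => Real.log n) atTop atTop :=
    Real.tendsto_log_atTop.comp tendsto_natCast_atTop_atTop
  -- With `log n ≥ 3/c` one has `c d ≥ c log² n ≥ 3 log n`, so the product is at most `1/n`, and
  -- `log n ≥ -log ε` makes this at most `ε`. An exponent larger than 1 on the logarithm is what
  -- makes this work.
  obtain ⟨N, hN⟩ := eventually_atTop.1 ((h1.eventually_ge_atTop (3 / c)).and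
    ((h1.eventually_ge_atTop (-Real.log ε)).and (eventually_gt_atTop 0)))
  refine ⟨N, fun n d hn hd => ?_⟩
  obtain ⟨ha, hb, h0⟩ := hN n hn
  have hl : 0 < Real.log n := lt_of_lt_of_le (by positivity) ha
  have hn0 : (0 : ℝ) < n := Nat.cast_pos.2 h0
  have h2 : (n : ℝ) ^ 2 = Real.exp (2 * Real.log n) := by
    rw [two_mul, Real.exp_add, Real.exp_log hn0, sq]
  rw [h2, ← Real.exp_add, ← Real.le_log_iff_exp_le hε]
  rw [div_le_iff₀ hc] at ha
  have h3 : 3 * Real.log n ≤ c * d := by nlinarith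
  linarith

theorem exists_pow_mul_exp_neg_le (K : ℕ) {c ε : ℝ} (hc : 0 < c) (hε : 0 < ε) :
    ∃ N : ℕ, ∀ n : ℕ, N ≤ n → (n : ℝ) ^ K * Real.exp (-(c * n)) ≤ ε := by
  have h1 : Tendsto (fun x : ℝ => x ^ K * Real.exp (-c * x)) atTop (𝓝 0) := by
    have h := Real.tendsto_pow_mul_exp_neg_atTop_nhds_zero K
    have h2 := (h.comp (tendsto_id.const_mul_atTop hc)).const_mul ((c ^ K)⁻¹)
    rw [mul_zero] at h2
    refine h2.congr fun x => ?_
    have : c ^ K ≠ 0 := (pow_pos hc K).ne'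
    simp only [Function.comp, id, mul_pow, neg_mul]
    field_simp
  obtain ⟨N, hN⟩ := eventually_atTop.1
    ((h1.comp tendsto_natCast_atTop_atTop).eventually (ge_mem_nhds hε))
  exact ⟨N, fun n hn => by simpa using hN n hn⟩

end Asymptotics

/-! ### The model with two blocks -/

theorem expect_simplexPMF {A : Type} [Fintype A] (x : stdSimplex ℝ A) (f : A → ℝ) :
    expect (simplexPMF x) f = ∑ a, x.1 a * f a := by
  refine Finset.sum_congr rfl fun a _ => ?_
  rw [simplexPMF, PMF.ofFintype_apply, ENNReal.toReal_ofReal (x.2.1 a)]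

theorem expect_coin (p : unitInterval) (f : Bool → ℝ) :
    expect (coin p) f = p * f true + (1 - p) * f false := by
  rw [coin, expect_simplexPMF]
  simp

theorem expect_coin_bit (p : unitInterval) : expect (coin p) bit = p := by
  simp [expect_coin]

/-- The entries of the block matrix. -/
def entry (p q : unitInterval) (i j : Fin 2) : unitInterval := !![p, q; q, p] i j

/-- The probability of a one on a feature of block `j` for a point of cluster `i`. -/
noncomputable def rate (p q : unitInterval) (i j : Fin 2) : ℝ := entry p q i j

theorem rate_eq (p q : unitInterval) (i j : Fin 2) :
    rate p q i j = if i = j then (p : ℝ) else q := by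
  fin_cases i <;> fin_cases j <;> rfl

theorem rate_nonneg (p q : unitInterval) (i j : Fin 2) : 0 ≤ rate p q i j :=
  (entry p q i j).2.1

theorem rate_le {p q : unitInterval} (hqp : q < p) (i j : Fin 2) : rate p q i j ≤ p := by
  have : (q : ℝ) ≤ p := hqp.le
  rw [rate_eq]
  split_ifs <;> linarith

/-- The law of a data point of cluster `i`. -/
noncomputable def rowLaw {d : ℕ} (p q : unitInterval) (D : Fin d → Fin 2) (i : Fin 2) :
    PMF (Fin d → Bool) :=
  piPMF fun j => coin (entry p q i (D j))

theorem bbm_eq {n d : ℕ} (p q : unitInterval) (C : Fin n → Fin 2) (D : Fin d → Fin 2) :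
    bbm C D !![p, q; q, p] = piPMF fun a => rowLaw p q D (C a) := rfl

theorem expect_rowLaw_bit {d : ℕ} (p q : unitInterval) (D : Fin d → Fin 2) (i : Fin 2)
    (j : Fin d) : expect (rowLaw p q D i) (fun x => bit (x j)) = rate p q i (D j) := by
  rw [rowLaw, expect_piPMF_eval (fun j => coin (entry p q i (D j))) j bit, expect_coin_bit]
  rfl

theorem Balanced.two_mul_card {m : ℕ} {L : Fin m → Fin 2} (h : Balanced L) (k : Fin 2) :
    2 * ((cluster L k).card : ℝ) = m := by
  have h1 : (cluster L 0).card + (cluster L 1).card = m := by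
    have := Finset.card_eq_sum_card_fiberwise (s := (Finset.univ : Finset (Fin m)))
      (t := Finset.univ) (f := L) (fun a _ => Finset.mem_coe.2 (Finset.mem_univ _))
    rw [Fin.sum_univ_two, Finset.card_univ, Fintype.card_fin] at this
    exact this.symm
  have h2 : (cluster L k).card + (cluster L k).card = m := by
    have := h k 0
    have := h k 1
    omega
  rw [two_mul]
  exact_mod_cast h2

theorem Balanced.sum_eq {m : ℕ} {L : Fin m → Fin 2} (h : Balanced L) (F : Fin 2 → ℝ) :
    ∑ a, F (L a) = m / 2 * (F 0 + F 1) := by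
  have h1 : ∑ a, F (L a) = ∑ k, ∑ a ∈ cluster L k, F (L a) :=
    (Finset.sum_fiberwise Finset.univ L fun a => F (L a)).symm
  have h2 : ∀ k, ∑ a ∈ cluster L k, F (L a) = (cluster L k).card * F k := fun k => by
    rw [Finset.sum_congr rfl fun a ha => by rw [(Finset.mem_filter.1 ha).2], Finset.sum_const,
      nsmul_eq_mul]
  rw [h1, Fin.sum_univ_two, h2, h2]
  have := h.two_mul_card 0
  have := h.two_mul_card 1
  linear_combination F 0 / 2 * h.two_mul_card 0 + F 1 / 2 * h.two_mul_card 1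

/-! ### Distances between data points -/

theorem expect_piPMF_pair {ι : Type} [Fintype ι] [DecidableEq ι] {β : ι → Type}
    [∀ i, Fintype (β i)] (μ : ∀ i, PMF (β i)) {i j : ι} (hij : i ≠ j) (F : β i → β j → ℝ) :
    expect (piPMF μ) (fun x => F (x i) (x j)) =
      expect (μ i) fun u => expect (μ j) fun v => F u v := by
  rw [expect_piPMF_update μ i]
  congr 1
  funext u
  rw [expect_congr_support (g := fun x => F u (x j)), expect_piPMF_eval _ j (F u),
    Function.update_of_ne hij.symm]
  intro x hx
  have h := support_piPMF hx i
  rw [Function.update_self] at h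
  have hxu : x i = u := by
    by_contra hne
    exact h (by simp [PMF.pure_apply, hne])
  rw [hxu]

/-- The expected fraction of the features on which two points of the given clusters differ. -/
noncomputable def meanDist (p q : unitInterval) (i i' : Fin 2) : ℝ :=
  if i = i' then (p : ℝ) * (1 - p) + q * (1 - q) else p + q - 2 * p * q

/-- All distances between data points are close to their expected values. -/
def Regular {n d : ℕ} (p q : unitInterval) (C : Fin n → Fin 2) (θ : ℝ)
    (X : Fin n → Fin d → Bool) : Prop :=
  ∀ a b, a ≠ b → |(hammingDist (X a) (X b) : ℝ) - meanDist p q (C a) (C b) * d| ≤ θ * d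

/-- For one pair of points the distance is a sum of independent indicators over the features, once
the matrix is read by columns; Hoeffding's inequality and a union over `n²` pairs finish. -/
theorem prob_not_regular_le {n d : ℕ} (p q : unitInterval) (C : Fin n → Fin 2)
    {D : Fin d → Fin 2} (hD : Balanced D) {θ : ℝ} (h0 : 0 ≤ θ) (h1 : θ ≤ 1) :
    prob (bbm C D !![p, q; q, p]) {X | ¬ Regular p q C θ X} ≤
      (n : ℝ) ^ 2 * (2 * Real.exp (-(θ ^ 2 / 16 * d))) := by
  classical
  have hpair : ∀ w : Fin n × Fin n, prob (bbm C D !![p, q; q, p]) {X | w.1 ≠ w.2 ∧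
      θ * d ≤ |(hammingDist (X w.1) (X w.2) : ℝ) - meanDist p q (C w.1) (C w.2) * d|} ≤
      2 * Real.exp (-(θ ^ 2 / 16 * d)) := by
    rintro ⟨a, b⟩
    dsimp only
    by_cases hab : a = b
    · refine le_trans (le_of_eq ?_) (by positivity : 0 ≤ 2 * Real.exp (-(θ ^ 2 / 16 * d)))
      rw [prob_eq_expect]
      simp [hab, expect_const]
    · have hE : ∀ j : Fin d, expect (piPMF fun a : Fin n => coin (entry p q (C a) (D j)))
          (fun y => if y a = y b then (0 : ℝ) else 1) =
          rate p q (C a) (D j) + rate p q (C b) (D j) -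
            2 * rate p q (C a) (D j) * rate p q (C b) (D j) := fun j => by
        refine (expect_piPMF_pair (fun a : Fin n => coin (entry p q (C a) (D j))) hab
          fun u v : Bool => if u = v then (0 : ℝ) else 1).trans ?_
        simp only [expect_coin, rate]
        norm_num
        ring
      have hsum : ∑ j : Fin d, expect (piPMF fun a : Fin n => coin (entry p q (C a) (D j)))
          (fun y => if y a = y b then (0 : ℝ) else 1) = meanDist p q (C a) (C b) * d := by
        rw [Finset.sum_congr rfl fun j _ => hE j, hD.sum_eq fun l => rate p q (C a) l +
          rate p q (C b) l - 2 * rate p q (C a) l * rate p q (C b) l, meanDist]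
        generalize C a = i
        generalize C b = i'
        fin_cases i <;> fin_cases i' <;> simp [rate_eq] <;> ring
      have hH := hoeffding_abs (fun j : Fin d => piPMF fun a : Fin n =>
        coin (entry p q (C a) (D j))) (g := fun _ y => if y a = y b then (0 : ℝ) else 1)
        (by intro _ y; split_ifs <;> simp) h0 h1
      rw [hsum, Fintype.card_fin] at hH
      rw [bbm_eq]
      simp only [rowLaw]
      rw [prob_piPMF_swap]
      refine (prob_mono _ fun y hy => ?_).trans (hH.trans_eq (by ring_nf))
      simp only [Set.mem_ofPred_eq, hammingDist_eq_sum] at hy ⊢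
      exact hy.2
  refine (prob_mono _ fun X hX => ?_).trans ((prob_exists_le_card _ _ hpair).trans_eq ?_)
  · simp only [Regular, Set.mem_ofPred_eq] at hX ⊢
    push Not at hX
    obtain ⟨a, b, hab, h⟩ := hX
    exact ⟨(a, b), hab, h.le⟩
  · rw [Fintype.card_prod, Fintype.card_fin]
    push_cast
    ring

theorem meanDist_sub (p q : unitInterval) {i i' : Fin 2} (h : i ≠ i') :
    meanDist p q i i' - meanDist p q i i = ((p : ℝ) - q) ^ 2 := by
  rw [meanDist, meanDist, if_neg h, if_pos rfl]
  ring

theorem meanDist_self_nonneg (p q : unitInterval) (i : Fin 2) : 0 ≤ meanDist p q i i := by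
  rw [meanDist, if_pos rfl]
  have h1 : 0 ≤ (p : ℝ) * (1 - p) := mul_nonneg p.2.1 (by linarith [p.2.2])
  have h2 : 0 ≤ (q : ℝ) * (1 - q) := mul_nonneg q.2.1 (by linarith [q.2.2])
  linarith

theorem exists_perm {i : Fin 2 → Fin 2} (h : i 0 ≠ i 1) :
    ∃ π : Equiv.Perm (Fin 2), ∀ k, π (i k) = k := by
  have hb : Function.Bijective i := by
    rw [← Finite.injective_iff_bijective]
    intro a b hab
    fin_cases a <;> fin_cases b <;> simp_all
  exact ⟨(Equiv.ofBijective i hb).symm, fun k => (Equiv.ofBijective i hb).symm_apply_apply k⟩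

/-- The expected distances to the two seeds differ by `(p - q)² d`, and each actual distance is off
by at most `θ d`. -/
theorem Regular.separates {n d : ℕ} {p q : unitInterval} {C : Fin n → Fin 2} {θ : ℝ}
    {X : Fin n → Fin d → Bool} (h : Regular p q C θ X) (hθ : 2 * θ < ((p : ℝ) - q) ^ 2)
    (h0 : 0 ≤ θ) (hd : 0 < d) (s : Fin 2 ↪ Fin n) {π : Equiv.Perm (Fin 2)}
    (hπ : ∀ k, π (C (s k)) = k) : Separates X (fun k => X (s k)) fun a => π (C a) := by
  intro a
  set k := π (C a) with hk
  have hCk : C (s k) = C a := π.injective (by rw [hπ])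
  obtain ⟨k', hk'⟩ : ∃ k', k ≠ k' := ⟨k + 1, by generalize k = k; fin_cases k <;> simp⟩
  have hCk' : C a ≠ C (s k') := fun he => hk' (by rw [hk, he, hπ])
  have hd' : (0 : ℝ) < d := Nat.cast_pos.2 hd
  refine nearest_of_gap_neg _ _ hk' ?_
  rw [gap_eq]
  have h1 : (hammingDist (X a) (X (s k)) : ℝ) ≤ (meanDist p q (C a) (C a) + θ) * d := by
    -- Regularity says nothing about a point and itself; a seed has distance 0 to itself, which is
    -- even better.
    by_cases ha : a = s k
    · rw [← ha, hammingDist_self, Nat.cast_zero]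
      have := meanDist_self_nonneg p q (C a)
      positivity
    · have := (abs_le.1 (h a (s k) ha)).2
      rw [hCk] at this
      linarith
  have h2 : (meanDist p q (C a) (C (s k')) - θ) * d ≤ hammingDist (X a) (X (s k')) := by
    have ha : a ≠ s k' := fun he => hCk' (by rw [← he])
    have := (abs_le.1 (h a (s k') ha)).1
    linarith
  have h3 := meanDist_sub p q hCk'
  have h4 : 0 < (meanDist p q (C a) (C (s k')) - meanDist p q (C a) (C a) - 2 * θ) * d :=
    mul_pos (by rw [h3]; linarith) hd'
  linarith

/-! ### Zeros are in the majority -/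

/-- Points with their labels are independent pairs, so each of the `2d` sums over points
concentrates. Only the total drift over all points is required to be negative, since some points may
drift the wrong way. -/
theorem expect_prob_not_zeroModes_le {n d : ℕ} (μ : Fin n → PMF (Fin d → Bool))
    (κ : Fin n → (Fin d → Bool) → PMF (Fin 2)) {θ : ℝ} (h0 : 0 ≤ θ) (h1 : θ ≤ 1)
    (h : ∀ k j, ∑ a, expect (μ a) (fun x => expect (κ a x) fun i =>
      if i = k then bit (x j) - 1 / 2 else 0) ≤ -(θ * n)) :
    (expect (piPMF μ) fun X => prob (piPMF fun a => κ a (X a)) {σ | ¬ ZeroModes X σ}) ≤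
      2 * d * Real.exp (-(θ ^ 2 / 16 * n)) := by
  classical
  rw [prob_piPMF_bind μ κ fun X σ => ¬ ZeroModes X σ]
  have hkj : ∀ w : Fin 2 × Fin d, prob (piPMF fun a => jointPMF (μ a) (κ a))
      {z | 0 ≤ ∑ a, if (z a).2 = w.1 then bit ((z a).1 w.2) - 1 / 2 else 0} ≤
      Real.exp (-(θ ^ 2 / 16 * n)) := by
    rintro ⟨k, j⟩
    have hH := hoeffding (fun a => jointPMF (μ a) (κ a))
      (g := fun _ y => if y.2 = k then bit (y.1 j) - 1 / 2 else 0)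
      (by
        intro _ y
        have := bit_mem (y.1 j)
        rw [abs_le]
        split_ifs <;> constructor <;> linarith) h0 h1
    refine (prob_mono _ fun z hz => ?_).trans (hH.trans_eq ?_)
    · simp only [Set.mem_ofPred_eq, expect_jointPMF, Fintype.card_fin] at hz ⊢
      linarith [h k j]
    · rw [Fintype.card_fin]
      ring_nf
  refine (prob_mono _ fun z hz => ?_).trans ((prob_exists_le_card _ _ hkj).trans_eq ?_)
  · simp only [ZeroModes, Set.mem_ofPred_eq] at hz ⊢
    push Not at hz
    obtain ⟨k, j, hkj⟩ := hz
    exact ⟨(k, j), hkj⟩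
  · rw [Fintype.card_prod, Fintype.card_fin, Fintype.card_fin]
    push_cast
    ring

/-- With equal centers each label is a fair coin independent of the data, so each point contributes
half of its bias `rate - 1/2` to either cluster. -/
theorem expect_prob_not_zeroModes_uniform_le {n d : ℕ} {p q : unitInterval} (hqp : q < p)
    (hp : (p : ℝ) < 1 / 2) (C : Fin n → Fin 2) (D : Fin d → Fin 2) :
    (expect (bbm C D !![p, q; q, p]) fun X =>
      prob (assign X fun _ _ => false) {σ | ¬ ZeroModes X σ}) ≤
      2 * d * Real.exp (-(((1 / 2 - (p : ℝ)) / 2) ^ 2 / 16 * n)) := by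
  refine expect_prob_not_zeroModes_le (fun a => rowLaw p q D (C a))
    (fun _ => choice fun _ _ => false) (by linarith) (by linarith [p.2.1]) fun k j => ?_
  refine (Finset.sum_le_sum (g := fun _ => -((1 / 2 - (p : ℝ)) / 2)) fun a _ => ?_).trans_eq ?_
  · have h1 : ∀ x : Fin d → Bool, (expect (choice (fun _ _ => false) x) fun i =>
        if i = k then bit (x j) - 1 / 2 else 0) = 1 / 2 * (bit (x j) - 1 / 2) := fun x => by
      rw [expect_choice_of_univ (nearest_of_gap_zero _ _ (by simp [gap]))]
      fin_cases k <;> norm_num <;> ring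
    simp only [h1, expect_const_mul, expect_sub, expect_const, expect_rowLaw_bit]
    linarith [rate_le hqp (C a) (D j)]
  · simp
    ring

/-- The previous bound with deterministic labels, written as point masses; only the planted cluster
labelled `k` contributes to the drift. -/
theorem prob_not_zeroModes_planted_le {n d : ℕ} {p q : unitInterval} (hqp : q < p)
    (hp : (p : ℝ) < 1 / 2) {C : Fin n → Fin 2} (hC : Balanced C) (D : Fin d → Fin 2)
    (π : Equiv.Perm (Fin 2)) :
    prob (bbm C D !![p, q; q, p]) {X | ¬ ZeroModes X fun a => π (C a)} ≤
      2 * d * Real.exp (-(((1 / 2 - (p : ℝ)) / 2) ^ 2 / 16 * n)) := by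
  classical
  have h := expect_prob_not_zeroModes_le (fun a => rowLaw p q D (C a))
    (fun a _ => PMF.pure (π (C a))) (θ := (1 / 2 - (p : ℝ)) / 2) (by linarith)
    (by linarith [p.2.1]) fun k j => ?_
  · refine le_trans ?_ h
    rw [prob_eq_expect]
    refine expect_mono _ fun X => ?_
    split_ifs with hX
    · refine (prob_eq_one_of_support _ _ fun σ hσ => ?_).ge
      have : σ = fun a => π (C a) := by
        funext a
        have := support_piPMF hσ a
        by_contra hne
        exact this (by simp [PMF.pure_apply, hne])
      rw [this]
      exact hX
    · exact prob_nonneg _ _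
  · refine (Finset.sum_le_sum
      (g := fun a => (fun l => if π l = k then (p : ℝ) - 1 / 2 else 0) (C a)) fun a _ => ?_).trans_eq ?_
    · simp only [expect_pure]
      split_ifs with hk
      · rw [expect_sub, expect_rowLaw_bit, expect_const]
        linarith [rate_le hqp (C a) (D j)]
      · rw [expect_const]
    · rw [hC.sum_eq fun l => if π l = k then (p : ℝ) - 1 / 2 else 0]
      have : (if π 0 = k then (p : ℝ) - 1 / 2 else 0) + (if π 1 = k then (p : ℝ) - 1 / 2 else 0) =
          (p : ℝ) - 1 / 2 := by
        have hne : π 0 ≠ π 1 := π.injective.ne (by decide)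
        rcases fin_two_eq_or (i := k) hne with rfl | rfl
        · simp [hne.symm]
        · simp [hne]
      rw [this]
      ring

end BooleanBlock

namespace BooleanBlock

/-! ### Two seeds and a random point -/

section Seeds

variable {d : ℕ} (p q : unitInterval) (D : Fin d → Fin 2)

/-- The difference of two Boolean vectors in one coordinate. -/
def bitDiff (b b' : Fin d → Bool) (j : Fin d) : ℝ := bit (b j) - bit (b' j)

theorem abs_bitDiff_le (b b' : Fin d → Bool) (j : Fin d) : |bitDiff b b' j| ≤ 1 := by
  rw [bitDiff]
  cases b j <;> cases b' j <;> simp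

/-- The expected value of `gap b b'` on a point of cluster `k`. -/
noncomputable def gapMean (k : Fin 2) (b b' : Fin d → Bool) : ℝ :=
  ∑ j, bitDiff b b' j * (1 - 2 * rate p q k (D j))

/-- The variance of half of `gap b b'` on a point of cluster `k`. -/
noncomputable def gapVar (k : Fin 2) (b b' : Fin d → Bool) : ℝ :=
  ∑ j, bitDiff b b' j ^ 2 * (rate p q k (D j) * (1 - rate p q k (D j)))

/-- The probability that a point of cluster `k` is assigned to the first of two centers. -/
noncomputable def firstProb (k : Fin 2) (b b' : Fin d → Bool) : ℝ :=
  expect (rowLaw p q D k) fun x => expect (choice ![b, b'] x) fun l => if l = 0 then 1 else 0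

theorem gap_eq_gapMean_add (k : Fin 2) (b b' x : Fin d → Bool) :
    gap b b' x = gapMean p q D k b b' +
      2 * ∑ j, bitDiff b b' j * (rate p q k (D j) - bit (x j)) := by
  rw [gap, gapMean, Finset.mul_sum, ← Finset.sum_add_distrib]
  refine Finset.sum_congr rfl fun j _ => ?_
  rw [bitDiff]
  ring

theorem expect_choice_first (b b' x : Fin d → Bool) :
    (gap b b' x < 0 → expect (choice ![b, b'] x) (fun l => if l = 0 then (1 : ℝ) else 0) = 1) ∧
    (0 < gap b b' x → expect (choice ![b, b'] x) (fun l => if l = 0 then (1 : ℝ) else 0) = 0) := by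
  constructor
  · intro h
    rw [expect_choice_of_eq (nearest_of_gap_neg ![b, b'] x (k := 0) (k' := 1) (by decide)
      (by simpa using h))]
    simp
  · intro h
    rw [expect_choice_of_eq (nearest_of_gap_neg ![b, b'] x (k := 1) (k' := 0) (by decide)
      (by simpa [gap_swap b b' x] using h))]
    simp

theorem firstProb_le (k : Fin 2) (b b' : Fin d → Bool) :
    firstProb p q D k b b' ≤ prob (rowLaw p q D k) {x | gap b b' x ≤ 0} := by
  refine expect_le_prob _ _ (fun x => expect_le_const _ fun l => by split_ifs <;> simp)
    fun x hx => ?_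
  exact ((expect_choice_first b b' x).2 (by simpa using hx)).le

theorem le_firstProb (k : Fin 2) (b b' : Fin d → Bool) :
    prob (rowLaw p q D k) {x | gap b b' x < 0} ≤ firstProb p q D k b b' := by
  refine prob_le_expect _ _ (fun x => expect_nonneg _ fun l => by split_ifs <;> simp)
    fun x hx => ?_
  exact ((expect_choice_first b b' x).1 (by simpa using hx)).ge

theorem abs_gapTerm_le (k : Fin 2) (b b' : Fin d → Bool) (j : Fin d) (y : Bool) :
    |bitDiff b b' j * (rate p q k (D j) - bit y)| ≤ 1 := by
  have h1 := abs_bitDiff_le b b' j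
  have h2 : |rate p q k (D j) - bit y| ≤ 1 := by
    have := bit_mem y
    have := (entry p q k (D j)).2
    rw [Set.mem_Icc] at this
    rw [rate, abs_le]
    constructor <;> linarith
  rw [abs_mul]
  exact mul_le_one₀ h1 (abs_nonneg _) h2

theorem expect_gapTerm (k : Fin 2) (b b' : Fin d → Bool) (j : Fin d) :
    expect (coin (entry p q k (D j))) (fun y => bitDiff b b' j * (rate p q k (D j) - bit y)) = 0 := by
  rw [expect_const_mul, expect_sub, expect_const, expect_coin_bit, rate, sub_self, mul_zero]

theorem expect_gapTerm_sq (k : Fin 2) (b b' : Fin d → Bool) (j : Fin d) :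
    expect (coin (entry p q k (D j)))
      (fun y => (bitDiff b b' j * (rate p q k (D j) - bit y)) ^ 2) =
      bitDiff b b' j ^ 2 * (rate p q k (D j) * (1 - rate p q k (D j))) := by
  rw [expect_coin, rate]
  simp only [bit_true, bit_false]
  ring

/-- If the gap has a large variance, its sign is governed by the normal distribution. -/
theorem exists_firstProb_approx {τ : ℝ} (hτ : 0 < τ) :
    ∃ V > 0, ∀ (p q : unitInterval) (d : ℕ) (D : Fin d → Fin 2) (k : Fin 2) (b b' : Fin d → Bool),
      V ≤ gapVar p q D k b b' →
      |firstProb p q D k b b' -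
        normalCDF (-(gapMean p q D k b b' / (2 * √(gapVar p q D k b b'))))| ≤ τ ∧
      prob (rowLaw p q D k) {x | |gap b b' x| ≤ 2} ≤ τ := by
  obtain ⟨V, hV, H⟩ := exists_normal_approx (τ := τ / 4) (by linarith)
  -- The event `|gap| ≤ 2` is a window of width 2 for the centered half gap. The second term makes
  -- its normal probability at most `2/√v ≤ τ/2`; the two approximation errors add `τ/4` each.
  refine ⟨max V ((4 / τ) ^ 2), lt_max_of_lt_left hV, fun p q d D k b b' hv => ?_⟩
  set v := gapVar p q D k b b' with hvdef
  set m := gapMean p q D k b b' with hm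
  have key := H (Fin d) (fun _ => Bool) (fun j => coin (entry p q k (D j)))
    (fun j y => bitDiff b b' j * (rate p q k (D j) - bit y))
    (fun j y => abs_gapTerm_le p q D k b b' j y) (fun j => expect_gapTerm p q D k b b' j) v
    (by simp only [expect_gapTerm_sq]; rfl) ((le_max_left _ _).trans hv)
  change ∀ z, prob (rowLaw p q D k) _ ≤ _ ∧ _ ≤ prob (rowLaw p q D k) _ at key
  have hv0 : 0 < v := lt_of_lt_of_le (lt_max_of_lt_left hV) hv
  have hs : 0 < √v := Real.sqrt_pos.2 hv0
  have hs4 : 4 / τ ≤ √v := Real.le_sqrt_of_sq_le ((le_max_right _ _).trans hv)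
  have hgap : ∀ x, gap b b' x = m + 2 * ∑ j, bitDiff b b' j * (rate p q k (D j) - bit (x j)) :=
    fun x => gap_eq_gapMean_add p q D k b b' x
  have hz : -m / 2 / √v = -(m / (2 * √v)) := by
    field_simp
  constructor
  · have h1 := key (-m / 2)
    rw [hz] at h1
    have h2 := firstProb_le p q D k b b'
    have h3 := le_firstProb p q D k b b'
    have h4 : prob (rowLaw p q D k) {x | gap b b' x ≤ 0} ≤ prob (rowLaw p q D k)
        {x | ∑ j, bitDiff b b' j * (rate p q k (D j) - bit (x j)) ≤ -m / 2} :=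
      prob_mono _ fun x hx => by
        simp only [Set.mem_ofPred_eq, hgap] at hx ⊢
        linarith
    have h5 : prob (rowLaw p q D k)
        {x | ∑ j, bitDiff b b' j * (rate p q k (D j) - bit (x j)) < -m / 2} ≤
        prob (rowLaw p q D k) {x | gap b b' x < 0} :=
      prob_mono _ fun x hx => by
        simp only [Set.mem_ofPred_eq, hgap] at hx ⊢
        linarith
    rw [abs_le]
    constructor <;> linarith
  · have h1 := (key (1 - m / 2)).1
    have h2 := (key (-1 - m / 2)).2
    have h3 : prob (rowLaw p q D k) {x | |gap b b' x| ≤ 2} + prob (rowLaw p q D k)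
        {x | ∑ j, bitDiff b b' j * (rate p q k (D j) - bit (x j)) < -1 - m / 2} ≤
        prob (rowLaw p q D k)
          {x | ∑ j, bitDiff b b' j * (rate p q k (D j) - bit (x j)) ≤ 1 - m / 2} := by
      classical
      rw [prob_eq_expect, prob_eq_expect, prob_eq_expect, ← expect_add]
      refine expect_mono _ fun x => ?_
      simp only [Set.mem_ofPred_eq, hgap, abs_le]
      split_ifs <;> norm_num <;> linarith
    have h4 := normalCDF_sub_le (x := (-1 - m / 2) / √v) (y := (1 - m / 2) / √v)
      (by gcongr; linarith)
    have h5 : (1 - m / 2) / √v - (-1 - m / 2) / √v = 2 / √v := by ring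
    have h6 : 2 / √v ≤ τ / 2 := by
      rw [div_le_iff₀ hτ] at hs4
      rw [div_le_iff₀ hs]
      linarith
    linarith

/-- If the variance of the gap is small compared to its mean, its sign is almost determined. -/
theorem firstProb_of_gapVar_le {k : Fin 2} {b b' : Fin d → Bool} {t v l : ℝ} (hl0 : 0 ≤ l)
    (hl1 : l ≤ 1) (hv : gapVar p q D k b b' ≤ v) (ht : 4 ≤ t) (hm : t ≤ |gapMean p q D k b b'|) :
    (firstProb p q D k b b' ≤ Real.exp (-(l * (t / 4)) + l ^ 2 * v) ∨
      1 - Real.exp (-(l * (t / 4)) + l ^ 2 * v) ≤ firstProb p q D k b b') ∧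
    prob (rowLaw p q D k) {x | |gap b b' x| ≤ 2} ≤ Real.exp (-(l * (t / 4)) + l ^ 2 * v) := by
  set m := gapMean p q D k b b' with hmdef
  have hgap : ∀ x, gap b b' x = m + 2 * ∑ j, bitDiff b b' j * (rate p q k (D j) - bit (x j)) :=
    fun x => gap_eq_gapMean_add p q D k b b' x
  -- If the mean is at least `t` in absolute value and the gap reaches `±2` on the way to the
  -- opposite sign, the centered half gap deviates by `(t - 2)/2`, which is at least `t/4` as `t ≥
  -- 4`.
  have hB := prob_sum_ge_le (fun j => coin (entry p q k (D j)))
    (g := fun j y => bitDiff b b' j * (rate p q k (D j) - bit y)) (t := t / 4) (v := v)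
    (fun j y => abs_gapTerm_le p q D k b b' j y) (fun j => (expect_gapTerm p q D k b b' j).le)
    (by simp only [expect_gapTerm_sq]; exact hv) hl0 hl1
  have hB' := prob_sum_ge_le (fun j => coin (entry p q k (D j)))
    (g := fun j y => -(bitDiff b b' j * (rate p q k (D j) - bit y))) (t := t / 4) (v := v)
    (fun j y => by rw [abs_neg]; exact abs_gapTerm_le p q D k b b' j y)
    (fun j => by rw [expect_neg, expect_gapTerm, neg_zero])
    (by simp only [neg_sq, expect_gapTerm_sq]; exact hv) hl0 hl1
  simp only [Finset.sum_neg_distrib] at hB'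
  change prob (rowLaw p q D k) _ ≤ _ at hB hB'
  rcases le_abs.1 hm with hpos | hneg
  · have h1 : prob (rowLaw p q D k) {x | gap b b' x ≤ 2} ≤
        Real.exp (-(l * (t / 4)) + l ^ 2 * v) := by
      refine (prob_mono _ fun x hx => ?_).trans hB'
      simp only [Set.mem_ofPred_eq, hgap] at hx ⊢
      linarith
    refine ⟨Or.inl ((firstProb_le p q D k b b').trans ((prob_mono _ fun x hx => ?_).trans h1)),
      (prob_mono _ fun x hx => ?_).trans h1⟩
    · simp only [Set.mem_ofPred_eq] at hx ⊢
      linarith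
    · exact (abs_le.1 (Set.mem_ofPred_eq ▸ hx)).2
  · have h1 : prob (rowLaw p q D k) {x | -2 ≤ gap b b' x} ≤
        Real.exp (-(l * (t / 4)) + l ^ 2 * v) := by
      refine (prob_mono _ fun x hx => ?_).trans hB
      simp only [Set.mem_ofPred_eq, hgap] at hx ⊢
      linarith
    refine ⟨Or.inr (le_trans ?_ (le_firstProb p q D k b b')), (prob_mono _ fun x hx => ?_).trans h1⟩
    · rw [sub_le_comm, ← prob_compl]
      refine (prob_mono _ fun x hx => ?_).trans h1
      have : ¬ gap b b' x < 0 := hx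
      simp only [Set.mem_ofPred_eq]
      linarith
    · exact (abs_le.1 (Set.mem_ofPred_eq ▸ hx)).1

end Seeds

end BooleanBlock

namespace BooleanBlock

/-! ### Means and variances of the gap for typical seeds from one planted cluster -/

section Typical

variable {d : ℕ}

/-- The sum of a function over one block of features. -/
def blockSum (D : Fin d → Fin 2) (l : Fin 2) (f : Fin d → ℝ) : ℝ :=
  ∑ j, if D j = l then f j else 0

theorem sum_mul_eq_blockSum (D : Fin d → Fin 2) (f : Fin d → ℝ) (h : Fin 2 → ℝ) {i i' : Fin 2}
    (hi : i ≠ i') :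
    ∑ j, f j * h (D j) = h i * blockSum D i f + h i' * blockSum D i' f := by
  simp only [blockSum, Finset.mul_sum, ← Finset.sum_add_distrib]
  refine Finset.sum_congr rfl fun j _ => ?_
  rcases fin_two_eq_or (i := D j) hi with h1 | h1
  · rw [h1, if_pos rfl, if_neg hi]
    ring
  · rw [h1, if_pos rfl, if_neg hi.symm]
    ring

/-- The variance of an entry. -/
noncomputable def rateVar (p q : unitInterval) (i l : Fin 2) : ℝ :=
  rate p q i l * (1 - rate p q i l)

theorem rateVar_nonneg (p q : unitInterval) (i l : Fin 2) : 0 ≤ rateVar p q i l :=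
  mul_nonneg (entry p q i l).2.1 (by have := (entry p q i l).2.2; rw [rate]; linarith)

theorem rateVar_le (p q : unitInterval) (i l : Fin 2) : rateVar p q i l ≤ 1 / 4 := by
  rw [rateVar]
  nlinarith [sq_nonneg (2 * rate p q i l - 1)]

/-- The typical value of the variance of the gap, relative to the number of features. -/
noncomputable def limitVar (p q : unitInterval) (i k : Fin 2) : ℝ :=
  rateVar p q k 0 * rateVar p q i 0 + rateVar p q k 1 * rateVar p q i 1

theorem limitVar_nonneg (p q : unitInterval) (i k : Fin 2) : 0 ≤ limitVar p q i k :=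
  add_nonneg (mul_nonneg (rateVar_nonneg _ _ _ _) (rateVar_nonneg _ _ _ _))
    (mul_nonneg (rateVar_nonneg _ _ _ _) (rateVar_nonneg _ _ _ _))

theorem limitVar_le (p q : unitInterval) (i k : Fin 2) : limitVar p q i k ≤ 1 / 8 := by
  rw [limitVar]
  have h := fun i l => rateVar_le p q i l
  have h0 := fun i l => rateVar_nonneg p q i l
  have h1 := mul_le_mul (h k 0) (h i 0) (h0 i 0) (by norm_num)
  have h2 := mul_le_mul (h k 1) (h i 1) (h0 i 1) (by norm_num)
  linarith

theorem limitVar_self (p q : unitInterval) (i : Fin 2) :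
    limitVar p q i i = ((p : ℝ) * (1 - p)) ^ 2 + ((q : ℝ) * (1 - q)) ^ 2 := by
  rw [limitVar]
  simp only [rateVar, rate_eq]
  fin_cases i <;> simp <;> ring

theorem limitVar_of_ne (p q : unitInterval) {i k : Fin 2} (hk : k ≠ i) :
    limitVar p q i k = 2 * ((p : ℝ) * (1 - p)) * ((q : ℝ) * (1 - q)) := by
  rw [limitVar]
  simp only [rateVar, rate_eq]
  fin_cases i <;> fin_cases k <;> simp at hk ⊢ <;> ring

/-- The seeds `b` and `b'`, both from cluster `i`, are such that the means and variances of the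
gaps are of the expected order and the normalized means for the two clusters differ. -/
structure Typical (p q : unitInterval) (D : Fin d → Fin 2) (i : Fin 2) (M τ δ : ℝ)
    (b b' : Fin d → Bool) : Prop where
  mean : ∀ l, |blockSum D l (bitDiff b b')| ≤ M * √d
  var : ∀ l, |blockSum D l (fun j => bitDiff b b' j ^ 2) - rateVar p q i l * d| ≤ τ * d
  diff : ∀ k, k ≠ i → δ * √d ≤
    |√(limitVar p q i i) * gapMean p q D k b b' - √(limitVar p q i k) * gapMean p q D i b b'|

theorem Typical.abs_gapMean_le {p q : unitInterval} {D : Fin d → Fin 2} {i : Fin 2} {M τ δ : ℝ}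
    {b b' : Fin d → Bool} (h : Typical p q D i M τ δ b b') (k : Fin 2) :
    |gapMean p q D k b b'| ≤ 2 * M * √d := by
  have hr : ∀ l, |1 - 2 * rate p q k l| ≤ 1 := fun l => by
    have := (entry p q k l).2
    rw [Set.mem_Icc] at this
    rw [rate, abs_le]
    constructor <;> linarith
  rw [gapMean, sum_mul_eq_blockSum D (bitDiff b b') (fun l => 1 - 2 * rate p q k l)
    (i := 0) (i' := 1) (by decide)]
  refine (abs_add_le _ _).trans ?_
  rw [abs_mul, abs_mul]
  have h1 := mul_le_of_le_one_left (abs_nonneg (blockSum D 0 (bitDiff b b'))) (hr 0)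
  have h2 := mul_le_of_le_one_left (abs_nonneg (blockSum D 1 (bitDiff b b'))) (hr 1)
  linarith [h.mean 0, h.mean 1]

theorem Typical.abs_gapVar_sub_le {p q : unitInterval} {D : Fin d → Fin 2} {i : Fin 2}
    {M τ δ : ℝ} {b b' : Fin d → Bool} (h : Typical p q D i M τ δ b b') (hτ : 0 ≤ τ) (k : Fin 2) :
    |gapVar p q D k b b' - limitVar p q i k * d| ≤ τ * d := by
  have h1 : gapVar p q D k b b' - limitVar p q i k * d =
      rateVar p q k 0 * (blockSum D 0 (fun j => bitDiff b b' j ^ 2) - rateVar p q i 0 * d) +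
      rateVar p q k 1 * (blockSum D 1 (fun j => bitDiff b b' j ^ 2) - rateVar p q i 1 * d) := by
    rw [gapVar, limitVar]
    change ∑ j, bitDiff b b' j ^ 2 * rateVar p q k (D j) - _ = _
    rw [sum_mul_eq_blockSum D (fun j => bitDiff b b' j ^ 2) (rateVar p q k) (i := 0) (i' := 1)
      (by decide)]
    ring
  rw [h1]
  refine (abs_add_le _ _).trans ?_
  rw [abs_mul, abs_mul, abs_of_nonneg (rateVar_nonneg p q k 0),
    abs_of_nonneg (rateVar_nonneg p q k 1)]
  have hd : 0 ≤ τ * (d : ℝ) := by positivity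
  have h2 := mul_le_mul (rateVar_le p q k 0) (h.var 0) (abs_nonneg _) (by norm_num)
  have h3 := mul_le_mul (rateVar_le p q k 1) (h.var 1) (abs_nonneg _) (by norm_num)
  linarith

/-- The law of a coordinate of two independent points of cluster `i`. -/
noncomputable def pairLaw (p q : unitInterval) (i l : Fin 2) : PMF (Bool × Bool) :=
  jointPMF (coin (entry p q i l)) fun _ => coin (entry p q i l)

theorem expect_pairLaw_diff (p q : unitInterval) (i l : Fin 2) :
    expect (pairLaw p q i l) (fun z => bit z.1 - bit z.2) = 0 := by
  rw [pairLaw, expect_jointPMF]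
  simp only [expect_coin]
  simp
  ring

theorem expect_pairLaw_diff_sq (p q : unitInterval) (i l : Fin 2) :
    expect (pairLaw p q i l) (fun z => (bit z.1 - bit z.2) ^ 2) = 2 * rateVar p q i l := by
  rw [pairLaw, expect_jointPMF]
  simp only [expect_coin, rateVar, rate]
  simp
  ring

theorem abs_bit_sub_le (u v : Bool) : |bit u - bit v| ≤ 1 := by
  cases u <;> cases v <;> simp

theorem expect_prob_rowLaw (p q : unitInterval) (D : Fin d → Fin 2) (i : Fin 2)
    (R : (Fin d → Bool) → (Fin d → Bool) → Prop) :
    (expect (rowLaw p q D i) fun b => prob (rowLaw p q D i) {b' | R b b'}) =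
      prob (piPMF fun j => pairLaw p q i (D j)) {z | R (fun j => (z j).1) fun j => (z j).2} :=
  prob_piPMF_bind (fun j => coin (entry p q i (D j))) (fun j _ => coin (entry p q i (D j))) R

theorem prob_blockSum_le (p q : unitInterval) (D : Fin d → Fin 2) (i l : Fin 2) {M : ℝ}
    (hM : 0 ≤ M) (hd : M ^ 2 ≤ d) (hd0 : 0 < d) :
    prob (piPMF fun j => pairLaw p q i (D j))
      {z | M * √d ≤ |blockSum D l (bitDiff (fun j => (z j).1) fun j => (z j).2)|} ≤
      2 * Real.exp (-(M ^ 2 / 16)) := by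
  have hd' : (0 : ℝ) < d := Nat.cast_pos.2 hd0
  have hs : 0 < √(d : ℝ) := Real.sqrt_pos.2 hd'
  have hss : √(d : ℝ) * √d = d := Real.mul_self_sqrt hd'.le
  have h := hoeffding_abs (fun j => pairLaw p q i (D j))
    (g := fun j z => if D j = l then bit z.1 - bit z.2 else 0) (θ := M / √d)
    (by
      intro j z
      split_ifs
      · exact abs_bit_sub_le _ _
      · simp) (by positivity)
    (by rw [div_le_one hs]; exact Real.le_sqrt_of_sq_le hd)
  have h0 : ∀ j, expect (pairLaw p q i (D j))
      (fun z => if D j = l then bit z.1 - bit z.2 else 0) = 0 := fun j => by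
    split_ifs
    · exact expect_pairLaw_diff p q i (D j)
    · exact expect_const _ _
  simp only [h0, Finset.sum_const_zero, sub_zero, Fintype.card_fin] at h
  have h1 : M / √d * (d : ℝ) = M * √d := by
    rw [div_mul_eq_mul_div, div_eq_iff hs.ne', mul_assoc, hss]
  have h2 : (M / √d) ^ 2 * (d : ℝ) / 16 = M ^ 2 / 16 := by
    rw [div_pow, Real.sq_sqrt hd'.le, div_mul_cancel₀ _ hd'.ne']
  rw [h1, h2] at h
  exact h

theorem prob_blockSum_sq_le (p q : unitInterval) {D : Fin d → Fin 2} (hD : Balanced D)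
    (i l : Fin 2) {τ : ℝ} (h0 : 0 ≤ τ) (h1 : τ ≤ 1) :
    prob (piPMF fun j => pairLaw p q i (D j))
      {z | τ * d ≤ |blockSum D l (fun j => bitDiff (fun j => (z j).1) (fun j => (z j).2) j ^ 2) -
        rateVar p q i l * d|} ≤ 2 * Real.exp (-(τ ^ 2 * d / 16)) := by
  have h := hoeffding_abs (fun j => pairLaw p q i (D j))
    (g := fun j z => if D j = l then (bit z.1 - bit z.2) ^ 2 else 0) (θ := τ)
    (by
      intro j z
      split_ifs
      · rw [abs_pow]
        exact pow_le_one₀ (abs_nonneg _) (abs_bit_sub_le _ _)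
      · simp) h0 h1
  have he : ∑ j, expect (pairLaw p q i (D j))
      (fun z => if D j = l then (bit z.1 - bit z.2) ^ 2 else 0) = rateVar p q i l * d := by
    have : ∀ j, expect (pairLaw p q i (D j))
        (fun z => if D j = l then (bit z.1 - bit z.2) ^ 2 else 0) =
        (fun m => if m = l then 2 * rateVar p q i m else 0) (D j) := fun j => by
      dsimp only
      split_ifs
      · exact expect_pairLaw_diff_sq p q i (D j)
      · exact expect_const _ _
    rw [Finset.sum_congr rfl fun j _ => this j,
      hD.sum_eq fun m => if m = l then 2 * rateVar p q i m else 0]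
    fin_cases l <;> simp <;> ring
  simp only [he, Fintype.card_fin] at h
  exact h

/-- With `P = p(1 - p)` and `Q = q(1 - q)` the difference of the two variances is `P² + Q² - 2PQ =
(P - Q)²`, and `P ≠ Q` because `q < p < 1/2`. -/
theorem sqrt_limitVar_lt {p q : unitInterval} (hp : (p : ℝ) < 1 / 2) (hqp : q < p) {i k : Fin 2}
    (hk : k ≠ i) : √(limitVar p q i k) < √(limitVar p q i i) := by
  refine Real.sqrt_lt_sqrt (limitVar_nonneg _ _ _ _) ?_
  rw [limitVar_of_ne p q hk, limitVar_self]
  have hqp' : (q : ℝ) < p := hqp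
  have h1 : (q : ℝ) * (1 - q) < p * (1 - p) := by nlinarith [q.2.1]
  nlinarith [sq_pos_of_pos (sub_pos.2 h1)]

/-- The difference of the normalized means is of the expected order. -/
theorem exists_prob_diff_le {p q : unitInterval} (hp0 : 0 < (p : ℝ)) (hp : (p : ℝ) < 1 / 2)
    (hqp : q < p) {ε : ℝ} (hε : 0 < ε) :
    ∃ δ > 0, ∃ d₀ : ℕ, ∀ d : ℕ, d₀ ≤ d → ∀ D : Fin d → Fin 2, Balanced D → ∀ i k : Fin 2, k ≠ i →
      prob (piPMF fun j => pairLaw p q i (D j))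
        {z | |√(limitVar p q i i) * gapMean p q D k (fun j => (z j).1) (fun j => (z j).2) -
          √(limitVar p q i k) * gapMean p q D i (fun j => (z j).1) (fun j => (z j).2)| < δ * √d} ≤
        ε := by
  obtain ⟨V, hV, H⟩ := exists_normal_approx (τ := ε / 4) (by linarith)
  have hqp' : (q : ℝ) < p := hqp
  have hlv : ∀ i i' : Fin 2, i ≠ i' → limitVar p q i i = limitVar p q 0 0 ∧
      limitVar p q i i' = limitVar p q 0 1 := fun i i' h => by
    rw [limitVar_self, limitVar_self, limitVar_of_ne p q h.symm,
      limitVar_of_ne p q (by decide : (1 : Fin 2) ≠ 0)]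
    exact ⟨rfl, rfl⟩
  -- The quantity to be bounded is a linear form in the differences of the seeds, with one weight
  -- per block; `w₀` is its weight on block `i`. It is positive because the own-cluster variance is
  -- the larger one and `1 - 2q > 1 - 2p > 0`.
  set w₀ := √(limitVar p q 0 0) * (1 - 2 * (q : ℝ)) - √(limitVar p q 0 1) * (1 - 2 * p) with hw₀
  have hlt := sqrt_limitVar_lt hp hqp (i := 0) (k := 1) (by decide)
  have hw₀pos : 0 < w₀ := by
    have h1 : √(limitVar p q 0 1) * (1 - 2 * p) ≤ √(limitVar p q 0 0) * (1 - 2 * p) :=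
      mul_le_mul_of_nonneg_right hlt.le (by linarith)
    have h2 : 0 < √(limitVar p q 0 0) := (Real.sqrt_nonneg _).trans_lt hlt
    have h3 : √(limitVar p q 0 0) * (1 - 2 * p) < √(limitVar p q 0 0) * (1 - 2 * (q : ℝ)) :=
      mul_lt_mul_of_pos_left (by linarith) h2
    linarith
  set a := w₀ ^ 2 * ((p : ℝ) * (1 - p)) with ha
  have hapos : 0 < a := mul_pos (pow_pos hw₀pos 2) (mul_pos hp0 (by linarith))
  have hsa : 0 < √a := Real.sqrt_pos.2 hapos
  obtain ⟨N, hN⟩ := exists_nat_ge (V / a)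
  -- Block `i` alone gives the form variance at least `a d`. The window `±δ√d` then has normal
  -- probability at most `2δ/√a = ε/2`, and the two approximation errors add `ε/4` each.
  refine ⟨ε * √a / 4, by positivity, max N 1, fun d hd D hD i k hk => ?_⟩
  have hd0 : (0 : ℝ) < d := Nat.cast_pos.2 ((le_max_right N 1).trans hd)
  have hdN : V ≤ a * d := by
    rw [← div_le_iff₀' hapos]
    exact hN.trans (Nat.cast_le.2 ((le_max_left N 1).trans hd))
  set w : Fin 2 → ℝ := fun l => √(limitVar p q i i) * (1 - 2 * rate p q k l) -
    √(limitVar p q i k) * (1 - 2 * rate p q i l) with hw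
  have hwi : w i = w₀ := by
    rw [hw, hw₀, (hlv i k hk.symm).1, (hlv i k hk.symm).2]
    simp only [rate_eq, if_neg hk, if_true]
  have hs1 : ∀ k, √(limitVar p q i k) ≤ 1 := fun k => by
    rw [Real.sqrt_le_iff]
    exact ⟨zero_le_one, by linarith [limitVar_le p q i k]⟩
  have hrt : ∀ k l, 0 ≤ 1 - 2 * rate p q k l ∧ 1 - 2 * rate p q k l ≤ 1 := fun k l => by
    have := rate_le hqp k l
    have := rate_nonneg p q k l
    constructor <;> linarith
  have hw1 : ∀ l, |w l| ≤ 1 := fun l => by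
    have h1 := hrt k l
    have h2 := hrt i l
    have h3 := mul_le_one₀ (hs1 i) h1.1 h1.2
    have h4 := mul_le_one₀ (hs1 k) h2.1 h2.2
    have h5 := mul_nonneg (Real.sqrt_nonneg (limitVar p q i i)) h1.1
    have h6 := mul_nonneg (Real.sqrt_nonneg (limitVar p q i k)) h2.1
    rw [hw, abs_le]
    constructor <;> dsimp only <;> linarith
  have hexp : ∀ j, expect (pairLaw p q i (D j)) (fun z => ((bit z.1 - bit z.2) * w (D j)) ^ 2) =
      (fun l => 2 * rateVar p q i l * w l ^ 2) (D j) := fun j => by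
    simp only [mul_pow, expect_mul_const, expect_pairLaw_diff_sq]
  have hv : ∑ j, expect (pairLaw p q i (D j)) (fun z => ((bit z.1 - bit z.2) * w (D j)) ^ 2) =
      d * (rateVar p q i 0 * w 0 ^ 2 + rateVar p q i 1 * w 1 ^ 2) := by
    rw [Finset.sum_congr rfl fun j _ => hexp j,
      hD.sum_eq fun l => 2 * rateVar p q i l * w l ^ 2]
    ring
  set v := (d : ℝ) * (rateVar p q i 0 * w 0 ^ 2 + rateVar p q i 1 * w 1 ^ 2) with hvdef
  have hva : a * d ≤ v := by
    rw [mul_comm]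
    refine mul_le_mul_of_nonneg_left ?_ hd0.le
    have h1 : ∀ l, 0 ≤ rateVar p q i l * w l ^ 2 := fun l =>
      mul_nonneg (rateVar_nonneg p q i l) (sq_nonneg _)
    have h2 : a = rateVar p q i i * w i ^ 2 := by
      rw [hwi, ha, rateVar, rate_eq, if_pos rfl, mul_comm]
    have h3 := Finset.single_le_sum (f := fun l => rateVar p q i l * w l ^ 2)
      (fun l _ => h1 l) (Finset.mem_univ i)
    rw [Fin.sum_univ_two] at h3
    exact h2.trans_le h3
  have key := H (Fin d) (fun _ => Bool × Bool) (fun j => pairLaw p q i (D j))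
    (fun j z => (bit z.1 - bit z.2) * w (D j))
    (fun j z => by
      rw [abs_mul]
      exact mul_le_one₀ (abs_bit_sub_le _ _) (abs_nonneg _) (hw1 _))
    (fun j => by rw [expect_mul_const, expect_pairLaw_diff, zero_mul]) v hv (hdN.trans hva)
  have hL : ∀ z : Fin d → Bool × Bool,
      √(limitVar p q i i) * gapMean p q D k (fun j => (z j).1) (fun j => (z j).2) -
        √(limitVar p q i k) * gapMean p q D i (fun j => (z j).1) (fun j => (z j).2) =
      ∑ j, (bit (z j).1 - bit (z j).2) * w (D j) := fun z => by
    simp only [gapMean, Finset.mul_sum, ← Finset.sum_sub_distrib]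
    refine Finset.sum_congr rfl fun j _ => ?_
    rw [bitDiff, hw]
    ring
  simp only [hL]
  set t := ε * √a / 4 * √(d : ℝ) with ht
  have ht0 : 0 ≤ t := by positivity
  have hs : 0 < √v := Real.sqrt_pos.2 (lt_of_lt_of_le (by positivity) hva)
  have h1 := (key t).1
  have h2 := (key (-t)).2
  have h3 : prob (piPMF fun j => pairLaw p q i (D j))
      {z | |∑ j, (bit (z j).1 - bit (z j).2) * w (D j)| < t} +
      prob (piPMF fun j => pairLaw p q i (D j))
      {z | ∑ j, (bit (z j).1 - bit (z j).2) * w (D j) < -t} ≤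
      prob (piPMF fun j => pairLaw p q i (D j))
      {z | ∑ j, (bit (z j).1 - bit (z j).2) * w (D j) ≤ t} := by
    classical
    rw [prob_eq_expect, prob_eq_expect, prob_eq_expect, ← expect_add]
    refine expect_mono _ fun x => ?_
    simp only [Set.mem_ofPred_eq, abs_lt]
    split_ifs <;> norm_num <;> linarith
  have h4 := normalCDF_sub_le (x := -t / √v) (y := t / √v) (by gcongr; linarith)
  have h5 : t / √v - -t / √v = 2 * (t / √v) := by ring
  have h6 : t / √v ≤ ε / 4 := by
    rw [div_le_iff₀ hs, ht]
    have h7 : √a * √(d : ℝ) ≤ √v := by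
      rw [← Real.sqrt_mul hapos.le]
      exact Real.sqrt_le_sqrt hva
    calc ε * √a / 4 * √(d : ℝ) = ε / 4 * (√a * √(d : ℝ)) := by ring
      _ ≤ ε / 4 * √v := by gcongr
  linarith

/-- Three failure events of probability `ε/3` each. The order of the quantifiers matters: `M` and
`δ` are fixed before the precision `τ` of the variances, which is later chosen small in terms of
them. -/
theorem exists_typical {p q : unitInterval} (hp0 : 0 < (p : ℝ)) (hp : (p : ℝ) < 1 / 2)
    (hqp : q < p) {ε : ℝ} (hε : 0 < ε) :
    ∃ M > 0, ∃ δ > 0, ∀ τ > 0, τ ≤ 1 → ∃ d₀ : ℕ, ∀ d : ℕ, d₀ ≤ d → ∀ D : Fin d → Fin 2,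
      Balanced D → ∀ i : Fin 2, (expect (rowLaw p q D i) fun b =>
        prob (rowLaw p q D i) {b' | ¬ Typical p q D i M τ δ b b'}) ≤ ε := by
  have hexp : ∀ c > 0, ∃ N : ℕ, ∀ x : ℝ, N ≤ x → 2 * Real.exp (-(c * x)) ≤ ε / 6 := by
    intro c hc
    obtain ⟨N, hN⟩ := exists_nat_ge (-Real.log (ε / 12) / c)
    refine ⟨N, fun x hx => ?_⟩
    have h1 := hN.trans hx
    rw [div_le_iff₀' hc] at h1
    have h2 : Real.exp (-(c * x)) ≤ ε / 12 := by
      rw [← Real.le_log_iff_exp_le (by linarith)]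
      linarith
    linarith
  obtain ⟨N₁, hN₁⟩ := hexp (1 / 16) (by norm_num)
  obtain ⟨δ, hδ, N₂, hN₂⟩ := exists_prob_diff_le hp0 hp hqp (ε := ε / 3) (by linarith)
  set M : ℝ := N₁ + 1 with hM
  have hM0 : 0 < M := by positivity
  have hM2 : (N₁ : ℝ) ≤ M ^ 2 := by
    have : (0 : ℝ) ≤ N₁ := Nat.cast_nonneg _
    rw [hM]
    nlinarith
  refine ⟨M, hM0, δ, hδ, fun τ hτ hτ1 => ?_⟩
  obtain ⟨N₃, hN₃⟩ := hexp (τ ^ 2 / 16) (by positivity)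
  obtain ⟨N₄, hN₄⟩ := exists_nat_ge (M ^ 2)
  refine ⟨max (max N₂ N₃) (max N₄ 1), fun d hd D hD i => ?_⟩
  have hd2 : N₂ ≤ d := by omega
  have hd3 : (N₃ : ℝ) ≤ d := by exact_mod_cast (by omega : N₃ ≤ d)
  have hd4 : M ^ 2 ≤ d := hN₄.trans (by exact_mod_cast (by omega : N₄ ≤ d))
  have hd0 : 0 < d := by omega
  rw [expect_prob_rowLaw]
  obtain ⟨k, hk⟩ : ∃ k, k ≠ i := ⟨i + 1, by fin_cases i <;> simp⟩
  have e1 : prob (piPMF fun j => pairLaw p q i (D j)) {z | ∃ l,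
      z ∈ {z | M * √d ≤ |blockSum D l (bitDiff (fun j => (z j).1) fun j => (z j).2)|}} ≤ ε / 3 := by
    refine (prob_exists_le_card _ _ fun l => prob_blockSum_le p q D i l hM0.le hd4 hd0).trans ?_
    have := hN₁ _ hM2
    rw [Fintype.card_fin]
    have h1 : 1 / 16 * M ^ 2 = M ^ 2 / 16 := by ring
    rw [h1] at this
    push_cast
    linarith
  have e2 : prob (piPMF fun j => pairLaw p q i (D j)) {z | ∃ l, z ∈ {z | τ * d ≤
      |blockSum D l (fun j => bitDiff (fun j => (z j).1) (fun j => (z j).2) j ^ 2) -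
        rateVar p q i l * d|}} ≤ ε / 3 := by
    refine (prob_exists_le_card _ _ fun l => prob_blockSum_sq_le p q hD i l hτ.le hτ1).trans ?_
    have := hN₃ _ hd3
    rw [Fintype.card_fin]
    have h1 : τ ^ 2 / 16 * (d : ℝ) = τ ^ 2 * d / 16 := by ring
    rw [h1] at this
    push_cast
    linarith
  have e3 := hN₂ d hd2 D hD i k hk
  refine (prob_mono _ fun z hz => ?_).trans ((prob_union_le _ _ _).trans
    (add_le_add ((prob_union_le _ _ _).trans (add_le_add e1 e2)) e3) |>.trans_eq (by ring))
  by_contra hcon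
  simp only [Set.mem_union, not_or, Set.mem_ofPred_eq, not_exists, not_le, not_lt] at hcon
  refine hz ⟨fun l => (hcon.1.1 l).le, fun l => (hcon.1.2 l).le, fun k' hk' => ?_⟩
  have : k' = k := (fin_two_eq_or (i := k') hk).resolve_right hk'
  rw [this]
  exact hcon.2

end Typical

end BooleanBlock

namespace BooleanBlock

/-! ### Good seeds: balanced and distinguishable assignment probabilities -/

section Good

theorem expect_prob_not_mono {α β : Type} [Fintype α] [Fintype β] (μ : PMF α) (ν : PMF β)
    {R S : α → β → Prop} (h : ∀ a b, R a b → S a b) :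
    (expect μ fun a => prob ν {b | ¬ S a b}) ≤ expect μ fun a => prob ν {b | ¬ R a b} :=
  expect_mono _ fun a => prob_mono _ fun b hb hR => hb (h a b hR)

variable {d : ℕ}

/-- Properties of two seeds from cluster `i` that make both algorithms behave as expected: both
centers attract a constant fraction of cluster `i`, the fractions of the two clusters that are
attracted by the first center differ, and there are few points in the middle. -/
structure GoodSeeds (p q : unitInterval) (D : Fin d → Fin 2) (i : Fin 2) (c τ : ℝ)
    (b b' : Fin d → Bool) : Prop where
  le_first : c ≤ firstProb p q D i b b'
  first_le : firstProb p q D i b b' ≤ 1 - c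
  diff : ∀ k, k ≠ i → c ≤ |firstProb p q D i b b' - firstProb p q D k b b'|
  middle : ∀ k, prob (rowLaw p q D k) {x | |gap b b' x| ≤ 2} ≤ τ

theorem abs_sqrt_sub_sqrt_le {a b t : ℝ} (ha : 0 ≤ a) (hb : 0 ≤ b) (h : |a - b| ≤ t) :
    |√a - √b| ≤ √t := by
  refine Real.le_sqrt_of_sq_le (le_trans ?_ h)
  have h1 : |a - b| = |√a - √b| * (√a + √b) := by
    rw [← abs_of_nonneg (add_nonneg (Real.sqrt_nonneg a) (Real.sqrt_nonneg b)), ← abs_mul]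
    congr 1
    nlinarith [Real.mul_self_sqrt ha, Real.mul_self_sqrt hb]
  rw [h1, sq]
  refine mul_le_mul_of_nonneg_left ?_ (abs_nonneg _)
  rw [abs_le]
  constructor <;> linarith [Real.sqrt_nonneg a, Real.sqrt_nonneg b]

variable {p q : unitInterval} {D : Fin d → Fin 2} {i : Fin 2} {M τ δ : ℝ} {b b' : Fin d → Bool}

theorem Typical.le_gapVar (h : Typical p q D i M τ δ b b') (hτ : 0 ≤ τ) {k : Fin 2}
    (hk : τ ≤ limitVar p q i k / 2) : limitVar p q i k / 2 * d ≤ gapVar p q D k b b' := by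
  have h1 := (abs_le.1 (h.abs_gapVar_sub_le hτ k)).1
  have h2 : τ * d ≤ limitVar p q i k / 2 * d := mul_le_mul_of_nonneg_right hk (Nat.cast_nonneg d)
  linarith

theorem Typical.abs_normalized_le (h : Typical p q D i M τ δ b b') (hM : 0 ≤ M) (hτ : 0 ≤ τ)
    (hd : 0 < d) {k : Fin 2} (hk : τ ≤ limitVar p q i k / 2) (hk0 : 0 < limitVar p q i k) :
    |-(gapMean p q D k b b' / (2 * √(gapVar p q D k b b')))| ≤ M / √(limitVar p q i k / 2) := by
  have hd' : (0 : ℝ) < d := Nat.cast_pos.2 hd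
  have h1 := h.le_gapVar hτ hk
  have h2 : √(limitVar p q i k / 2) * √d ≤ √(gapVar p q D k b b') := by
    rw [← Real.sqrt_mul (by linarith)]
    exact Real.sqrt_le_sqrt h1
  have h3 : 0 < √(limitVar p q i k / 2) := Real.sqrt_pos.2 (by linarith)
  have h4 : 0 < √(d : ℝ) := Real.sqrt_pos.2 hd'
  have h5 : 0 < √(gapVar p q D k b b') := lt_of_lt_of_le (by positivity) h2
  rw [abs_neg, abs_div, abs_of_pos (by positivity : 0 < 2 * √(gapVar p q D k b b')),
    div_le_div_iff₀ (by positivity) h3]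
  calc |gapMean p q D k b b'| * √(limitVar p q i k / 2)
      ≤ 2 * M * √d * √(limitVar p q i k / 2) :=
        mul_le_mul_of_nonneg_right (h.abs_gapMean_le k) h3.le
    _ = M * (2 * (√(limitVar p q i k / 2) * √d)) := by ring
    _ ≤ M * (2 * √(gapVar p q D k b b')) := by gcongr

/-- Over a common denominator, the numerator is a cross product of means and standard deviations.
Replacing the standard deviations by their limits costs `2M√τ d` twice, at most `δ d/2` in all, so
`δ d/2` of the typical difference survives; the denominator is at most `2d`. -/
theorem Typical.le_abs_normalized_sub (h : Typical p q D i M τ δ b b') (hτ : 0 ≤ τ)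
    (hδ : 0 ≤ δ) (hτ1 : τ ≤ 1 / 2) (hτδ : 8 * M * √τ ≤ δ) (hd : 0 < d) {k : Fin 2} (hki : k ≠ i)
    (hk : τ ≤ limitVar p q i k / 2) (hk0 : 0 < limitVar p q i k)
    (hi : τ ≤ limitVar p q i i / 2) (hi0 : 0 < limitVar p q i i) :
    δ / 4 ≤ |-(gapMean p q D i b b' / (2 * √(gapVar p q D i b b'))) -
      -(gapMean p q D k b b' / (2 * √(gapVar p q D k b b')))| := by
  have hd' : (0 : ℝ) < d := Nat.cast_pos.2 hd
  have hsd : 0 < √(d : ℝ) := Real.sqrt_pos.2 hd'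
  have hss : √(d : ℝ) * √d = d := Real.mul_self_sqrt hd'.le
  have hvpos : ∀ l, τ ≤ limitVar p q i l / 2 → 0 < limitVar p q i l →
      0 < gapVar p q D l b b' := fun l hl hl0 =>
    lt_of_lt_of_le (by positivity) (h.le_gapVar hτ hl)
  have hvi := hvpos i hi hi0
  have hvk := hvpos k hk hk0
  have hsq : ∀ l, 0 < gapVar p q D l b b' →
      |√(gapVar p q D l b b') - √(limitVar p q i l) * √d| ≤ √τ * √d := fun l hl => by
    rw [← Real.sqrt_mul (limitVar_nonneg p q i l), ← Real.sqrt_mul hτ]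
    exact abs_sqrt_sub_sqrt_le hl.le (mul_nonneg (limitVar_nonneg p q i l) hd'.le)
      (h.abs_gapVar_sub_le hτ l)
  have hle : ∀ l, √(gapVar p q D l b b') ≤ √d := fun l => by
    refine Real.sqrt_le_sqrt ?_
    have h1 := (abs_le.1 (h.abs_gapVar_sub_le hτ l)).2
    have h2 := limitVar_le p q i l
    nlinarith
  set si := √(gapVar p q D i b b') with hsi
  set sk := √(gapVar p q D k b b') with hsk
  have hsi0 : 0 < si := Real.sqrt_pos.2 hvi
  have hsk0 : 0 < sk := Real.sqrt_pos.2 hvk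
  set mi := gapMean p q D i b b'
  set mk := gapMean p q D k b b'
  have hmi : |mi| ≤ 2 * M * √d := h.abs_gapMean_le i
  have hmk : |mk| ≤ 2 * M * √d := h.abs_gapMean_le k
  have hnum : δ / 2 * d ≤ |si * mk - sk * mi| := by
    have e : √(d : ℝ) * (√(limitVar p q i i) * mk - √(limitVar p q i k) * mi) =
        (si * mk - sk * mi) - (si - √(limitVar p q i i) * √d) * mk +
          (sk - √(limitVar p q i k) * √d) * mi := by ring
    have h1 : |√(d : ℝ) * (√(limitVar p q i i) * mk - √(limitVar p q i k) * mi)| ≤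
        |si * mk - sk * mi| + |(si - √(limitVar p q i i) * √d) * mk| +
          |(sk - √(limitVar p q i k) * √d) * mi| := by
      rw [e]
      exact (abs_add_le _ _).trans (by gcongr; exact abs_sub _ _)
    have h2 : |(si - √(limitVar p q i i) * √d) * mk| ≤ √τ * √d * (2 * M * √d) := by
      rw [abs_mul]
      exact mul_le_mul (hsq i hvi) hmk (abs_nonneg _) (by positivity)
    have h3 : |(sk - √(limitVar p q i k) * √d) * mi| ≤ √τ * √d * (2 * M * √d) := by
      rw [abs_mul]
      exact mul_le_mul (hsq k hvk) hmi (abs_nonneg _) (by positivity)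
    have h4 : δ * d ≤ |√(d : ℝ) * (√(limitVar p q i i) * mk - √(limitVar p q i k) * mi)| := by
      rw [abs_mul, abs_of_pos hsd]
      calc δ * d = √(d : ℝ) * (δ * √d) := by linear_combination (-δ) * hss
        _ ≤ _ := mul_le_mul_of_nonneg_left (h.diff k hki) hsd.le
    have h5 : √τ * √d * (2 * M * √d) = 2 * M * √τ * d := by
      linear_combination (2 * M * √τ) * hss
    have h6 : 8 * M * √τ * d ≤ δ * d := mul_le_mul_of_nonneg_right hτδ hd'.le
    rw [h5] at h2 h3
    linarith
  have e : -(mi / (2 * si)) - -(mk / (2 * sk)) = (si * mk - sk * mi) / (2 * (si * sk)) := by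
    field_simp
    ring
  rw [e, abs_div, abs_of_pos (by positivity : 0 < 2 * (si * sk)), le_div_iff₀ (by positivity)]
  have h7 : si * sk ≤ d := by
    rw [← hss]
    exact mul_le_mul (hle i) (hle k) hsk0.le hsd.le
  nlinarith

/-- Two independent points of the same cluster are good seeds, except with small probability. -/
theorem exists_goodSeeds {p q : unitInterval} (hp0 : 0 < (p : ℝ)) (hp : (p : ℝ) < 1 / 2)
    (hqp : q < p) {ε : ℝ} (hε : 0 < ε) :
    ∃ c > 0, ∀ τ > 0, ∃ d₀ : ℕ, ∀ d : ℕ, d₀ ≤ d → ∀ D : Fin d → Fin 2, Balanced D → ∀ i : Fin 2,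
      (expect (rowLaw p q D i) fun b =>
        prob (rowLaw p q D i) {b' | ¬ GoodSeeds p q D i c τ b b'}) ≤ ε := by
  obtain ⟨M, hM, δ, hδ, Htyp⟩ := exists_typical hp0 hp hqp hε
  set V₁ := limitVar p q 0 0 with hV₁
  set V₂ := limitVar p q 0 1 with hV₂
  have hP : 0 < (p : ℝ) * (1 - p) := mul_pos hp0 (by linarith)
  have hlv1 : ∀ i, limitVar p q i i = V₁ := fun i => by rw [hV₁, limitVar_self, limitVar_self]
  have hlv2 : ∀ i k, k ≠ i → limitVar p q i k = V₂ := fun i k hk => by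
    rw [hV₂, limitVar_of_ne p q hk, limitVar_of_ne p q (by decide)]
  have hV₁0 : 0 < V₁ := by
    rw [hV₁, limitVar_self]
    positivity
  have hV₂0 : 0 ≤ V₂ := limitVar_nonneg p q 0 1
  set M₂ := M / √(V₁ / 2) + M / √(V₂ / 2) with hM₂
  have hMa : M / √(V₁ / 2) ≤ M₂ := le_add_of_nonneg_right (by positivity)
  have hMb : M / √(V₂ / 2) ≤ M₂ := le_add_of_nonneg_left (by positivity)
  obtain ⟨cΦ, hcΦ, HΦ⟩ := exists_le_normalCDF_sub M₂
  -- Normalized means stay in `[-M₂, M₂]`, so the corresponding normal probabilities are at least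
  -- `c₀` away from 0 and 1.
  obtain ⟨c₀, hc₀, hc₀l, hc₀r⟩ : ∃ c₀ > 0, c₀ ≤ normalCDF (-M₂) ∧ normalCDF M₂ ≤ 1 - c₀ := by
    refine ⟨min (normalCDF (-M₂)) (1 - normalCDF M₂), lt_min ?_ ?_, min_le_left _ _, ?_⟩
    · exact (normalCDF_nonneg (-M₂ - 1)).trans_lt (normalCDF_strictMono (by linarith))
    · have := (normalCDF_strictMono (lt_add_one M₂)).trans_le (normalCDF_le_one (M₂ + 1))
      linarith
    · have := min_le_right (normalCDF (-M₂)) (1 - normalCDF M₂)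
      linarith
  refine ⟨min (c₀ / 2) (cΦ * δ / 8), lt_min (by linarith) (by positivity), fun τ hτ => ?_⟩
  -- Precision of the normal approximation: below the required `τ`, and small compared with both
  -- lower bounds `c₀` and `cΦ * δ` that it must not spoil.
  set τ' := min τ (min (min (c₀ / 4) (1 / 2)) (cΦ * δ / 16)) with hτ'
  have hτ'0 : 0 < τ' := lt_min hτ (lt_min (lt_min (by linarith) (by norm_num)) (by positivity))
  have hτ'1 : τ' ≤ τ := min_le_left _ _
  have hτ'2 : τ' ≤ c₀ / 4 := (min_le_right _ _).trans ((min_le_left _ _).trans (min_le_left _ _))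
  have hτ'4 : τ' ≤ cΦ * δ / 16 := (min_le_right _ _).trans (min_le_right _ _)
  obtain ⟨V, hV, HV⟩ := exists_firstProb_approx hτ'0
  -- The seeds' own planted cluster: its gap always has variance of order `d`, so the normal
  -- approximation applies for every `q`.
  have own : ∀ {d : ℕ} {D : Fin d → Fin 2} {i : Fin 2} {t : ℝ} {b b' : Fin d → Bool},
      Typical p q D i M t δ b b' → 0 ≤ t → t ≤ V₁ / 2 → 0 < d → V ≤ V₁ / 2 * d →
      c₀ - τ' ≤ firstProb p q D i b b' ∧ firstProb p q D i b b' ≤ 1 - (c₀ - τ') ∧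
        prob (rowLaw p q D i) {x | |gap b b' x| ≤ 2} ≤ τ' := by
    intro d D i t b b' h ht htV hd hVd
    have h1 := h.le_gapVar ht (k := i) (by rw [hlv1]; exact htV)
    rw [hlv1] at h1
    obtain ⟨h2, h3⟩ := HV p q d D i b b' (hVd.trans h1)
    have h4 := h.abs_normalized_le hM.le ht hd (k := i) (by rw [hlv1]; exact htV)
      (by rw [hlv1]; exact hV₁0)
    rw [hlv1] at h4
    have h5 := abs_le.1 (h4.trans hMa)
    have h6 := normalCDF_mono h5.1
    have h7 := normalCDF_mono h5.2
    have h8 := abs_le.1 h2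
    exact ⟨by linarith, by linarith, h3⟩
  -- For `q = 0` the limiting variance on the other cluster vanishes and the central limit theorem
  -- says nothing there. Bernstein's inequality shows instead that the other cluster goes almost
  -- entirely to one seed, while the own cluster is split.
  by_cases hq : (q : ℝ) = 0
  · have hV₂z : V₂ = 0 := by rw [hV₂, limitVar_of_ne p q (by decide), hq]; ring
    -- The exponent below will be `1 - δ/(4√t)`; choosing `t` with `δ/(4√t) ≥ y` makes it at most
    -- `log τ'`.
    set y := 1 - Real.log τ' with hy
    have hy0 : 0 < y := by
      have := Real.log_neg hτ'0 (by
        linarith [(min_le_right τ (min (min (c₀ / 4) (1 / 2)) (cΦ * δ / 16))).trans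
          ((min_le_left _ _).trans (min_le_right _ _))])
      linarith
    set t := min (min (V₁ / 2) 1) ((δ / (4 * y)) ^ 2) with ht
    have ht0 : 0 < t := lt_min (lt_min (by linarith) one_pos) (by positivity)
    have htV : t ≤ V₁ / 2 := (min_le_left _ _).trans (min_le_left _ _)
    have hst : 0 < √t := Real.sqrt_pos.2 ht0
    have hty : √t ≤ δ / (4 * y) := Real.sqrt_le_iff.2 ⟨by positivity, min_le_right _ _⟩
    obtain ⟨N₁, hN₁⟩ := Htyp t ht0 ((min_le_left _ _).trans (min_le_right _ _))
    obtain ⟨N₂, hN₂⟩ := exists_nat_ge (V / (V₁ / 2))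
    obtain ⟨N₃, hN₃⟩ := exists_nat_ge (1 / t)
    obtain ⟨N₄, hN₄⟩ := exists_nat_ge ((4 / δ) ^ 2)
    refine ⟨max (max N₁ N₂) (max (max N₃ N₄) 1), fun d hd D hD i => ?_⟩
    have hd1 : N₁ ≤ d := by omega
    refine (expect_prob_not_mono _ _ fun b b' hT => ?_).trans (hN₁ d hd1 D hD i)
    have hd0 : 0 < d := by omega
    have hd0' : (0 : ℝ) < d := Nat.cast_pos.2 hd0
    have hsd : 0 < √(d : ℝ) := Real.sqrt_pos.2 hd0'
    have hd2 : V ≤ V₁ / 2 * d := by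
      rw [← div_le_iff₀' (by linarith)]
      exact hN₂.trans (by exact_mod_cast (by omega : N₂ ≤ d))
    have hd3 : 1 ≤ t * d := by
      rw [← div_le_iff₀' ht0]
      exact hN₃.trans (by exact_mod_cast (by omega : N₃ ≤ d))
    have hd4 : 4 ≤ δ * √d := by
      rw [← div_le_iff₀' hδ]
      exact Real.le_sqrt_of_sq_le (hN₄.trans (by exact_mod_cast (by omega : N₄ ≤ d)))
    obtain ⟨o1, o2, o3⟩ := own hT ht0.le htV hd0 hd2
    have oth : ∀ k, k ≠ i → (firstProb p q D k b b' ≤ τ' ∨ 1 - τ' ≤ firstProb p q D k b b') ∧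
        prob (rowLaw p q D k) {x | |gap b b' x| ≤ 2} ≤ τ' := by
      intro k hk
      have h1 : gapVar p q D k b b' ≤ t * d := by
        have := (abs_le.1 (hT.abs_gapVar_sub_le ht0.le k)).2
        rw [hlv2 i k hk, hV₂z] at this
        linarith
      have h2 : δ * √d ≤ |gapMean p q D k b b'| := by
        have := hT.diff k hk
        rw [hlv2 i k hk, hV₂z, Real.sqrt_zero, zero_mul, sub_zero, hlv1, abs_mul,
          abs_of_nonneg (Real.sqrt_nonneg _)] at this
        refine this.trans (mul_le_of_le_one_left (abs_nonneg _) ?_)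
        rw [Real.sqrt_le_iff]
        exact ⟨zero_le_one, by linarith [limitVar_le p q 0 0]⟩
      have hl : 1 ≤ √t * √d := by
        rw [← Real.sqrt_mul ht0.le, Real.one_le_sqrt]
        exact hd3
      -- This `l` makes the variance term `l² t d` equal to 1, and `l ≤ 1` is the condition `t d ≥
      -- 1`.
      have h3 := firstProb_of_gapVar_le p q D (l := 1 / (√t * √d)) (by positivity)
        (by rw [div_le_one (by positivity)]; exact hl) h1 hd4 h2
      have h4 : Real.exp (-(1 / (√t * √d) * (δ * √d / 4)) + (1 / (√t * √d)) ^ 2 * (t * d)) ≤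
          τ' := by
        rw [← Real.le_log_iff_exp_le hτ'0]
        have h5 : (1 / (√t * √d)) ^ 2 * (t * d) = 1 := by
          rw [div_pow, mul_pow, Real.sq_sqrt ht0.le, Real.sq_sqrt hd0'.le]
          field_simp
        have h6 : 1 / (√t * √d) * (δ * √d / 4) = δ / (4 * √t) := by
          field_simp
        have h7 : y ≤ δ / (4 * √t) := by
          rw [le_div_iff₀ (by positivity)]
          rw [le_div_iff₀ (by positivity)] at hty
          linarith
        rw [h5, h6]
        linarith
      refine ⟨h3.1.imp (fun h => h.trans h4) fun h => ?_, h3.2.trans h4⟩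
      linarith
    refine ⟨?_, ?_, fun k hk => ?_, fun k => ?_⟩
    · exact (min_le_left _ _).trans (by linarith)
    · have := min_le_left (c₀ / 2) (cΦ * δ / 8)
      linarith
    · refine (min_le_left _ _).trans (le_abs.2 ?_)
      rcases (oth k hk).1 with h | h
      · left; linarith
      · right; linarith
    · by_cases hk : k = i
      · rw [hk]
        exact o3.trans hτ'1
      · exact (oth k hk).2.trans hτ'1
  · have hq0 : 0 < (q : ℝ) := lt_of_le_of_ne q.2.1 (Ne.symm hq)
    have hqp' : (q : ℝ) < p := hqp
    have hV₂0 : 0 < V₂ := by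
      rw [hV₂, limitVar_of_ne p q (by decide)]
      have : 0 < (q : ℝ) * (1 - q) := mul_pos hq0 (by linarith)
      positivity
    set t := min (min (V₁ / 2) (V₂ / 2)) (min (1 / 2) ((δ / (8 * M)) ^ 2)) with ht
    have ht0 : 0 < t := lt_min (lt_min (by linarith) (by linarith))
      (lt_min (by norm_num) (by positivity))
    have ht1 : t ≤ V₁ / 2 := (min_le_left _ _).trans (min_le_left _ _)
    have ht2 : t ≤ V₂ / 2 := (min_le_left _ _).trans (min_le_right _ _)
    have ht3 : t ≤ 1 / 2 := (min_le_right _ _).trans (min_le_left _ _)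
    have ht4 : 8 * M * √t ≤ δ := by
      have : √t ≤ δ / (8 * M) := Real.sqrt_le_iff.2
        ⟨by positivity, (min_le_right _ _).trans (min_le_right _ _)⟩
      rw [le_div_iff₀ (by positivity)] at this
      linarith
    obtain ⟨N₁, hN₁⟩ := Htyp t ht0 (ht3.trans (by norm_num))
    obtain ⟨N₂, hN₂⟩ := exists_nat_ge (V / (V₁ / 2))
    obtain ⟨N₃, hN₃⟩ := exists_nat_ge (V / (V₂ / 2))
    refine ⟨max (max N₁ N₂) (max N₃ 1), fun d hd D hD i => ?_⟩
    have hd1 : N₁ ≤ d := by omega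
    refine (expect_prob_not_mono _ _ fun b b' hT => ?_).trans (hN₁ d hd1 D hD i)
    have hd0 : 0 < d := by omega
    have hd2 : V ≤ V₁ / 2 * d := by
      rw [← div_le_iff₀' (by linarith)]
      exact hN₂.trans (by exact_mod_cast (by omega : N₂ ≤ d))
    have hd3 : V ≤ V₂ / 2 * d := by
      rw [← div_le_iff₀' (by linarith)]
      exact hN₃.trans (by exact_mod_cast (by omega : N₃ ≤ d))
    obtain ⟨o1, o2, o3⟩ := own hT ht0.le ht1 hd0 hd2
    have oth : ∀ k, k ≠ i → |firstProb p q D k b b' -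
        normalCDF (-(gapMean p q D k b b' / (2 * √(gapVar p q D k b b'))))| ≤ τ' ∧
        prob (rowLaw p q D k) {x | |gap b b' x| ≤ 2} ≤ τ' := by
      intro k hk
      have h1 := hT.le_gapVar ht0.le (k := k) (by rw [hlv2 i k hk]; exact ht2)
      rw [hlv2 i k hk] at h1
      exact HV p q d D k b b' (hd3.trans h1)
    refine ⟨?_, ?_, fun k hk => ?_, fun k => ?_⟩
    · exact (min_le_left _ _).trans (by linarith)
    · have := min_le_left (c₀ / 2) (cΦ * δ / 8)
      linarith
    -- The normalized means differ by `δ/4`, hence the normal probabilities by `cΦ δ/4`; two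
    -- approximation errors of at most `cΦ δ/16` leave `cΦ δ/8`.
    · refine (min_le_right _ _).trans ?_
      have hki : t ≤ limitVar p q i k / 2 := by rw [hlv2 i k hk]; exact ht2
      have hii : t ≤ limitVar p q i i / 2 := by rw [hlv1]; exact ht1
      have hki0 : 0 < limitVar p q i k := by rw [hlv2 i k hk]; exact hV₂0
      have hii0 : 0 < limitVar p q i i := by rw [hlv1]; exact hV₁0
      have h1 := hT.le_abs_normalized_sub ht0.le hδ.le ht3 ht4 hd0 hk hki hki0 hii hii0
      have h2' := hT.abs_normalized_le hM.le ht0.le hd0 hki hki0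
      rw [hlv2 i k hk] at h2'
      have h2 := abs_le.1 (h2'.trans hMb)
      have h3' := hT.abs_normalized_le hM.le ht0.le hd0 hii hii0
      rw [hlv1] at h3'
      have h3 := abs_le.1 (h3'.trans hMa)
      have h4 := abs_le.1 (oth k hk).1
      have h1i := hT.le_gapVar ht0.le hii
      rw [hlv1] at h1i
      have h5 := abs_le.1 (HV p q d D i b b' (hd2.trans h1i)).1
      generalize -(gapMean p q D i b b' / (2 * √(gapVar p q D i b b'))) = u at *
      generalize -(gapMean p q D k b b' / (2 * √(gapVar p q D k b b'))) = v at *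
      rcases le_total u v with huv | huv
      · have h6 := HΦ u v h3.1 huv h2.2
        rw [abs_of_nonpos (by linarith)] at h1
        have h7 : cΦ * (δ / 4) ≤ cΦ * (v - u) := mul_le_mul_of_nonneg_left (by linarith) hcΦ.le
        refine le_abs.2 (Or.inr ?_)
        linarith
      · have h6 := HΦ v u h2.1 huv h3.2
        rw [abs_of_nonneg (by linarith)] at h1
        have h7 : cΦ * (δ / 4) ≤ cΦ * (u - v) := mul_le_mul_of_nonneg_left (by linarith) hcΦ.le
        refine le_abs.2 (Or.inl ?_)
        linarith
    · by_cases hk : k = i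
      · rw [hk]
        exact o3.trans hτ'1
      · exact (oth k hk).2.trans hτ'1

end Good

end BooleanBlock

namespace BooleanBlock

/-! ### Resampling coordinates -/

section Resample

variable {ι : Type} [Fintype ι] [DecidableEq ι] {β : ι → Type} [∀ i, Fintype (β i)]

theorem piPMF_map {γ : ι → Type} [∀ i, Fintype (γ i)] (μ : ∀ i, PMF (β i))
    (h : ∀ i, β i → γ i) :
    (piPMF μ).map (fun x i => h i (x i)) = piPMF fun i => (μ i).map (h i) := by
  classical
  ext y
  rw [← ENNReal.toReal_eq_toReal_iff' (PMF.apply_ne_top _ _) (PMF.apply_ne_top _ _),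
    piPMF_apply_toReal, toReal_eq_expect, expect_map]
  simp only [toReal_eq_expect (PMF.map _ _), expect_map]
  rw [← expect_piPMF_prod μ fun i b => if h i b = y i then 1 else 0]
  congr 1
  funext x
  rw [Finset.prod_ite_zero]
  simp [funext_iff]

theorem expect_piPMF_update_pure (μ : ∀ i, PMF (β i)) (i : ι) (u : β i) (F : (∀ i, β i) → ℝ) :
    expect (piPMF (Function.update μ i (PMF.pure u))) F =
      expect (piPMF μ) fun x => F (Function.update x i u) := by
  let h : ∀ j, β j → β j := Function.update (fun _ => id) i fun _ => u
  have h1 : (fun j => (μ j).map (h j)) = Function.update μ i (PMF.pure u) := by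
    funext j
    by_cases hj : j = i
    · subst hj
      simp only [h, Function.update_self]
      exact PMF.map_const _ _
    · simp [h, hj, PMF.map_id]
  rw [← h1, ← piPMF_map, expect_map]
  congr 1
  funext x
  congr 1
  funext j
  by_cases hj : j = i
  · subst hj
    simp [h]
  · simp [h, hj]

/-- Decouples a coordinate from the rest; it serves to compare an assignment with one that ignores a
given feature. -/
theorem expect_piPMF_resample (μ : ∀ i, PMF (β i)) (i : ι) (F : (∀ i, β i) → ℝ) :
    expect (piPMF μ) F = expect (μ i) fun u => expect (piPMF μ) fun x =>
      F (Function.update x i u) := by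
  rw [expect_piPMF_update μ i]
  simp only [expect_piPMF_update_pure]

end Resample

/-- The laws of the data points when two of them are given. -/
noncomputable def seeded {n : ℕ} {α : Type} (μ : Fin n → PMF α) (s : Fin 2 ↪ Fin n) (b b' : α) :
    Fin n → PMF α :=
  Function.update (Function.update μ (s 0) (PMF.pure b)) (s 1) (PMF.pure b')

theorem seeded_of_ne {n : ℕ} {α : Type} (μ : Fin n → PMF α) (s : Fin 2 ↪ Fin n) (b b' : α)
    {a : Fin n} (h0 : a ≠ s 0) (h1 : a ≠ s 1) : seeded μ s b b' a = μ a := by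
  rw [seeded, Function.update_of_ne h1, Function.update_of_ne h0]

/-- Conditioning on the two seeds: their indices are fixed, so the remaining points stay independent
with unchanged laws. -/
theorem expect_piPMF_seeded {n : ℕ} {α : Type} [Fintype α] (μ : Fin n → PMF α)
    (s : Fin 2 ↪ Fin n) (F : (Fin n → α) → ℝ) :
    expect (piPMF μ) F = expect (μ (s 0)) fun b => expect (μ (s 1)) fun b' =>
      expect (piPMF (seeded μ s b b')) F := by
  rw [expect_piPMF_update μ (s 0)]
  congr 1
  funext b
  rw [expect_piPMF_update _ (s 1), Function.update_of_ne (s.injective.ne (by decide))]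
  rfl

theorem seeded_support {n : ℕ} {α : Type} [Fintype α] (μ : Fin n → PMF α)
    (s : Fin 2 ↪ Fin n) {b b' : α} {X : Fin n → α} (h : piPMF (seeded μ s b b') X ≠ 0) :
    (fun k => X (s k)) = ![b, b'] := by
  classical
  have hne : s 0 ≠ s 1 := s.injective.ne (by decide)
  have h0 := support_piPMF h (s 0)
  have h1 := support_piPMF h (s 1)
  rw [seeded, Function.update_of_ne hne, Function.update_self] at h0
  rw [seeded, Function.update_self] at h1
  have hb : X (s 0) = b := by
    by_contra hcon
    exact h0 (by simp [PMF.pure_apply, hcon])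
  have hb' : X (s 1) = b' := by
    by_contra hcon
    exact h1 (by simp [PMF.pure_apply, hcon])
  funext k
  fin_cases k
  exacts [hb, hb']

/-- Sums over all points of expectations, when two points are given. -/
theorem sum_seeded_le {n : ℕ} {α : Type} [Fintype α] {μ : Fin n → PMF α} {s : Fin 2 ↪ Fin n}
    {b b' : α} {g : Fin n → α → ℝ} {f : Fin n → ℝ} (hg : ∀ a x, g a x ≤ f a + 1)
    (h : ∀ a, expect (μ a) (g a) ≤ f a) :
    ∑ a, expect (seeded μ s b b' a) (g a) ≤ ∑ a, f a + 2 := by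
  -- The two seeds satisfy only the trivial bound `f a + 1`, which accounts for the `+ 2`.
  have h1 : ∀ a, expect (seeded μ s b b' a) (g a) ≤
      f a + ((if a = s 0 then 1 else 0) + if a = s 1 then 1 else 0) := fun a => by
    by_cases h0 : a = s 0
    · refine (expect_le_const _ (hg a)).trans ?_
      rw [if_pos h0]
      split_ifs <;> linarith
    · by_cases h1 : a = s 1
      · refine (expect_le_const _ (hg a)).trans ?_
        rw [if_neg h0, if_pos h1]
        linarith
      · rw [seeded_of_ne μ s b b' h0 h1, if_neg h0, if_neg h1]
        linarith [h a]
  refine (Finset.sum_le_sum fun a _ => h1 a).trans_eq ?_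
  rw [Finset.sum_add_distrib, Finset.sum_add_distrib]
  rw [Finset.sum_ite_eq', Finset.sum_ite_eq', if_pos (Finset.mem_univ _),
    if_pos (Finset.mem_univ _)]
  norm_num

/-! ### Clusters of two seeds from the same planted cluster -/

section SameSeeds

variable {d : ℕ}

theorem abs_gap_update_sub_le (b b' x : Fin d → Bool) (j : Fin d) (u : Bool) :
    |gap b b' (Function.update x j u) - gap b b' x| ≤ 2 := by
  have h1 : gap b b' (Function.update x j u) - gap b b' x =
      bitDiff b b' j * (2 * (bit (x j) - bit u)) := by
    rw [gap, gap, ← Finset.sum_sub_distrib, Finset.sum_eq_single j]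
    · rw [Function.update_self, bitDiff]
      ring
    · intro j' _ hj'
      rw [Function.update_of_ne hj']
      ring
    · simp
  rw [h1, abs_mul, abs_mul, abs_two]
  have := abs_bitDiff_le b b' j
  have := abs_bit_sub_le (x j) u
  nlinarith [abs_nonneg (bitDiff b b' j), abs_nonneg (bit (x j) - bit u)]

/-- The probability that `x` is assigned to center `k`. -/
noncomputable def choiceProb (b b' : Fin d → Bool) (k : Fin 2) (x : Fin d → Bool) : ℝ :=
  expect (choice ![b, b'] x) fun l => if l = k then 1 else 0

theorem choiceProb_mem (b b' : Fin d → Bool) (k : Fin 2) (x : Fin d → Bool) :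
    0 ≤ choiceProb b b' k x ∧ choiceProb b b' k x ≤ 1 :=
  ⟨expect_nonneg _ fun l => by split_ifs <;> norm_num,
    expect_le_const _ fun l => by split_ifs <;> norm_num⟩

theorem choiceProb_one (b b' x : Fin d → Bool) :
    choiceProb b b' 1 x = 1 - choiceProb b b' 0 x := by
  rw [choiceProb, choiceProb, eq_sub_iff_add_eq, ← expect_add]
  refine (congrArg _ (funext fun l => ?_)).trans (expect_const _ 1)
  fin_cases l <;> simp

theorem choiceProb_update (b b' : Fin d → Bool) (k : Fin 2) (x : Fin d → Bool) (j : Fin d)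
    (u : Bool) (h : 2 < |gap b b' x|) :
    choiceProb b b' k (Function.update x j u) = choiceProb b b' k x := by
  have h1 := abs_le.1 (abs_gap_update_sub_le b b' x j u)
  rw [choiceProb, choiceProb]
  rcases lt_abs.1 h with h2 | h2
  · rw [expect_choice_of_eq (nearest_of_gap_neg ![b, b'] x (k := 1) (k' := 0) (by decide)
        (by rw [gap_swap]; simp; linarith)),
      expect_choice_of_eq (nearest_of_gap_neg ![b, b'] _ (k := 1) (k' := 0) (by decide)
        (by rw [gap_swap]; simp; linarith))]
  · rw [expect_choice_of_eq (nearest_of_gap_neg ![b, b'] x (k := 0) (k' := 1) (by decide)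
        (by simp; linarith)),
      expect_choice_of_eq (nearest_of_gap_neg ![b, b'] _ (k := 0) (k' := 1) (by decide)
        (by simp; linarith))]

theorem expect_choice_mul (b b' : Fin d → Bool) (k : Fin 2) (x : Fin d → Bool) (y : ℝ) :
    (expect (choice ![b, b'] x) fun l => if l = k then y else 0) = choiceProb b b' k x * y := by
  rw [choiceProb, ← expect_mul_const]
  congr 1
  funext l
  split_ifs <;> simp

/-- The assignment to a center depends only weakly on a single feature. -/
theorem expect_choiceProb_mul_le {p q : unitInterval} (hp : (p : ℝ) < 1 / 2) (hqp : q < p)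
    (D : Fin d → Fin 2) (l : Fin 2) {b b' : Fin d → Bool} {τ : ℝ}
    (h : prob (rowLaw p q D l) {x | |gap b b' x| ≤ 2} ≤ τ) (k : Fin 2) (j : Fin d) :
    expect (rowLaw p q D l) (fun x => choiceProb b b' k x * (bit (x j) - 1 / 2)) ≤
      -((1 / 2 - p) * expect (rowLaw p q D l) (choiceProb b b' k)) + τ := by
  classical
  set f := choiceProb b b' k with hf
  -- The assignment made with feature `j` overwritten by 0 is independent of that feature and agrees
  -- with the true one when `|gap| > 2`. The replacement costs `τ/2` in the product, where the other
  -- factor is `±1/2`, and at most another `τ/2` in the mean of the choice probability, where it is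
  -- multiplied by `1/2 - p`.
  set f' : (Fin d → Bool) → ℝ := fun x => f (Function.update x j false) with hf'
  set m : (Fin d → Bool) → ℝ := fun x => if x ∈ {x | |gap b b' x| ≤ 2} then 1 else 0 with hm
  have hmE : expect (rowLaw p q D l) m ≤ τ := by rwa [hm, ← prob_eq_expect]
  have hclose : ∀ x, |f x - f' x| ≤ m x := fun x => by
    by_cases hx : |gap b b' x| ≤ 2
    · have h1 := choiceProb_mem b b' k x
      have h2 := choiceProb_mem b b' k (Function.update x j false)
      have : m x = 1 := if_pos hx
      rw [this, abs_le]
      constructor <;> linarith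
    · have : f' x = f x := choiceProb_update b b' k x j false (not_le.1 hx)
      rw [this, sub_self, abs_zero]
      exact (by rw [hm]; dsimp only; split_ifs; exacts [zero_le_one, le_rfl] : 0 ≤ m x)
  have hE1 : expect (rowLaw p q D l) (fun x => f x * (bit (x j) - 1 / 2)) ≤
      expect (rowLaw p q D l) (fun x => f' x * (bit (x j) - 1 / 2)) + τ / 2 := by
    have h1 : ∀ x, f x * (bit (x j) - 1 / 2) ≤ f' x * (bit (x j) - 1 / 2) + m x * (1 / 2) := by
      intro x
      have h2 := abs_le.1 (hclose x)
      cases x j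
      · simp only [bit_false]
        linarith
      · simp only [bit_true]
        linarith
    have h3 := expect_mono (rowLaw p q D l) h1
    rw [expect_add, expect_mul_const] at h3
    linarith
  have hE2 : expect (rowLaw p q D l) (fun x => f' x * (bit (x j) - 1 / 2)) =
      (rate p q l (D j) - 1 / 2) * expect (rowLaw p q D l) f' := by
    rw [rowLaw, expect_piPMF_resample _ j]
    simp only [hf', Function.update_self, Function.update_idem, expect_mul_const]
    rw [expect_const_mul, expect_sub, expect_const, expect_coin_bit, rate, mul_comm]
  have hE3 : expect (rowLaw p q D l) f - τ ≤ expect (rowLaw p q D l) f' := by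
    have h3 := expect_mono (rowLaw p q D l) (f := fun x => f x - m x) (g := f') fun x => by
      have h2 := abs_le.1 (hclose x)
      linarith
    rw [expect_sub] at h3
    linarith
  have hE4 : 0 ≤ expect (rowLaw p q D l) f' := expect_nonneg _ fun x => (choiceProb_mem _ _ _ _).1
  have hr := rate_le hqp l (D j)
  have hτ0 : 0 ≤ τ := (prob_nonneg _ _).trans h
  rw [hE2] at hE1
  nlinarith [p.2.1]

theorem firstProb_eq (p q : unitInterval) (D : Fin d → Fin 2) (l : Fin 2) (b b' : Fin d → Bool) :
    firstProb p q D l b b' = expect (rowLaw p q D l) (choiceProb b b' 0) := rfl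

theorem GoodSeeds.le_choiceProb {p q : unitInterval} {D : Fin d → Fin 2} {i : Fin 2} {c τ : ℝ}
    {b b' : Fin d → Bool} (h : GoodSeeds p q D i c τ b b') (k : Fin 2) :
    c ≤ expect (rowLaw p q D i) (choiceProb b b' k) := by
  have h1 := h.le_first
  have h2 := h.first_le
  rw [firstProb_eq] at h1 h2
  fin_cases k
  · exact h1
  · change c ≤ expect _ (choiceProb b b' 1)
    rw [show choiceProb b b' 1 = fun x => 1 - choiceProb b b' 0 x from
      funext (choiceProb_one b b'), expect_sub, expect_const]
    linarith

/-- For good seeds from the same planted cluster, zeros are in the majority on all features of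
both clusters. -/
theorem GoodSeeds.expect_prob_not_zeroModes_le {n : ℕ} {p q : unitInterval}
    (hp : (p : ℝ) < 1 / 2) (hqp : q < p) {C : Fin n → Fin 2} (hC : Balanced C)
    {D : Fin d → Fin 2} {i : Fin 2} {c τ : ℝ} {b b' : Fin d → Bool}
    (h : GoodSeeds p q D i c τ b b') (hc : 0 < c) (hτ : τ ≤ (1 / 2 - p) * c / 8)
    (hn : 16 ≤ (1 / 2 - p) * c * n) (s : Fin 2 ↪ Fin n) :
    (expect (piPMF (seeded (fun a => rowLaw p q D (C a)) s b b')) fun X =>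
      prob (assign X fun k => X (s k)) {σ | ¬ ZeroModes X σ}) ≤
      2 * d * Real.exp (-(((1 / 2 - p) * c / 8) ^ 2 / 16 * n)) := by
  have hp0 := p.2.1
  have hr0 : 0 < (1 / 2 - (p : ℝ)) * c := mul_pos (by linarith) hc
  have hc1 : c ≤ 1 := (h.le_choiceProb 0).trans (expect_le_const _ fun x =>
    (choiceProb_mem b b' 0 x).2)
  rw [expect_congr_support (g := fun X => prob (piPMF fun a => choice ![b, b'] (X a))
    {σ | ¬ ZeroModes X σ}) _ fun X hX => by rw [seeded_support _ s hX]; rfl]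
  -- With `r = (1/2 - p)c` the total drift is at most `(n/2)(-r + 2τ) + 2`, where the own planted
  -- cluster supplies `-r` and the seeds supply 2. As `τ ≤ r/8` and `r n ≥ 16`, this is below `-r
  -- n/8`.
  refine BooleanBlock.expect_prob_not_zeroModes_le (θ := (1 / 2 - (p : ℝ)) * c / 8) _
    (fun _ => choice ![b, b']) (by linarith) (by nlinarith) fun k j => ?_
  simp only [expect_choice_mul]
  have hA : ∀ l, 0 ≤ expect (rowLaw p q D l) (choiceProb b b' k) ∧
      expect (rowLaw p q D l) (choiceProb b b' k) ≤ 1 := fun l =>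
    ⟨expect_nonneg _ fun x => (choiceProb_mem b b' k x).1,
      expect_le_const _ fun x => (choiceProb_mem b b' k x).2⟩
  have hτ0 : 0 ≤ τ := (prob_nonneg _ _).trans (h.middle 0)
  refine (sum_seeded_le (f := fun a => (fun l => -((1 / 2 - (p : ℝ)) *
    expect (rowLaw p q D l) (choiceProb b b' k)) + τ) (C a)) (fun a x => ?_) fun a =>
    expect_choiceProb_mul_le hp hqp D (C a) (h.middle (C a)) k j).trans ?_
  · have h1 := choiceProb_mem b b' k x
    have h2 : choiceProb b b' k x * (bit (x j) - 1 / 2) ≤ 1 / 2 := by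
      have := bit_mem (x j)
      nlinarith
    have h3 := hA (C a)
    dsimp only
    nlinarith
  · rw [hC.sum_eq fun l => -((1 / 2 - (p : ℝ)) * expect (rowLaw p q D l) (choiceProb b b' k)) + τ]
    have h1 : c ≤ expect (rowLaw p q D 0) (choiceProb b b' k) +
        expect (rowLaw p q D 1) (choiceProb b b' k) := by
      have := h.le_choiceProb k
      have h2 := Finset.single_le_sum
        (f := fun l => expect (rowLaw p q D l) (choiceProb b b' k))
        (fun l _ => (hA l).1) (Finset.mem_univ i)
      rw [Fin.sum_univ_two] at h2
      exact this.trans h2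
    have hn0 : (0 : ℝ) ≤ n := Nat.cast_nonneg n
    have h2 := mul_le_mul_of_nonneg_left h1 (by linarith : 0 ≤ 1 / 2 - (p : ℝ))
    have h3 : (n : ℝ) / 2 * (-((1 / 2 - (p : ℝ)) * expect (rowLaw p q D 0) (choiceProb b b' k)) + τ +
        (-((1 / 2 - (p : ℝ)) * expect (rowLaw p q D 1) (choiceProb b b' k)) + τ)) ≤
        (n : ℝ) / 2 * (-((1 / 2 - p) * c) + 2 * τ) :=
      mul_le_mul_of_nonneg_left (by linarith) (by linarith)
    have h4 : (n : ℝ) / 2 * (-((1 / 2 - (p : ℝ)) * c) + 2 * τ) ≤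
        (n : ℝ) / 2 * (-((1 / 2 - p) * c) + 2 * ((1 / 2 - p) * c / 8)) :=
      mul_le_mul_of_nonneg_left (by linarith) (by linarith)
    nlinarith

end SameSeeds

end BooleanBlock

namespace BooleanBlock

/-! ### The `k`-modes algorithm -/

section Accuracy

variable {n : ℕ}

theorem le_accuracy (C σ : Fin n → Fin 2) (π : Equiv.Perm (Fin 2)) :
    ((Finset.univ.filter fun a => π (σ a) = C a).card : ℝ) / n ≤ accuracy C σ :=
  le_ciSup (f := fun π : Equiv.Perm (Fin 2) =>
    ((Finset.univ.filter fun a => π (σ a) = C a).card : ℝ) / n) (Set.finite_range _).bddAbove π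

theorem accuracy_le_one (C σ : Fin n → Fin 2) : accuracy C σ ≤ 1 :=
  ciSup_le fun π => div_le_one_of_le₀ (by
    have := Finset.card_filter_le (Finset.univ : Finset (Fin n)) fun a => π (σ a) = C a
    rw [Finset.card_univ, Fintype.card_fin] at this
    exact_mod_cast this) (Nat.cast_nonneg n)

theorem prob_output {d : ℕ} (ρ : Fin d → stdSimplex ℝ Bool → stdSimplex ℝ Bool) (h : 2 ≤ n)
    (X : Fin n → Fin d → Bool) (T : ℕ) (S : Set (Fin n → Fin 2)) :
    prob (output ρ h X T) S = expect (seeding h) fun s =>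
      prob (stateAfter ρ X (fun i => X (s i)) T) {st | (st.clusters.getD fun _ => 0) ∈ S} := by
  rw [output, prob_bind]
  congr 1
  funext s
  rw [prob_map]
  rfl

end Accuracy

section KModes

variable {n d : ℕ}

/-- For each of the two matchings the number of correct points is a sum of `n` fair coins. The
threshold 0.505 leaves room below 0.51 for passing to mean accuracy. -/
theorem prob_accuracy_uniform_le (X : Fin n → Fin d → Bool) (C : Fin n → Fin 2) (hn : 0 < n) :
    prob (assign X fun _ _ => false) {σ | ¬ accuracy C σ ≤ 0.505} ≤
      2 * Real.exp (-((1 / 200) ^ 2 / 16 * n)) := by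
  have hn' : (0 : ℝ) < n := Nat.cast_pos.2 hn
  have hE : ∀ (π : Equiv.Perm (Fin 2)) (a : Fin n), expect (choice (fun _ _ => false) (X a))
      (fun l => if π l = C a then (1 : ℝ) else 0) = 1 / 2 := fun π a => by
    rw [expect_choice_of_univ (nearest_of_gap_zero _ _ (by simp [gap]))]
    have hne : π 0 ≠ π 1 := π.injective.ne (by decide)
    rcases fin_two_eq_or (i := C a) hne with h | h
    · rw [h, if_pos rfl, if_neg hne.symm]
      norm_num
    · rw [h, if_pos rfl, if_neg hne]
      norm_num
  have h1 : ∀ π : Equiv.Perm (Fin 2), prob (assign X fun _ _ => false)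
      {σ | 0.505 * n ≤ ∑ a, if π (σ a) = C a then (1 : ℝ) else 0} ≤
      Real.exp (-((1 / 200) ^ 2 / 16 * n)) := fun π => by
    have hH := hoeffding (fun a => choice (fun _ _ => false) (X a))
      (g := fun a l => if π l = C a then (1 : ℝ) else 0) (θ := 1 / 200)
      (by intro a l; split_ifs <;> simp) (by norm_num) (by norm_num)
    simp only [hE, Fintype.card_fin, Finset.sum_const, Finset.card_univ, nsmul_eq_mul] at hH
    refine (prob_mono _ fun σ hσ => ?_).trans (hH.trans_eq (by ring_nf))
    simp only [Set.mem_ofPred_eq] at hσ ⊢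
    refine le_trans (le_of_eq ?_) hσ
    norm_num
    ring
  refine (prob_mono _ fun σ hσ => ?_).trans ((prob_exists_le_card _ _ h1).trans_eq ?_)
  · by_contra hcon
    simp only [Set.mem_ofPred_eq, not_exists, not_le] at hcon
    refine hσ (ciSup_le fun π => ?_)
    rw [div_le_iff₀ hn']
    have := hcon π
    simp only [Finset.sum_boole] at this
    exact this.le
  · rw [Fintype.card_perm, Fintype.card_fin]
    norm_num

theorem expect_prob_uniform_bad_le {p q : unitInterval} (hqp : q < p) (hp : (p : ℝ) < 1 / 2)
    (C : Fin n → Fin 2) (D : Fin d → Fin 2) (hn : 0 < n) :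
    (expect (bbm C D !![p, q; q, p]) fun X => prob (assign X fun _ _ => false)
      {σ | ¬ (σ ∈ {σ | accuracy C σ ≤ 0.505} ∧ ZeroModes X σ)}) ≤
      2 * Real.exp (-((1 / 200) ^ 2 / 16 * n)) +
        2 * d * Real.exp (-(((1 / 2 - (p : ℝ)) / 2) ^ 2 / 16 * n)) := by
  refine (expect_mono _ fun X => ?_).trans ((expect_add _ (fun _ =>
    2 * Real.exp (-((1 / 200) ^ 2 / 16 * (n : ℝ)))) _).trans_le (add_le_add (expect_const _ _).le
      (expect_prob_not_zeroModes_uniform_le hqp hp C D)))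
  refine le_trans (prob_mono _ fun σ hσ => ?_) ((prob_union_le _ _ _).trans
    (add_le_add (prob_accuracy_uniform_le X C hn) le_rfl))
  rcases not_and_or.1 hσ with h | h
  · exact Or.inl h
  · exact Or.inr h

/-- After the first iteration of `k`-modes, zeros are in the majority on all features. -/
theorem exists_zeroModes_first {p q : unitInterval} (hp0 : 0 < (p : ℝ)) (hp : (p : ℝ) < 1 / 2)
    (hqp : q < p) {ε : ℝ} (hε : 0 < ε) :
    ∃ η > 0, ∃ N : ℕ, ∀ n d : ℕ, N ≤ n → Real.log n ^ 2 ≤ d → (d : ℝ) ≤ Real.exp (η * n) →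
      ∀ (C : Fin n → Fin 2) (D : Fin d → Fin 2), Balanced C → Balanced D →
      ∀ s : Fin 2 ↪ Fin n, (expect (bbm C D !![p, q; q, p]) fun X =>
        prob (assign X fun k => X (s k)) {σ | ¬ ZeroModes X σ}) ≤ ε := by
  have hqp' : (q : ℝ) < p := hqp
  obtain ⟨c, hc, Hgood⟩ := exists_goodSeeds hp0 hp hqp (ε := ε / 2) (by linarith)
  have hr : 0 < (1 / 2 - (p : ℝ)) := by linarith
  obtain ⟨d₀, hd₀⟩ := Hgood ((1 / 2 - p) * c / 8) (by positivity)
  set θ₁ := (1 / 2 - (p : ℝ)) * c / 8 with hθ₁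
  set θ₂ := (1 / 2 - (p : ℝ)) / 2 with hθ₂
  -- Both tail exponents `θ²/16` are at least `2η`, so the factor `d ≤ exp(ηn)` from the union over
  -- features still leaves `exp(-ηn)`.
  set η := min (θ₁ ^ 2 / 32) (θ₂ ^ 2 / 32) with hη
  have hη0 : 0 < η := lt_min (by positivity) (by positivity)
  set θ := ((p : ℝ) - q) ^ 2 / 4 with hθ
  have hθ0 : 0 < θ := by have := sq_pos_of_pos (sub_pos.2 hqp'); positivity
  have hθ1 : θ ≤ 1 := by nlinarith [q.2.1]
  obtain ⟨N₁, hN₁⟩ := exists_pow_mul_exp_neg_le 0 hη0 (ε := ε / 4) (by linarith)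
  obtain ⟨N₂, hN₂⟩ := exists_sq_mul_exp_neg_le (c := θ ^ 2 / 16) (by positivity)
    (ε := ε / 4) (by linarith)
  obtain ⟨N₃, hN₃⟩ := exists_log_sq_large (max d₀ 1)
  obtain ⟨N₄, hN₄⟩ := exists_nat_ge (16 / ((1 / 2 - (p : ℝ)) * c))
  refine ⟨η, hη0, max (max N₁ N₂) (max N₃ N₄), fun n d hn hd hdη C D hC hD s => ?_⟩
  have hdl : d₀ ≤ d := by
    have := hN₃ n d (by omega) hd
    exact_mod_cast (le_max_left _ _).trans this
  have hd0 : 0 < d := by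
    have := hN₃ n d (by omega) hd
    exact_mod_cast (zero_lt_one.trans_le (le_max_right (d₀ : ℝ) 1)).trans_le this
  have hsmall : ∀ t : ℝ, η ≤ t ^ 2 / 32 → 2 * d * Real.exp (-(t ^ 2 / 16 * n)) ≤ ε / 2 := by
    intro t ht
    have h1 := hN₁ n (by omega)
    rw [pow_zero, one_mul] at h1
    have h2 : (d : ℝ) * Real.exp (-(t ^ 2 / 16 * n)) ≤ Real.exp (-(η * n)) := by
      calc (d : ℝ) * Real.exp (-(t ^ 2 / 16 * n))
          ≤ Real.exp (η * n) * Real.exp (-(t ^ 2 / 16 * n)) := by gcongr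
        _ = Real.exp (η * n - t ^ 2 / 16 * n) := by rw [← Real.exp_add]; ring_nf
        _ ≤ Real.exp (-(η * n)) := by
          apply Real.exp_le_exp.2
          have : (0 : ℝ) ≤ n := Nat.cast_nonneg n
          nlinarith
    linarith
  by_cases hs : C (s 0) = C (s 1)
  · rw [bbm_eq, expect_piPMF_seeded _ s, ← hs]
    have hdata : 16 ≤ (1 / 2 - (p : ℝ)) * c * n := by
      rw [← div_le_iff₀' (by positivity)]
      exact hN₄.trans (by exact_mod_cast (by omega : N₄ ≤ n))
    have h1 : ∀ b, (expect (rowLaw p q D (C (s 0))) fun b' =>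
        expect (piPMF (seeded (fun a => rowLaw p q D (C a)) s b b')) fun X =>
          prob (assign X fun k => X (s k)) {σ | ¬ ZeroModes X σ}) ≤
        prob (rowLaw p q D (C (s 0))) {b' | ¬ GoodSeeds p q D (C (s 0)) c θ₁ b b'} + ε / 2 := by
      classical
      intro b
      rw [prob_eq_expect, ← expect_const (rowLaw p q D (C (s 0))) (ε / 2), ← expect_add]
      refine expect_mono _ fun b' => ?_
      by_cases hg : GoodSeeds p q D (C (s 0)) c θ₁ b b'
      · rw [if_neg (by simpa using hg), zero_add]
        exact (hg.expect_prob_not_zeroModes_le hp hqp hC hc le_rfl hdata s).trans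
          (hsmall _ (min_le_left _ _))
      · rw [if_pos (by simpa using hg)]
        have := expect_le_const (piPMF (seeded (fun a => rowLaw p q D (C a)) s b b'))
          fun X => prob_le_one (assign X fun k => X (s k)) {σ | ¬ ZeroModes X σ}
        linarith
    refine (expect_mono _ h1).trans ?_
    rw [expect_add, expect_const]
    linarith [hd₀ d hdl D hD (C (s 0))]
  · obtain ⟨π, hπ⟩ := exists_perm (i := fun k => C (s k)) hs
    -- Probabilities under `PMF.pure X` play the role of indicators; after averaging over the data,
    -- `prob_bind` turns them into probabilities of the events.
    have h1 : ∀ X : Fin n → Fin d → Bool, prob (assign X fun k => X (s k)) {σ | ¬ ZeroModes X σ} ≤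
        prob (PMF.pure X) {X | ¬ Regular p q C θ X} +
          prob (PMF.pure X) {X | ¬ ZeroModes X fun a => π (C a)} := by
      intro X
      by_cases hX : Regular p q C θ X
      · have hsep := hX.separates (by rw [hθ]; linarith) hθ0.le hd0 s hπ
        classical
        rw [prob_eq_expect, hsep.expect_assign]
        by_cases hz : ZeroModes X fun a => π (C a)
        · rw [if_neg (by simpa using hz)]
          exact add_nonneg (prob_nonneg _ _) (prob_nonneg _ _)
        · rw [if_pos (by simpa using hz), prob_pure_of_mem (S := {X | ¬ ZeroModes X _}) hz]
          linarith [prob_nonneg (PMF.pure X) {X | ¬ Regular p q C θ X}]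
      · rw [prob_pure_of_mem (S := {X | ¬ Regular p q C θ X}) hX]
        linarith [prob_le_one (assign X fun k => X (s k)) {σ | ¬ ZeroModes X σ},
          prob_nonneg (PMF.pure X) {X | ¬ ZeroModes X fun a => π (C a)}]
    refine (expect_mono _ h1).trans ?_
    rw [expect_add, ← prob_bind, ← prob_bind, PMF.bind_pure]
    have h2 := prob_not_regular_le p q C hD hθ0.le hθ1
    have h3 := prob_not_zeroModes_planted_le hqp hp hC D π
    have h4 := hN₂ n d (by omega) hd
    have h5 := hsmall _ (min_le_right (θ₁ ^ 2 / 32) (θ₂ ^ 2 / 32))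
    linarith

/-- `k`-modes has low accuracy. -/
theorem exists_kModes_accuracy {p q : unitInterval} (hp0 : 0 < (p : ℝ)) (hp : (p : ℝ) < 1 / 2)
    (hqp : q < p) (K : ℕ) {ε : ℝ} (hε : 0 < ε) :
    ∃ η > 0, ∃ N : ℕ, ∀ n d : ℕ, N ≤ n → ∀ hn : 2 ≤ n, Real.log n ^ 2 ≤ d →
      (d : ℝ) ≤ Real.exp (η * n) →
      ∀ (C : Fin n → Fin 2) (D : Fin d → Fin 2), Balanced C → Balanced D →
      ∀ T : ℕ, 2 ≤ T → T ≤ n ^ K → (expect (bbm C D !![p, q; q, p]) fun X =>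
        prob (kModes hn X T) {σ | ¬ accuracy C σ ≤ 0.505}) ≤ ε := by
  obtain ⟨η₁, hη₁, N₁, H₁⟩ := exists_zeroModes_first hp0 hp hqp (ε := ε / 2) (by linarith)
  set θ₂ := (1 / 2 - (p : ℝ)) / 2 with hθ₂
  have hθ₂0 : 0 < θ₂ := by linarith
  obtain ⟨N₂, hN₂⟩ := exists_pow_mul_exp_neg_le K (c := (1 / 200 : ℝ) ^ 2 / 16) (by norm_num)
    (ε := ε / 8) (by linarith)
  obtain ⟨N₃, hN₃⟩ := exists_pow_mul_exp_neg_le K (c := θ₂ ^ 2 / 32) (by positivity)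
    (ε := ε / 8) (by linarith)
  refine ⟨min η₁ (θ₂ ^ 2 / 32), lt_min hη₁ (by positivity), max N₁ (max N₂ N₃), ?_⟩
  intro n d hN hn hd hdη C D hC hD T hT hTK
  have hn0 : (0 : ℝ) ≤ n := Nat.cast_nonneg n
  have hdη₁ : (d : ℝ) ≤ Real.exp (η₁ * n) := hdη.trans (Real.exp_le_exp.2
    (mul_le_mul_of_nonneg_right (min_le_left _ _) hn0))
  have hdη₂ : (d : ℝ) ≤ Real.exp (θ₂ ^ 2 / 32 * n) := hdη.trans (Real.exp_le_exp.2
    (mul_le_mul_of_nonneg_right (min_le_right _ _) hn0))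
  set Q : Set (Fin n → Fin 2) := {σ | accuracy C σ ≤ 0.505} with hQ
  set e : (Fin n → Fin d → Bool) → ℝ := fun X =>
    prob (assign X fun _ _ => false) {σ | ¬ (σ ∈ Q ∧ ZeroModes X σ)} with he
  have hrun : ∀ X, prob (kModes hn X T) {σ | ¬ accuracy C σ ≤ 0.505} ≤
      expect (seeding hn) fun s =>
        prob (assign X fun k => X (s k)) {σ | ¬ ZeroModes X σ} + T * e X := by
    intro X
    rw [kModes, prob_output]
    refine expect_mono _ fun s => ?_
    have h1 := le_prob_kModes_run X Q (fun k => X (s k)) hT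
    have h2 : prob (assign X fun k => X (s k)) {σ | ZeroModes X σ} =
        1 - prob (assign X fun k => X (s k)) {σ | ¬ ZeroModes X σ} := by
      rw [← prob_compl]
      congr 1
      ext σ
      simp
    have h3 : prob (stateAfter (fun _ => pluralityRound) X (fun i => X (s i)) T)
        {st | (st.clusters.getD fun _ => 0) ∈ {σ | ¬ accuracy C σ ≤ 0.505}} ≤
        1 - prob (stateAfter (fun _ => pluralityRound) X (fun i => X (s i)) T)
          {s | ∃ σ ∈ Q, s.clusters = some σ} := by
      rw [← prob_compl]
      refine prob_mono _ fun st hst => ?_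
      rintro ⟨σ, hσ, hc⟩
      refine hst ?_
      rw [hc]
      exact hσ
    linarith
  refine (expect_mono _ hrun).trans ?_
  -- The seeding is independent of the data, so the bound may be proved for fixed indices of the
  -- seeds.
  rw [expect_comm]
  refine expect_le_const _ fun s => ?_
  rw [expect_add, expect_const_mul]
  have h1 := H₁ n d (by omega) hd hdη₁ C D hC hD s
  have h2 := expect_prob_uniform_bad_le hqp hp C D (by omega : 0 < n)
  have hTn : (T : ℝ) ≤ (n : ℝ) ^ K := by exact_mod_cast hTK
  have h3 : (d : ℝ) * Real.exp (-(θ₂ ^ 2 / 16 * n)) ≤ Real.exp (-(θ₂ ^ 2 / 32 * n)) := by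
    calc (d : ℝ) * Real.exp (-(θ₂ ^ 2 / 16 * n))
        ≤ Real.exp (θ₂ ^ 2 / 32 * n) * Real.exp (-(θ₂ ^ 2 / 16 * n)) := by gcongr
      _ = Real.exp (-(θ₂ ^ 2 / 32 * n)) := by rw [← Real.exp_add]; ring_nf
  have h4 := hN₂ n (by omega)
  have h5 := hN₃ n (by omega)
  have h6 : T * expect (bbm C D !![p, q; q, p]) e ≤ (n : ℝ) ^ K *
      (2 * Real.exp (-((1 / 200) ^ 2 / 16 * n)) + 2 * Real.exp (-(θ₂ ^ 2 / 32 * n))) := by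
    refine mul_le_mul hTn (h2.trans ?_) (expect_nonneg _ fun X => prob_nonneg _ _) (by positivity)
    linarith
  linarith

end KModes

end BooleanBlock

namespace BooleanBlock

/-! ### The update step -/

section Update

variable {n d : ℕ}

/-- The law of the coordinate `j` of the new center of cluster `k`. -/
noncomputable def centerLaw (ρ : Fin d → stdSimplex ℝ Bool → stdSimplex ℝ Bool)
    (X : Fin n → Fin d → Bool) (c : Fin 2 → Fin d → Bool) (σ : Fin n → Fin 2) (k : Fin 2)
    (j : Fin d) : PMF Bool :=
  if h : (cluster σ k).Nonempty then simplexPMF (ρ j (histogram X (cluster σ k) h j))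
  else PMF.pure (c k j)

theorem update_eq (ρ : Fin d → stdSimplex ℝ Bool → stdSimplex ℝ Bool)
    (X : Fin n → Fin d → Bool) (c : Fin 2 → Fin d → Bool) (σ : Fin n → Fin 2) :
    update ρ X c σ = piPMF fun k => piPMF fun j => centerLaw ρ X c σ k j := rfl

theorem abs_sub_mul_sign_le {u v : ℝ} (hu : 0 ≤ u ∧ u ≤ 1) (hv : 0 ≤ v ∧ v ≤ 1) (b : Bool) :
    |(u - v) * (1 - 2 * bit b)| ≤ 1 := by
  rw [abs_le]
  cases b
  · rw [bit_false]
    constructor <;> linarith [hu.1, hu.2, hv.1, hv.2]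
  · rw [bit_true]
    constructor <;> linarith [hu.1, hu.2, hv.1, hv.2]

/-- The new centers classify the data as `τ` does if they do so on average. -/
theorem prob_update_not_separates_le (ρ : Fin d → stdSimplex ℝ Bool → stdSimplex ℝ Bool)
    (X : Fin n → Fin d → Bool) (c : Fin 2 → Fin d → Bool) (σ τ : Fin n → Fin 2) {θ : ℝ}
    (h0 : 0 ≤ θ) (h1 : θ ≤ 1)
    (h : ∀ a k', τ a ≠ k' → ∑ j, (expect (centerLaw ρ X c σ (τ a) j) bit -
      expect (centerLaw ρ X c σ k' j) bit) * (1 - 2 * bit (X a j)) ≤ -(θ * d)) :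
    prob (update ρ X c σ) {c' | ¬ Separates X c' τ} ≤ n * Real.exp (-(θ ^ 2 / 16 * d)) := by
  -- In `Fin 2`, `k + 1` is the other label.
  have hne : ∀ k : Fin 2, k ≠ k + 1 := by decide
  have ha : ∀ a, prob (piPMF fun j => piPMF fun k => centerLaw ρ X c σ k j)
      {y | 0 ≤ ∑ j, (bit (y j (τ a)) - bit (y j (τ a + 1))) * (1 - 2 * bit (X a j))} ≤
      Real.exp (-(θ ^ 2 / 16 * d)) := fun a => by
    have hH := hoeffding (fun j => piPMF fun k => centerLaw ρ X c σ k j)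
      (g := fun j y => (bit (y (τ a)) - bit (y (τ a + 1))) * (1 - 2 * bit (X a j)))
      (fun j y => abs_sub_mul_sign_le (bit_mem _) (bit_mem _) _) h0 h1
    have hE : ∀ j, expect (piPMF fun k => centerLaw ρ X c σ k j)
        (fun y => (bit (y (τ a)) - bit (y (τ a + 1))) * (1 - 2 * bit (X a j))) =
        (expect (centerLaw ρ X c σ (τ a) j) bit -
          expect (centerLaw ρ X c σ (τ a + 1) j) bit) * (1 - 2 * bit (X a j)) := fun j => by
      rw [expect_mul_const, expect_sub]
      congr 2
      · exact expect_piPMF_eval (fun k => centerLaw ρ X c σ k j) (τ a) bit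
      · exact expect_piPMF_eval (fun k => centerLaw ρ X c σ k j) (τ a + 1) bit
    refine (prob_mono _ fun y hy => ?_).trans (hH.trans_eq ?_)
    · simp only [Set.mem_ofPred_eq, hE, Fintype.card_fin] at hy ⊢
      linarith [h a _ (hne (τ a))]
    · rw [Fintype.card_fin]
      ring_nf
  rw [update_eq, prob_piPMF_swap]
  refine (prob_mono _ fun y hy => ?_).trans ((prob_exists_le_card _ _ ha).trans_eq ?_)
  · simp only [Separates, Set.mem_ofPred_eq] at hy ⊢
    push Not at hy
    obtain ⟨a, hy⟩ := hy
    refine ⟨a, ?_⟩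
    by_contra hcon
    exact hy (nearest_of_gap_neg _ _ (hne (τ a)) (not_le.1 hcon))
  · rw [Fintype.card_fin]

/-- The fraction of ones on the feature `j` among the points of `S`. -/
noncomputable def fraction (X : Fin n → Fin d → Bool) (S : Finset (Fin n)) (j : Fin d) : ℝ :=
  (∑ a ∈ S, bit (X a j)) / S.card

/-- Soft rounding as a function of the fraction of ones. -/
noncomputable def softFun (t x : ℝ) : ℝ := x ^ t / (x ^ t + (1 - x) ^ t)

theorem expect_centerLaw_softRound (t : ℝ) (X : Fin n → Fin d → Bool)
    (c : Fin 2 → Fin d → Bool) {σ : Fin n → Fin 2} {k : Fin 2} (h : (cluster σ k).Nonempty)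
    (j : Fin d) :
    expect (centerLaw (fun _ => softRound t) X c σ k j) bit =
      softFun t (fraction X (cluster σ k) j) := by
  have hcard : ((cluster σ k).card : ℝ) ≠ 0 := Nat.cast_ne_zero.2 h.card_ne_zero
  have htrue : (((cluster σ k).filter fun a => X a j = true).card : ℝ) =
      ∑ a ∈ cluster σ k, bit (X a j) := by
    simp [bit]
  have hfalse : (((cluster σ k).filter fun a => X a j = false).card : ℝ) =
      (cluster σ k).card - ∑ a ∈ cluster σ k, bit (X a j) := by
    rw [eq_sub_iff_add_eq, ← htrue, ← Nat.cast_add, add_comm]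
    congr 1
    have := Finset.card_filter_add_card_filter_not (s := cluster σ k) fun a => X a j = true
    simpa using this
  rw [centerLaw, dif_pos h, expect_simplexPMF, Fintype.sum_bool, bit_true, bit_false, mul_one,
    mul_zero, add_zero]
  simp only [softRound, histogram, Fintype.sum_bool, htrue, hfalse]
  rw [sub_div, div_self hcard, softFun, fraction]

end Update

/-! ### The soft rounding function on the unit interval -/

section SoftFun

theorem softFun_denom_pos {t x : ℝ} (hx : x ∈ Set.Icc (0 : ℝ) 1) : 0 < x ^ t + (1 - x) ^ t := by
  rcases hx.1.eq_or_lt with h | h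
  · exact add_pos_of_nonneg_of_pos (Real.rpow_nonneg hx.1 t)
      (Real.rpow_pos_of_pos (by linarith) t)
  · exact add_pos_of_pos_of_nonneg (Real.rpow_pos_of_pos h t)
      (Real.rpow_nonneg (by linarith [hx.2]) t)

theorem softFun_mem {t x : ℝ} (hx : x ∈ Set.Icc (0 : ℝ) 1) :
    0 ≤ softFun t x ∧ softFun t x ≤ 1 := by
  have h1 := Real.rpow_nonneg hx.1 t
  have h2 := Real.rpow_nonneg (sub_nonneg.2 hx.2) t
  exact ⟨div_nonneg h1 (by linarith), div_le_one_of_le₀ (by linarith) (by linarith)⟩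

theorem continuousOn_softFun {t : ℝ} (ht : 0 ≤ t) : ContinuousOn (softFun t) (Set.Icc 0 1) := by
  have h1 : Continuous fun x : ℝ => x ^ t := Real.continuous_rpow_const ht
  have h2 : Continuous fun x : ℝ => (1 - x) ^ t := h1.comp (continuous_const.sub continuous_id)
  exact h1.continuousOn.div (h1.add h2).continuousOn fun x hx => (softFun_denom_pos hx).ne'

theorem softFun_lt {t x y : ℝ} (ht : 0 < t) (hx : 0 ≤ x) (hxy : x < y) (hy : y < 1) :
    softFun t x < softFun t y := by
  have h1 : x ^ t < y ^ t := Real.rpow_lt_rpow hx hxy ht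
  have h2 : (1 - y) ^ t < (1 - x) ^ t := Real.rpow_lt_rpow (by linarith) (by linarith) ht
  have h3 : 0 ≤ x ^ t := Real.rpow_nonneg hx t
  have h4 : 0 < (1 - y) ^ t := Real.rpow_pos_of_pos (by linarith) t
  rw [softFun, softFun, div_lt_div_iff₀ (by linarith) (by linarith)]
  nlinarith

theorem softFun_one (x : ℝ) : softFun 1 x = x := by
  rw [softFun, Real.rpow_one, Real.rpow_one, add_sub_cancel, div_one]

end SoftFun

/-! ### Continuous functions of sample means -/

section SampleMean

/-- A continuous function of the mean of many bits is close to its value at the expectation. -/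
theorem exists_sampleMean_close {f : ℝ → ℝ} (hf : ContinuousOn f (Set.Icc 0 1))
    (hf1 : ∀ x ∈ Set.Icc (0 : ℝ) 1, 0 ≤ f x ∧ f x ≤ 1) {ε : ℝ} (hε : 0 < ε) :
    ∃ N : ℕ, ∀ n : ℕ, N ≤ n → ∀ C : Fin n → Fin 2, Balanced C → ∀ (ν : Fin n → PMF Bool)
      (i : Fin 2), ∀ r ∈ Set.Icc (0 : ℝ) 1, (∀ a, C a = i → expect (ν a) bit = r) →
      expect (piPMF ν) (fun y =>
        |f ((∑ a ∈ cluster C i, bit (y a)) / (cluster C i).card) - f r|) ≤ ε := by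
  classical
  obtain ⟨δ, hδ, huc⟩ := Metric.uniformContinuousOn_iff.1
    (isCompact_Icc.uniformContinuousOn_of_continuous hf) (ε / 2) (by linarith)
  -- A deviation of less than `θ n` in the sum is less than `2θ < δ` in the mean, since a planted
  -- cluster has `n/2` points.
  set θ := min δ 1 / 4 with hθ
  have hm : 0 < min δ 1 := lt_min hδ one_pos
  have hθ0 : 0 < θ := by positivity
  have hθ1 : θ ≤ 1 := by linarith [min_le_right δ 1]
  have hθδ : 2 * θ < δ := by linarith [min_le_left δ 1]
  obtain ⟨N, hN⟩ := exists_pow_mul_exp_neg_le 0 (c := θ ^ 2 / 16) (by positivity) (ε := ε / 4)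
    (by linarith)
  refine ⟨max N 1, fun n hn C hC ν i r hr hν => ?_⟩
  have hn0 : (0 : ℝ) < n := Nat.cast_pos.2 (by omega)
  have hcard := hC.two_mul_card i
  have hcard0 : (0 : ℝ) < (cluster C i).card := by linarith
  have hH := hoeffding_abs ν (g := fun a u => if C a = i then bit u else 0) (θ := θ)
    (by
      intro a u
      have := bit_mem u
      rw [abs_le]
      split_ifs <;> constructor <;> linarith) hθ0.le hθ1
  have hE : ∑ a, expect (ν a) (fun u => if C a = i then bit u else 0) =
      (cluster C i).card * r := by
    rw [← nsmul_eq_mul, ← Finset.sum_const, cluster, Finset.sum_filter]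
    refine Finset.sum_congr rfl fun a _ => ?_
    split_ifs with h
    · exact hν a h
    · exact expect_const _ _
  rw [hE, Fintype.card_fin] at hH
  set B : Set (Fin n → Bool) := {y | θ * n ≤
    |∑ a, (if C a = i then bit (y a) else 0) - (cluster C i).card * r|} with hB
  have hpt : ∀ y : Fin n → Bool,
      |f ((∑ a ∈ cluster C i, bit (y a)) / (cluster C i).card) - f r| ≤
      ε / 2 + if y ∈ B then 1 else 0 := by
    intro y
    have hmem : (∑ a ∈ cluster C i, bit (y a)) / (cluster C i).card ∈ Set.Icc (0 : ℝ) 1 := by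
      refine ⟨div_nonneg (Finset.sum_nonneg fun a _ => (bit_mem _).1) hcard0.le, ?_⟩
      rw [div_le_one hcard0]
      exact (Finset.sum_le_sum fun a _ => (bit_mem (y a)).2).trans_eq (by simp)
    by_cases hy : y ∈ B
    · rw [if_pos hy]
      have h1 := hf1 _ hmem
      have h2 := hf1 r hr
      rw [abs_le]
      constructor <;> linarith
    · rw [if_neg hy, add_zero]
      refine (huc _ hmem r hr ?_).le
      have hy' : |∑ a ∈ cluster C i, bit (y a) - (cluster C i).card * r| < θ * n := by
        rw [cluster, Finset.sum_filter]
        exact not_le.1 hy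
      rw [Real.dist_eq, div_sub' hcard0.ne', abs_div, abs_of_pos hcard0, div_lt_iff₀ hcard0]
      nlinarith
  have h1 := expect_mono (piPMF ν) hpt
  rw [expect_add, expect_const, ← prob_eq_expect] at h1
  have h2 := hN n (by omega)
  rw [pow_zero, one_mul] at h2
  have h3 : Real.exp (-(θ ^ 2 * n / 16)) = Real.exp (-(θ ^ 2 / 16 * n)) := by ring_nf
  rw [h3] at hH
  linarith

end SampleMean

end BooleanBlock

namespace BooleanBlock

/-! ### Seeds from different planted clusters -/

section SoftModes

/-- Centers that are computed from the planted clusters by soft rounding are closer to the points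
of their own cluster on average. -/
theorem exists_soft_drift {p q : unitInterval} (hp : (p : ℝ) < 1 / 2) (hqp : q < p) {t : ℝ}
    (ht : 0 < t) :
    ∃ θ > 0, θ ≤ 1 ∧ ∃ N : ℕ, ∀ n d : ℕ, N ≤ n → ∀ (C : Fin n → Fin 2) (D : Fin d → Fin 2),
      Balanced C → Balanced D → prob (bbm C D !![p, q; q, p])
        {X | ¬ ∀ a k', C a ≠ k' → ∑ j, (softFun t (fraction X (cluster C (C a)) j) -
          softFun t (fraction X (cluster C k') j)) * (1 - 2 * bit (X a j)) ≤ -(θ * d)} ≤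
      n * Real.exp (-(θ ^ 2 / 16 * d)) := by
  have hqp' : (q : ℝ) < p := hqp
  have hφ := softFun_lt ht q.2.1 hqp' (by linarith)
  have hφp := softFun_mem (t := t) p.2
  have hφq := softFun_mem (t := t) q.2
  -- The mean over the two blocks of the ideal drift is exactly `-Δ`: block `C a` gives `(φ(p) -
  -- φ(q))(1 - 2p)` and the other `-(φ(p) - φ(q))(1 - 2q)`, where `φ` is `softFun t`. Sampling
  -- errors of `Δ/4` for each center and a Hoeffding deviation of `Δ/4` leave `-Δ/4`.
  set Δ := (softFun t p - softFun t q) * ((p : ℝ) - q) with hΔ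
  have hΔ0 : 0 < Δ := mul_pos (by linarith) (by linarith)
  have hΔ1 : Δ ≤ 1 := by nlinarith [q.2.1]
  obtain ⟨N, hN⟩ := exists_sampleMean_close (continuousOn_softFun ht.le)
    (fun x hx => softFun_mem hx) (ε := Δ / 4) (by linarith)
  refine ⟨Δ / 4, by linarith, by linarith, N, fun n d hn C D hC hD => ?_⟩
  have hne : ∀ k : Fin 2, k ≠ k + 1 := by decide
  have hfrac : ∀ (S : Finset (Fin n)) (y : Fin n → Bool),
      (∑ a ∈ S, bit (y a)) / (S.card : ℝ) ∈ Set.Icc (0 : ℝ) 1 := fun S y =>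
    ⟨div_nonneg (Finset.sum_nonneg fun a _ => (bit_mem _).1) (Nat.cast_nonneg _),
      div_le_one_of_le₀ ((Finset.sum_le_sum fun a _ => (bit_mem (y a)).2).trans_eq (by simp))
        (Nat.cast_nonneg _)⟩
  have ha : ∀ a, prob (piPMF fun j : Fin d => piPMF fun a : Fin n => coin (entry p q (C a) (D j)))
      {y | -(Δ / 4 * d) ≤ ∑ j, (softFun t ((∑ b ∈ cluster C (C a), bit (y j b)) /
          ((cluster C (C a)).card : ℝ)) - softFun t ((∑ b ∈ cluster C (C a + 1), bit (y j b)) /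
          ((cluster C (C a + 1)).card : ℝ))) * (1 - 2 * bit (y j a))} ≤
      Real.exp (-((Δ / 4) ^ 2 / 16 * d)) := by
    intro a
    set g : Fin d → (Fin n → Bool) → ℝ := fun j y =>
      (softFun t ((∑ b ∈ cluster C (C a), bit (y b)) / ((cluster C (C a)).card : ℝ)) -
        softFun t ((∑ b ∈ cluster C (C a + 1), bit (y b)) /
          ((cluster C (C a + 1)).card : ℝ))) * (1 - 2 * bit (y a)) with hg
    have hH := hoeffding (fun j : Fin d => piPMF fun a : Fin n => coin (entry p q (C a) (D j)))
      (g := g) (θ := Δ / 4)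
      (fun j y => abs_sub_mul_sign_le (softFun_mem (hfrac _ _)) (softFun_mem (hfrac _ _)) _)
      (by linarith) (by linarith)
    have hE : ∀ j, expect (piPMF fun a : Fin n => coin (entry p q (C a) (D j))) (g j) ≤
        (fun l => (softFun t (rate p q (C a) l) - softFun t (rate p q (C a + 1) l)) *
          (1 - 2 * rate p q (C a) l) + Δ / 2) (D j) := by
      intro j
      dsimp only
      have hrate : ∀ i, rate p q i (D j) ∈ Set.Icc (0 : ℝ) 1 := fun i => (entry p q i (D j)).2
      have hmean : ∀ i, expect (piPMF fun a : Fin n => coin (entry p q (C a) (D j))) (fun y =>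
          |softFun t ((∑ b ∈ cluster C i, bit (y b)) / ((cluster C i).card : ℝ)) -
            softFun t (rate p q i (D j))|) ≤ Δ / 4 := fun i =>
        hN n hn C hC _ i _ (hrate i) fun b hb => by rw [hb, expect_coin_bit]; rfl
      -- The point `a` itself enters the fraction of its cluster. Taking absolute errors against the
      -- constant ideal values avoids this dependence.
      have hpt : ∀ y, g j y ≤
          (softFun t (rate p q (C a) (D j)) - softFun t (rate p q (C a + 1) (D j))) *
            (1 - 2 * bit (y a)) +
          (|softFun t ((∑ b ∈ cluster C (C a), bit (y b)) / ((cluster C (C a)).card : ℝ)) -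
            softFun t (rate p q (C a) (D j))| +
          |softFun t ((∑ b ∈ cluster C (C a + 1), bit (y b)) / ((cluster C (C a + 1)).card : ℝ)) -
            softFun t (rate p q (C a + 1) (D j))|) := by
        intro y
        simp only [hg]
        generalize softFun t ((∑ b ∈ cluster C (C a), bit (y b)) /
          ((cluster C (C a)).card : ℝ)) = u
        generalize softFun t ((∑ b ∈ cluster C (C a + 1), bit (y b)) /
          ((cluster C (C a + 1)).card : ℝ)) = v
        generalize softFun t (rate p q (C a) (D j)) = u'
        generalize softFun t (rate p q (C a + 1) (D j)) = v'
        have h1 := abs_le.1 (le_refl |u - u'|)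
        have h2 := abs_le.1 (le_refl |v - v'|)
        cases y a
        · rw [bit_false]
          linarith [h1.1, h1.2, h2.1, h2.2]
        · rw [bit_true]
          linarith [h1.1, h1.2, h2.1, h2.2]
      refine (expect_mono _ hpt).trans ?_
      rw [expect_add, expect_add, expect_const_mul, expect_sub, expect_const, expect_const_mul,
        expect_piPMF_eval (fun a : Fin n => coin (entry p q (C a) (D j))) a bit, expect_coin_bit]
      have h1 := hmean (C a)
      have h2 := hmean (C a + 1)
      change _ * (1 - 2 * rate p q (C a) (D j)) + _ ≤ _
      linarith
    have hsum : ∑ j, expect (piPMF fun a : Fin n => coin (entry p q (C a) (D j))) (g j) ≤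
        -(Δ / 2 * d) := by
      refine (Finset.sum_le_sum fun j _ => hE j).trans_eq ?_
      rw [hD.sum_eq fun l => (softFun t (rate p q (C a) l) - softFun t (rate p q (C a + 1) l)) *
          (1 - 2 * rate p q (C a) l) + Δ / 2, hΔ]
      generalize C a = i
      fin_cases i <;> simp [rate_eq] <;> ring
    refine (prob_mono _ fun y hy => ?_).trans (hH.trans_eq ?_)
    · simp only [Set.mem_ofPred_eq, Fintype.card_fin] at hy ⊢
      simp only [hg] at hsum ⊢
      linarith
    · rw [Fintype.card_fin]
      ring_nf
  rw [bbm_eq]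
  simp only [rowLaw]
  rw [prob_piPMF_swap]
  refine (prob_mono _ fun y hy => ?_).trans ((prob_exists_le_card _ _ ha).trans_eq ?_)
  · simp only [Set.mem_ofPred_eq] at hy ⊢
    push Not at hy
    obtain ⟨a, k', hk', h⟩ := hy
    have hk : k' = C a + 1 := (fin_two_eq_or (i := k') (hne (C a))).resolve_left hk'.symm
    rw [hk] at h
    exact ⟨a, h.le⟩
  · rw [Fintype.card_fin]

theorem cluster_perm {n : ℕ} (C : Fin n → Fin 2) (π : Equiv.Perm (Fin 2)) (i : Fin 2) :
    cluster (fun a => π (C a)) (π i) = cluster C i := by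
  ext a
  simp [cluster]

theorem Balanced.cluster_nonempty {n : ℕ} {C : Fin n → Fin 2} (hC : Balanced C) (hn : 0 < n)
    (i : Fin 2) : (cluster C i).Nonempty := by
  have h := hC.two_mul_card i
  have hn' : (0 : ℝ) < n := Nat.cast_pos.2 hn
  exact Finset.card_pos.1 (by exact_mod_cast (by linarith : (0 : ℝ) < (cluster C i).card))

/-- `SoftModes` is successful if the seeds belong to different planted clusters. -/
theorem exists_soft_solved_of_ne {p q : unitInterval} (hp : (p : ℝ) < 1 / 2) (hqp : q < p)
    {t : ℝ} (ht : 0 < t) {ε : ℝ} (hε : 0 < ε) :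
    ∃ N : ℕ, ∀ n d : ℕ, N ≤ n → Real.log n ^ 2 ≤ d →
      ∀ (C : Fin n → Fin 2) (D : Fin d → Fin 2), Balanced C → Balanced D →
      ∀ s : Fin 2 ↪ Fin n, C (s 0) ≠ C (s 1) → ∀ T : ℕ, 1 ≤ T →
      (expect (bbm C D !![p, q; q, p]) fun X =>
        prob (stateAfter (fun _ => softRound t) X (fun k => X (s k)) T) (Solved X C)ᶜ) ≤ ε := by
  have hqp' : (q : ℝ) < p := hqp
  obtain ⟨θ, hθ0, hθ1, N₁, H⟩ := exists_soft_drift hp hqp ht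
  set θ' := ((p : ℝ) - q) ^ 2 / 4 with hθ'
  have hθ'0 : 0 < θ' := by have := sq_pos_of_pos (sub_pos.2 hqp'); positivity
  have hθ'1 : θ' ≤ 1 := by nlinarith [q.2.1]
  obtain ⟨N₂, hN₂⟩ := exists_sq_mul_exp_neg_le (c := θ' ^ 2 / 16) (by positivity)
    (ε := ε / 4) (by linarith)
  obtain ⟨N₃, hN₃⟩ := exists_sq_mul_exp_neg_le (c := θ ^ 2 / 16) (by positivity)
    (ε := ε / 4) (by linarith)
  obtain ⟨N₄, hN₄⟩ := exists_log_sq_large 1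
  refine ⟨max (max N₁ N₂) (max N₃ (max N₄ 1)), fun n d hn hd C D hC hD s hs T hT => ?_⟩
  have hd0 : 0 < d := by
    have := hN₄ n d (by omega) hd
    exact_mod_cast zero_lt_one.trans_le this
  have hn1 : (1 : ℝ) ≤ n := by exact_mod_cast (by omega : 1 ≤ n)
  obtain ⟨π, hπ⟩ := exists_perm (i := fun k => C (s k)) hs
  set Good : Set (Fin n → Fin d → Bool) := {X | ∀ a k', C a ≠ k' →
    ∑ j, (softFun t (fraction X (cluster C (C a)) j) -
          softFun t (fraction X (cluster C k') j)) * (1 - 2 * bit (X a j)) ≤ -(θ * d)} with hGood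
  have hsmall : (n : ℝ) * Real.exp (-(θ ^ 2 / 16 * d)) ≤ ε / 4 := by
    refine le_trans (mul_le_mul_of_nonneg_right ?_ (Real.exp_nonneg _)) (hN₃ n d (by omega) hd)
    nlinarith
  have h1 : ∀ X : Fin n → Fin d → Bool,
      prob (stateAfter (fun _ => softRound t) X (fun k => X (s k)) T) (Solved X C)ᶜ ≤
        prob (PMF.pure X) {X | ¬ Regular p q C θ' X} + prob (PMF.pure X) {X | ¬ X ∈ Good} +
          ε / 4 := by
    intro X
    have hP1 := prob_nonneg (PMF.pure X) {X | ¬ Regular p q C θ' X}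
    have hP2 := prob_nonneg (PMF.pure X) {X | ¬ X ∈ Good}
    have hP3 := prob_le_one (stateAfter (fun _ => softRound t) X (fun k => X (s k)) T)
      (Solved X C)ᶜ
    by_cases hX : Regular p q C θ' X
    · by_cases hX' : X ∈ Good
      · have hsep := hX.separates (by rw [hθ']; linarith) hθ'0.le hd0 s hπ
        have h2 := le_prob_stateAfter_of_separates (fun _ => softRound t) X C _ π hsep hT
        have h3 := prob_update_not_separates_le (fun _ => softRound t) X (fun k => X (s k))
          (fun a => π (C a)) (fun a => π (C a)) hθ0.le hθ1 fun a k' hk' => by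
            obtain ⟨i', rfl⟩ := π.surjective k'
            have hne : C a ≠ i' := fun h => hk' (by rw [h])
            have hnon : ∀ i, (cluster (fun a => π (C a)) (π i)).Nonempty := fun i => by
              rw [cluster_perm]
              exact hC.cluster_nonempty (by omega) i
            simp only [expect_centerLaw_softRound t X _ (hnon _), cluster_perm]
            exact hX' a i' hne
        have h4 := prob_compl (update (fun _ => softRound t) X (fun k => X (s k))
          fun a => π (C a)) {c | Separates X c fun a => π (C a)}
        change prob _ {c | ¬ Separates X c fun a => π (C a)} = _ at h4
        rw [prob_compl]
        linarith
      · rw [prob_pure_of_mem (S := {X | ¬ X ∈ Good}) hX']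
        linarith
    · rw [prob_pure_of_mem (S := {X | ¬ Regular p q C θ' X}) hX]
      linarith
  refine (expect_mono _ h1).trans ?_
  rw [expect_add, expect_add, ← prob_bind, ← prob_bind, PMF.bind_pure, expect_const]
  have h2 := prob_not_regular_le p q C hD hθ'0.le hθ'1
  have h3 := H n d (by omega) C D hC hD
  have h4 := hN₂ n d (by omega) hd
  change prob _ {X | ¬ X ∈ Good} ≤ _ at h3
  linarith

end SoftModes

/-! ### Accuracy and seeding -/

section Seeding

variable {n : ℕ}

/-- Every point is correct under exactly one of the two matchings, so one of them is right on at
least half of the points. -/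
theorem half_le_accuracy (C σ : Fin n → Fin 2) (hn : 0 < n) : 1 / 2 ≤ accuracy C σ := by
  have hn' : (0 : ℝ) < n := Nat.cast_pos.2 hn
  have h1 := le_accuracy C σ 1
  have h2 := le_accuracy C σ (Equiv.swap 0 1)
  have h3 : (Finset.univ.filter fun a => Equiv.swap (0 : Fin 2) 1 (σ a) = C a) =
      Finset.univ.filter fun a => ¬ (1 : Equiv.Perm (Fin 2)) (σ a) = C a := by
    refine Finset.filter_congr fun a _ => ?_
    generalize σ a = u
    generalize C a = v
    revert u v
    decide
  have h4 := Finset.card_filter_add_card_filter_not (s := (Finset.univ : Finset (Fin n)))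
    fun a => (1 : Equiv.Perm (Fin 2)) (σ a) = C a
  rw [← h3, Finset.card_univ, Fintype.card_fin] at h4
  have h5 : (((Finset.univ.filter fun a => (1 : Equiv.Perm (Fin 2)) (σ a) = C a).card : ℝ) +
    (Finset.univ.filter fun a => Equiv.swap (0 : Fin 2) 1 (σ a) = C a).card) / n = 1 := by
    rw [← Nat.cast_add, h4, div_self hn'.ne']
  rw [add_div] at h5
  linarith

theorem one_le_accuracy {C σ : Fin n → Fin 2} (hn : 0 < n) (h : MisclassifiesNoPoint C σ) :
    1 ≤ accuracy C σ := by
  obtain ⟨π, hπ⟩ := h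
  have h1 := le_accuracy C σ π
  rw [Finset.filter_true_of_mem fun a _ => hπ a, Finset.card_univ, Fintype.card_fin,
    div_self (Nat.cast_ne_zero.2 hn.ne')] at h1
  exact h1

theorem le_expect_accuracy (C : Fin n → Fin 2) (hn : 0 < n) (μ : PMF (Fin n → Fin 2)) :
    1 / 2 + prob μ {σ | MisclassifiesNoPoint C σ} / 2 ≤ expect μ (accuracy C) := by
  classical
  have h := expect_mono μ (g := accuracy C) (f := fun σ => 1 / 2 +
    (if σ ∈ {σ | MisclassifiesNoPoint C σ} then 1 else 0) * (1 / 2)) fun σ => by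
      split_ifs with h
      · have := one_le_accuracy hn h
        linarith
      · have := half_le_accuracy C σ hn
        linarith
  rw [expect_add, expect_const, expect_mul_const, ← prob_eq_expect] at h
  linarith

theorem prob_not_misclassifiesNoPoint_le {d : ℕ}
    (ρ : Fin d → stdSimplex ℝ Bool → stdSimplex ℝ Bool) (X : Fin n → Fin d → Bool)
    (seeds : Fin 2 → Fin d → Bool) (T : ℕ) (C : Fin n → Fin 2) :
    prob (stateAfter ρ X seeds T)
      {st | (st.clusters.getD fun _ => 0) ∈ {σ | ¬ MisclassifiesNoPoint C σ}} ≤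
      prob (stateAfter ρ X seeds T) (Solved X C)ᶜ := by
  refine prob_mono _ fun st hst hsol => hst ?_
  obtain ⟨π, hc, -⟩ := hsol
  rw [hc]
  exact ⟨π⁻¹, fun a => by simp⟩

/-- With probability at least 1/2 the seeds belong to different planted clusters. -/
theorem prob_seeding_eq_le {C : Fin n → Fin 2} (hC : Balanced C) (hn : 2 ≤ n) :
    prob (seeding hn) {s | C (s 0) = C (s 1)} ≤ 1 / 2 := by
  classical
  have hn' : (2 : ℝ) ≤ n := by exact_mod_cast hn
  have hcard : (Fintype.card (Fin 2 ↪ Fin n) : ℝ) = n * (n - 1) := by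
    rw [Fintype.card_embedding_eq, Fintype.card_fin, Fintype.card_fin]
    simp only [Nat.descFactorial]
    push_cast [Nat.cast_sub (by omega : 1 ≤ n)]
    simp
    ring
  have hpairs : ((Finset.univ.filter fun w : Fin n × Fin n => C w.1 ≠ C w.2).card : ℝ) =
      n * (n / 2) := by
    have h1 : ∀ a : Fin n, ∑ b : Fin n, (if C a ≠ C b then (1 : ℝ) else 0) = n / 2 := fun a => by
      rw [hC.sum_eq fun l => if C a ≠ l then (1 : ℝ) else 0]
      generalize C a = i
      fin_cases i <;> simp
    rw [Finset.card_filter]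
    push_cast
    rw [Fintype.sum_prod_type, Finset.sum_congr rfl fun a _ => h1 a]
    simp
  -- There are `n²/2` ordered pairs of points with different labels, and each comes from a seeding;
  -- this is at least half of the `n(n - 1)` seedings.
  have hle : (Finset.univ.filter fun w : Fin n × Fin n => C w.1 ≠ C w.2).card ≤
      (Finset.univ.filter fun s : Fin 2 ↪ Fin n => C (s 0) ≠ C (s 1)).card := by
    refine Finset.card_le_card_of_surjOn (fun s => (s 0, s 1)) ?_
    rintro ⟨a, b⟩ hab
    have hab' : C a ≠ C b := by simpa using hab
    have hne : a ≠ b := fun h => hab' (by rw [h])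
    have hinj : Function.Injective ![a, b] := by
      intro i j hij
      fin_cases i <;> fin_cases j <;> simp_all
    exact ⟨⟨![a, b], hinj⟩, by simpa using hab', rfl⟩
  have hsplit := Finset.card_filter_add_card_filter_not
    (s := (Finset.univ : Finset (Fin 2 ↪ Fin n))) fun s => C (s 0) = C (s 1)
  rw [Finset.card_univ] at hsplit
  have hprob : prob (seeding hn) {s | C (s 0) = C (s 1)} =
      (Finset.univ.filter fun s : Fin 2 ↪ Fin n => C (s 0) = C (s 1)).card /
        (Fintype.card (Fin 2 ↪ Fin n) : ℝ) := by
    rw [prob_eq_expect, expect]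
    simp only [seeding, PMF.uniformOfFintype_apply, Set.mem_ofPred_eq]
    rw [← Finset.mul_sum, ENNReal.toReal_inv, ENNReal.toReal_natCast, div_eq_inv_mul,
      Finset.card_filter, Nat.cast_sum]
    congr 1
    refine Finset.sum_congr rfl fun s _ => ?_
    by_cases h : C (s 0) = C (s 1) <;> simp [h]
  have hle' : (n : ℝ) * (n / 2) ≤
      (Finset.univ.filter fun s : Fin 2 ↪ Fin n => C (s 0) ≠ C (s 1)).card := by
    rw [← hpairs]
    exact_mod_cast hle
  have hsplit' : ((Finset.univ.filter fun s : Fin 2 ↪ Fin n => C (s 0) = C (s 1)).card : ℝ) +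
      (Finset.univ.filter fun s : Fin 2 ↪ Fin n => C (s 0) ≠ C (s 1)).card = n * (n - 1) := by
    rw [← hcard]
    exact_mod_cast hsplit
  rw [hprob, hcard, div_le_iff₀ (by nlinarith)]
  nlinarith

end Seeding

/-- `SoftModes` has high mean accuracy. -/
theorem exists_softModes_accuracy {p q : unitInterval} (hp : (p : ℝ) < 1 / 2) (hqp : q < p)
    {t : ℝ} (ht : 0 < t) {ε : ℝ} (hε : 0 < ε) :
    ∃ N : ℕ, ∀ n d : ℕ, N ≤ n → ∀ hn : 2 ≤ n, Real.log n ^ 2 ≤ d →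
      ∀ (C : Fin n → Fin 2) (D : Fin d → Fin 2), Balanced C → Balanced D → ∀ T : ℕ, 1 ≤ T →
      1 - ε ≤ prob (bbm C D !![p, q; q, p])
        {X | 0.74 ≤ expect (softModes t hn X T) (accuracy C)} := by
  classical
  -- By Markov's inequality the failure probability `B X` for seeds from different clusters is below
  -- 0.02 except with probability `ε`, and it enters the mean accuracy with factor 1/2: `0.75 - 0.01
  -- = 0.74`.
  obtain ⟨N, hN⟩ := exists_soft_solved_of_ne hp hqp ht (ε := ε * 0.02) (by positivity)
  refine ⟨N, fun n d hNn hn hd C D hC hD T hT => ?_⟩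
  set B : (Fin n → Fin d → Bool) → ℝ := fun X => expect (seeding hn) fun s =>
    if C (s 0) = C (s 1) then 0 else
      prob (stateAfter (fun _ => softRound t) X (fun k => X (s k)) T) (Solved X C)ᶜ with hB
  have hB0 : ∀ X, 0 ≤ B X := fun X => expect_nonneg _ fun s => by
    split_ifs
    exacts [le_rfl, prob_nonneg _ _]
  have hEB : expect (bbm C D !![p, q; q, p]) B ≤ ε * 0.02 := by
    rw [hB, expect_comm]
    refine expect_le_const _ fun s => ?_
    split_ifs with hs
    · rw [expect_const]
      positivity
    · exact hN n d hNn hd C D hC hD s hs T hT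
  have hacc : ∀ X, 3 / 4 - B X / 2 ≤ expect (softModes t hn X T) (accuracy C) := fun X => by
    have h1 := le_expect_accuracy C (by omega) (softModes t hn X T)
    have h2 : prob (softModes t hn X T) {σ | ¬ MisclassifiesNoPoint C σ} ≤
        prob (seeding hn) {s | C (s 0) = C (s 1)} + B X := by
      rw [softModes, prob_output, prob_eq_expect, hB, ← expect_add]
      refine expect_mono _ fun s => ?_
      simp only [Set.mem_ofPred_eq]
      by_cases hs : C (s 0) = C (s 1)
      · rw [if_pos hs, if_pos hs, add_zero]
        exact prob_le_one _ _
      · rw [if_neg hs, if_neg hs, zero_add]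
        exact prob_not_misclassifiesNoPoint_le _ X _ T C
    have h3 := prob_seeding_eq_le hC hn
    have h4 := prob_compl (softModes t hn X T) {σ | MisclassifiesNoPoint C σ}
    change prob _ {σ | ¬ MisclassifiesNoPoint C σ} = _ at h4
    linarith
  have hM := prob_ge_le_expect_div (bbm C D !![p, q; q, p]) hB0 (t := 0.02) (by norm_num)
  have h1 : expect (bbm C D !![p, q; q, p]) B / 0.02 ≤ ε := by
    rw [div_le_iff₀ (by norm_num)]
    exact hEB
  have h2 := prob_compl (bbm C D !![p, q; q, p]) {X | 0.02 ≤ B X}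
  refine le_trans (by linarith : 1 - ε ≤ _) (h2.symm.trans_le (prob_mono _ fun X hX => ?_))
  have hX' : B X < 0.02 := not_le.1 hX
  refine le_trans ?_ (hacc X)
  norm_num at hX' ⊢
  linarith

end BooleanBlock

namespace BooleanBlock

/-! ### Clusters with different compositions -/

section Split

variable {n d : ℕ}

/-- The number of points of the planted cluster `i` in the cluster `k`. -/
noncomputable def overlap (C σ : Fin n → Fin 2) (k i : Fin 2) : ℝ :=
  ∑ y ∈ cluster σ k, if C y = i then 1 else 0

/-- The fraction of points of the planted cluster `i` in the cluster `k`. -/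
noncomputable def share (C σ : Fin n → Fin 2) (k i : Fin 2) : ℝ :=
  overlap C σ k i / (cluster σ k).card

/-- Both clusters are large, and the planted cluster `i` is better represented in the cluster
`π i` than in the other one. -/
def GoodSplit (C : Fin n → Fin 2) (δ M : ℝ) (π : Equiv.Perm (Fin 2)) (σ : Fin n → Fin 2) : Prop :=
  (∀ k, M ≤ (cluster σ k).card) ∧ ∀ i k', π i ≠ k' → δ ≤ share C σ (π i) i - share C σ k' i

theorem overlap_nonneg (C σ : Fin n → Fin 2) (k i : Fin 2) : 0 ≤ overlap C σ k i :=
  Finset.sum_nonneg fun y _ => by split_ifs <;> norm_num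

theorem overlap_add (C σ : Fin n → Fin 2) (k : Fin 2) :
    overlap C σ k 0 + overlap C σ k 1 = (cluster σ k).card := by
  rw [overlap, overlap, ← Finset.sum_add_distrib, ← nsmul_one, ← Finset.sum_const]
  refine Finset.sum_congr rfl fun y _ => ?_
  rcases fin_two_eq_or (i := C y) (k := 0) (k' := 1) (by decide) with h | h <;> simp [h]

theorem Balanced.overlap_add {C : Fin n → Fin 2} (hC : Balanced C) (σ : Fin n → Fin 2)
    (i : Fin 2) : overlap C σ 0 i + overlap C σ 1 i = n / 2 := by
  have h1 := Finset.sum_fiberwise Finset.univ σ fun y => if C y = i then (1 : ℝ) else 0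
  rw [Fin.sum_univ_two] at h1
  refine h1.trans ?_
  rw [hC.sum_eq fun l => if l = i then (1 : ℝ) else 0]
  fin_cases i <;> simp

/-- A cluster of size `u` contains `A` and `B` points of the two planted clusters, each of size `h`,
and the other cluster has size `v`. The difference of the shares is `h(A - B)/(uv)`, and `uv ≤ h²`.
-/
theorem le_share_sub {A B h u v δ : ℝ} (hu : 0 < u) (hv : 0 < v) (hh : 0 ≤ h) (hδ : 0 ≤ δ)
    (huA : A + B = u) (huv : u + v = 2 * h) (hAB : δ * h ≤ A - B) :
    δ ≤ A / u - (h - A) / v := by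
  rw [div_sub_div _ _ hu.ne' hv.ne', le_div_iff₀ (mul_pos hu hv)]
  have h1 : u * v ≤ h ^ 2 := by nlinarith [sq_nonneg (u - v)]
  have h2 : A * v - u * (h - A) = h * (A - B) := by
    have : v = 2 * h - u := by linarith
    rw [this, ← huA]
    ring
  rw [h2]
  nlinarith

/-- Overlaps that are close to their expectations give a good split. -/
theorem goodSplit_of_overlap {C σ : Fin n → Fin 2} (hC : Balanced C) (hn : 0 < n) {c : ℝ}
    (hc : 0 < c) {P : Fin 2 → ℝ} {i₀ : Fin 2} (h0 : c ≤ P i₀) (h1 : P i₀ ≤ 1 - c)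
    (hdiff : ∀ i, i ≠ i₀ → c ≤ |P i₀ - P i|)
    (hclose : ∀ i, |overlap C σ 0 i - n / 2 * P i| ≤ c * n / 16) :
    ∃ π, GoodSplit C (c / 2) (c * n / 4) π σ := by
  have hn' : (0 : ℝ) < n := Nat.cast_pos.2 hn
  have hcn : 0 < c * n := mul_pos hc hn'
  have hA := overlap_add C σ 0
  have hB := overlap_add C σ 1
  have hR0 := hC.overlap_add σ 0
  have hR1 := hC.overlap_add σ 1
  have hnn := fun k i => overlap_nonneg C σ k i
  have hsize0 : c * n / 4 ≤ (cluster σ 0).card := by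
    have h2 : overlap C σ 0 i₀ ≤ (cluster σ 0).card := by
      rw [← hA]
      have := hnn 0 0
      have := hnn 0 1
      fin_cases i₀ <;> simp <;> linarith
    have h3 := (abs_le.1 (hclose i₀)).1
    have h4 : n / 2 * c ≤ n / 2 * P i₀ := mul_le_mul_of_nonneg_left h0 (by linarith)
    linarith
  have hsize1 : c * n / 4 ≤ (cluster σ 1).card := by
    have h2 : overlap C σ 1 i₀ ≤ (cluster σ 1).card := by
      rw [← hB]
      have := hnn 1 0
      have := hnn 1 1
      fin_cases i₀ <;> simp <;> linarith
    have h3 := (abs_le.1 (hclose i₀)).2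
    have h4 : (n : ℝ) / 2 * P i₀ ≤ n / 2 * (1 - c) := mul_le_mul_of_nonneg_left h1 (by linarith)
    have h5 := hC.overlap_add σ i₀
    linarith
  have hd : c ≤ |P 0 - P 1| := by
    rcases fin_two_eq_or (i := i₀) (k := 0) (k' := 1) (by decide) with rfl | rfl
    · exact hdiff 1 (by decide)
    · rw [abs_sub_comm]
      exact hdiff 0 (by decide)
  have hc0 := abs_le.1 (hclose 0)
  have hc1 := abs_le.1 (hclose 1)
  have hu : (0 : ℝ) < (cluster σ 0).card := by linarith
  have hv : (0 : ℝ) < (cluster σ 1).card := by linarith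
  have e0 : overlap C σ 1 0 = n / 2 - overlap C σ 0 0 := by linarith
  have e1 : overlap C σ 1 1 = n / 2 - overlap C σ 0 1 := by linarith
  have f0 : overlap C σ 0 0 = n / 2 - overlap C σ 1 0 := by linarith
  have f1 : overlap C σ 0 1 = n / 2 - overlap C σ 1 1 := by linarith
  have hsize : ∀ k, c * n / 4 ≤ (cluster σ k).card := fun k => by
    fin_cases k
    exacts [hsize0, hsize1]
  -- The planted cluster that is more attracted by the first seed is matched with cluster 0. Of the
  -- expected surplus `c n/2`, at least `c n/4` remains after the two errors of `c n/16`.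
  rcases le_abs.1 hd with h | h
  · have hAB : c / 2 * (n / 2) ≤ overlap C σ 0 0 - overlap C σ 0 1 := by
      have : (n : ℝ) / 2 * c ≤ n / 2 * (P 0 - P 1) := mul_le_mul_of_nonneg_left h (by linarith)
      linarith
    refine ⟨1, hsize, fun i k' hk' => ?_⟩
    rcases fin_two_eq_or (i := i) (k := 0) (k' := 1) (by decide) with rfl | rfl
    · obtain rfl : k' = 1 := by
        have : k' ≠ 0 := hk'.symm
        omega
      rw [Equiv.Perm.coe_one, id, share, share, e0]
      exact le_share_sub hu hv (by linarith) (by linarith) hA (by linarith) hAB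
    · obtain rfl : k' = 0 := by
        have : k' ≠ 1 := hk'.symm
        omega
      rw [Equiv.Perm.coe_one, id, share, share, f1]
      exact le_share_sub hv hu (by linarith) (by linarith) (by linarith [hB]) (by linarith)
        (B := overlap C σ 1 0) (by linarith)
  · have hAB : c / 2 * (n / 2) ≤ overlap C σ 0 1 - overlap C σ 0 0 := by
      have : (n : ℝ) / 2 * c ≤ n / 2 * -(P 0 - P 1) := mul_le_mul_of_nonneg_left h (by linarith)
      linarith
    refine ⟨Equiv.swap 0 1, hsize, fun i k' hk' => ?_⟩
    rcases fin_two_eq_or (i := i) (k := 0) (k' := 1) (by decide) with rfl | rfl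
    · rw [Equiv.swap_apply_left] at hk' ⊢
      obtain rfl : k' = 0 := by omega
      rw [share, share, f0]
      exact le_share_sub hv hu (by linarith) (by linarith) hB (by linarith) (by linarith)
    · rw [Equiv.swap_apply_right] at hk' ⊢
      obtain rfl : k' = 1 := by omega
      rw [share, share, e1]
      exact le_share_sub hu hv (by linarith) (by linarith) (by linarith [hA]) (by linarith)
        (B := overlap C σ 0 0) (by linarith)

/-- The planted clusters have shares 1 and 0. Thus recovered clusters are a special case of a good
split and need no separate treatment in the next iteration. -/
theorem Balanced.goodSplit {C : Fin n → Fin 2} (hC : Balanced C) (hn : 0 < n)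
    (π : Equiv.Perm (Fin 2)) {δ M : ℝ} (hδ : δ ≤ 1) (hM : M ≤ n / 2) :
    GoodSplit C δ M π fun a => π (C a) := by
  have hcl : ∀ i i', overlap C (fun a => π (C a)) (π i) i' =
      if i = i' then ((cluster C i).card : ℝ) else 0 := fun i i' => by
    rw [overlap, cluster_perm, Finset.sum_congr rfl fun y hy => by
      rw [(Finset.mem_filter.1 hy).2]]
    split_ifs <;> simp
  have hpos : ∀ i, ((cluster C i).card : ℝ) ≠ 0 := fun i =>
    Nat.cast_ne_zero.2 (hC.cluster_nonempty hn i).card_ne_zero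
  refine ⟨fun k => ?_, fun i k' hk' => ?_⟩
  · obtain ⟨i, rfl⟩ := π.surjective k
    rw [cluster_perm]
    linarith [hC.two_mul_card i]
  · obtain ⟨i', rfl⟩ := π.surjective k'
    have hne : i' ≠ i := fun h => hk' (by rw [h])
    rw [share, share, hcl, hcl, if_pos rfl, if_neg hne, cluster_perm, div_self (hpos i), zero_div,
      sub_zero]
    exact hδ

end Split

/-! ### Centers computed by `SoftModes(1)` -/

section Averages

variable {n d : ℕ}

/-- Averaging `gap` against the zero vector over `S`. The subtracted distance to the zero vector is
the same for both centers and cancels when they are compared, leaving average distances to the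
clusters. -/
theorem sum_fraction_mul (X : Fin n → Fin d → Bool) {S : Finset (Fin n)} (hS : S.Nonempty)
    (x : Fin d → Bool) :
    ∑ j, fraction X S j * (1 - 2 * bit (x j)) =
      (∑ y ∈ S, (hammingDist x (X y) : ℝ)) / S.card - hammingDist x fun _ => false := by
  have hcard : (S.card : ℝ) ≠ 0 := Nat.cast_ne_zero.2 hS.card_ne_zero
  have h1 : ∑ j, fraction X S j * (1 - 2 * bit (x j)) =
      (∑ y ∈ S, gap (X y) (fun _ => false) x) / S.card := by
    simp only [gap, fraction, bit_false, sub_zero]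
    rw [Finset.sum_comm, Finset.sum_div]
    refine Finset.sum_congr rfl fun j _ => ?_
    rw [← Finset.sum_mul]
    ring
  rw [h1]
  simp only [gap_eq]
  rw [Finset.sum_sub_distrib, sub_div, Finset.sum_const, nsmul_eq_mul, mul_div_cancel_left₀ _ hcard]

theorem meanDist_eq (p q : unitInterval) (i i' : Fin 2) :
    meanDist p q i i' = p + q - 2 * p * q - ((p : ℝ) - q) ^ 2 * if i' = i then 1 else 0 := by
  rw [meanDist]
  by_cases h : i = i'
  · rw [if_pos h, if_pos h.symm]
    ring
  · rw [if_neg h, if_neg (Ne.symm h)]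
    ring

theorem meanDist_self_le (p q : unitInterval) (i : Fin 2) : meanDist p q i i ≤ 1 := by
  rw [meanDist, if_pos rfl]
  nlinarith [sq_nonneg ((p : ℝ) - 1 / 2), sq_nonneg ((q : ℝ) - 1 / 2)]

/-- The expected distance takes two values that differ by `(p - q)²`, so its average over a cluster
is affine in the share. The term `1/M` covers the point itself, whose distance to itself is 0. -/
theorem Regular.abs_average_sub_le {p q : unitInterval} {C : Fin n → Fin 2} {θ : ℝ}
    {X : Fin n → Fin d → Bool} (h : Regular p q C θ X) (h0 : 0 ≤ θ) (σ : Fin n → Fin 2)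
    (k : Fin 2) {M : ℝ} (hM : 0 < M) (hk : M ≤ (cluster σ k).card) (a : Fin n) :
    |(∑ y ∈ cluster σ k, (hammingDist (X a) (X y) : ℝ)) / (cluster σ k).card -
      (p + q - 2 * p * q - ((p : ℝ) - q) ^ 2 * share C σ k (C a)) * d| ≤ (θ + 1 / M) * d := by
  have hcard : (0 : ℝ) < (cluster σ k).card := hM.trans_le hk
  have hd0 : (0 : ℝ) ≤ d := Nat.cast_nonneg d
  have h1 : (p + q - 2 * p * q - ((p : ℝ) - q) ^ 2 * share C σ k (C a)) * d =
      (∑ y ∈ cluster σ k, meanDist p q (C a) (C y) * d) / (cluster σ k).card := by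
    simp only [meanDist_eq]
    rw [← Finset.sum_mul, Finset.sum_sub_distrib, ← Finset.mul_sum, Finset.sum_const,
      nsmul_eq_mul, share, overlap]
    field_simp
  have h2 : ∀ y, |(hammingDist (X a) (X y) : ℝ) - meanDist p q (C a) (C y) * d| ≤
      θ * d + if a = y then (d : ℝ) else 0 := fun y => by
    by_cases hy : a = y
    · subst hy
      rw [hammingDist_self, if_pos rfl, Nat.cast_zero, zero_sub, abs_neg, abs_of_nonneg
        (mul_nonneg (meanDist_self_nonneg p q _) hd0)]
      have := mul_le_mul_of_nonneg_right (meanDist_self_le p q (C a)) hd0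
      have := mul_nonneg h0 hd0
      linarith
    · rw [if_neg hy, add_zero]
      exact h a y hy
  rw [h1, ← sub_div, ← Finset.sum_sub_distrib, abs_div, abs_of_pos hcard, div_le_iff₀ hcard]
  refine (Finset.abs_sum_le_sum_abs _ _).trans ((Finset.sum_le_sum fun y _ => h2 y).trans ?_)
  rw [Finset.sum_add_distrib, Finset.sum_const, nsmul_eq_mul, Finset.sum_ite_eq]
  have h3 : (if a ∈ cluster σ k then (d : ℝ) else 0) ≤ d := by
    split_ifs
    exacts [le_rfl, hd0]
  have h4 : (d : ℝ) ≤ 1 / M * d * (cluster σ k).card := by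
    rw [one_div, inv_mul_eq_div, div_mul_eq_mul_div, le_div_iff₀ hM]
    exact mul_le_mul_of_nonneg_left hk hd0
  linarith

/-- For regular data, centers computed from a good split are close to the planted clusters. -/
theorem Regular.prob_update_le {p q : unitInterval} {C : Fin n → Fin 2} {θ : ℝ}
    {X : Fin n → Fin d → Bool} (h : Regular p q C θ X) (h0 : 0 ≤ θ) {σ : Fin n → Fin 2}
    {δ M θ₀ : ℝ} (hM : 0 < M) {π : Equiv.Perm (Fin 2)} (hσ : GoodSplit C δ M π σ)
    (hθ₀ : 0 ≤ θ₀) (hθ₁ : θ₀ ≤ 1) (hδ : θ₀ ≤ ((p : ℝ) - q) ^ 2 * δ - 2 * θ - 2 / M)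
    (c : Fin 2 → Fin d → Bool) :
    prob (update (fun _ => softRound 1) X c σ) {c' | ¬ Separates X c' fun a => π (C a)} ≤
      n * Real.exp (-(θ₀ ^ 2 / 16 * d)) := by
  obtain ⟨hσ, hπ⟩ := hσ
  refine prob_update_not_separates_le _ X c σ _ hθ₀ hθ₁ fun a k' hk' => ?_
  have hnon : ∀ k, (cluster σ k).Nonempty := fun k => Finset.card_pos.1 (by
    exact_mod_cast hM.trans_le (hσ k))
  simp only [expect_centerLaw_softRound 1 X c (hnon _), softFun_one, sub_mul,
    Finset.sum_sub_distrib]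
  rw [sum_fraction_mul X (hnon _), sum_fraction_mul X (hnon _)]
  have h1 := (abs_le.1 (h.abs_average_sub_le h0 σ (π (C a)) hM (hσ _) a)).2
  have h2 := (abs_le.1 (h.abs_average_sub_le h0 σ k' hM (hσ _) a)).1
  have hd0 : (0 : ℝ) ≤ d := Nat.cast_nonneg d
  have h3 := mul_le_mul_of_nonneg_left (hπ (C a) k' hk') (sq_nonneg ((p : ℝ) - q))
  have h4 : θ₀ * d ≤ (((p : ℝ) - q) ^ 2 * (share C σ (π (C a)) (C a) - share C σ k' (C a)) -
      2 * θ - 2 * (1 / M)) * d := by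
    refine mul_le_mul_of_nonneg_right (hδ.trans ?_) hd0
    rw [← mul_one_div 2 M]
    linarith
  linarith

/-- A run on regular data is successful if the first clusters are a good split. -/
theorem Regular.prob_not_solved_le {p q : unitInterval} {C : Fin n → Fin 2} (hC : Balanced C)
    (hn : 0 < n) {θ : ℝ} {X : Fin n → Fin d → Bool} (h : Regular p q C θ X) (h0 : 0 ≤ θ)
    {δ M θ₀ : ℝ} (hM : 0 < M) (hMn : M ≤ n / 2) (hδ1 : δ ≤ 1) (hθ₀ : 0 ≤ θ₀)
    (hθ₁ : θ₀ ≤ 1) (hδ : θ₀ ≤ ((p : ℝ) - q) ^ 2 * δ - 2 * θ - 2 / M)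
    (seeds : Fin 2 → Fin d → Bool) {T : ℕ} (hT : 2 ≤ T) :
    prob (stateAfter (fun _ => softRound 1) X seeds T) (Solved X C)ᶜ ≤
      prob (assign X seeds) {σ | ¬ ∃ π, GoodSplit C δ M π σ} +
        2 * (n * Real.exp (-(θ₀ ^ 2 / 16 * d))) := by
  set e := n * Real.exp (-(θ₀ ^ 2 / 16 * d)) with he
  have he0 : 0 ≤ e := by positivity
  have hone : ∀ (σ : Fin n → Fin 2) (c : Fin 2 → Fin d → Bool) (π : Equiv.Perm (Fin 2)),
      GoodSplit C δ M π σ → 1 - e ≤ prob (update (fun _ => softRound 1) X c σ)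
        {c' | Separates X c' fun a => π (C a)} := fun σ c π hσ => by
    have h1 := h.prob_update_le h0 hM hσ hθ₀ hθ₁ hδ c
    have h2 := prob_compl (update (fun _ => softRound 1) X c σ)
      {c' | Separates X c' fun a => π (C a)}
    change prob _ {c' | ¬ Separates X c' fun a => π (C a)} = _ at h2
    linarith
  -- One error `e` for the centers of the first split, which must separate the planted clusters, and
  -- one for the centers computed from the recovered clusters, which must do so again.
  have h1 := le_prob_stateAfter_of_update (fun _ => softRound 1) X C seeds he0
    (fun π c => hone _ c π (hC.goodSplit hn π hδ1 hMn)) hT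
  have h2 := prob_bind_ge (assign X seeds) (update (fun _ => softRound 1) X seeds)
    (S := {σ | ∃ π, GoodSplit C δ M π σ})
    (T := {c | ∃ π : Equiv.Perm (Fin 2), Separates X c fun a => π (C a)}) he0
    fun σ ⟨π, hσ⟩ => (hone σ seeds π hσ).trans (prob_mono _ fun c hc => ⟨π, hc⟩)
  rw [prob_bind] at h2
  have h3 := prob_compl (assign X seeds) {σ | ∃ π, GoodSplit C δ M π σ}
  change prob _ {σ | ¬ ∃ π, GoodSplit C δ M π σ} = _ at h3
  rw [prob_compl]
  linarith

end Averages

end BooleanBlock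

namespace BooleanBlock

/-! ### `SoftModes(1)` -/

section SameSeeds

variable {n d : ℕ}

/-- For given seeds, the overlaps of the first clusters with the planted ones are concentrated. -/
theorem prob_overlap_le {p q : unitInterval} {C : Fin n → Fin 2} (hC : Balanced C)
    (D : Fin d → Fin 2) (b b' : Fin d → Bool) (s : Fin 2 ↪ Fin n) (i : Fin 2) {θ : ℝ}
    (h0 : 0 ≤ θ) (h1 : θ ≤ 1) (hn : 2 ≤ θ * n) :
    prob (piPMF fun a => jointPMF (seeded (fun a => rowLaw p q D (C a)) s b b' a)
      (choice ![b, b'])) {z | 2 * θ * n < |overlap C (fun a => (z a).2) 0 i -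
        n / 2 * firstProb p q D i b b'|} ≤ 2 * Real.exp (-(θ ^ 2 / 16 * n)) := by
  set μ := fun a => rowLaw p q D (C a) with hμ
  set w : Fin n → ℝ := fun a => if C a = i then 1 else 0 with hw
  have hw01 : ∀ a, 0 ≤ w a ∧ w a ≤ 1 := fun a => by
    simp only [hw]
    split_ifs <;> norm_num
  have hH := hoeffding_abs (fun a => jointPMF (seeded μ s b b' a) (choice ![b, b']))
    (g := fun a z => if z.2 = 0 then w a else 0)
    (by
      intro a z
      have := hw01 a
      rw [abs_le]
      split_ifs <;> constructor <;> linarith) h0 h1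
  simp only [expect_jointPMF, expect_choice_mul, Fintype.card_fin] at hH
  have hP : ∀ l, 0 ≤ firstProb p q D l b b' ∧ firstProb p q D l b b' ≤ 1 := fun l =>
    ⟨expect_nonneg _ fun x => (choiceProb_mem b b' 0 x).1,
      expect_le_const _ fun x => (choiceProb_mem b b' 0 x).2⟩
  have hf : ∑ a, (fun l => if l = i then firstProb p q D i b b' else 0) (C a) =
      n / 2 * firstProb p q D i b b' := by
    rw [hC.sum_eq fun l => if l = i then firstProb p q D i b b' else 0]
    fin_cases i <;> simp
  have hE : ∀ a, expect (μ a) (fun x => choiceProb b b' 0 x * w a) =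
      (fun l => if l = i then firstProb p q D i b b' else 0) (C a) := fun a => by
    rw [expect_mul_const, hμ, ← firstProb_eq]
    by_cases h : C a = i <;> simp [hw, h]
  have hf01 : ∀ a, 0 ≤ (fun l => if l = i then firstProb p q D i b b' else 0) (C a) ∧
      (fun l => if l = i then firstProb p q D i b b' else 0) (C a) ≤ 1 := fun a => by
    dsimp only
    split_ifs
    exacts [hP i, ⟨le_rfl, zero_le_one⟩]
  have hcw : ∀ a x, 0 ≤ choiceProb b b' 0 x * w a ∧ choiceProb b b' 0 x * w a ≤ 1 := fun a x =>
    ⟨mul_nonneg (choiceProb_mem b b' 0 x).1 (hw01 a).1,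
      mul_le_one₀ (choiceProb_mem b b' 0 x).2 (hw01 a).1 (hw01 a).2⟩
  have hup := sum_seeded_le (μ := μ) (s := s) (b := b) (b' := b')
    (g := fun a x => choiceProb b b' 0 x * w a)
    (f := fun a => (fun l => if l = i then firstProb p q D i b b' else 0) (C a))
    (fun a x => by linarith [hcw a x, hf01 a]) fun a => (hE a).le
  have hlow := sum_seeded_le (μ := μ) (s := s) (b := b) (b' := b')
    (g := fun a x => -(choiceProb b b' 0 x * w a))
    (f := fun a => -(fun l => if l = i then firstProb p q D i b b' else 0) (C a))
    (fun a x => by linarith [hcw a x, hf01 a]) fun a => by rw [expect_neg, hE a]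
  simp only [expect_neg, Finset.sum_neg_distrib] at hlow
  rw [hf] at hup hlow
  refine (prob_mono _ fun z hz => ?_).trans (hH.trans_eq (by ring_nf))
  simp only [Set.mem_ofPred_eq] at hz ⊢
  have hov : overlap C (fun a => (z a).2) 0 i = ∑ a, if (z a).2 = 0 then w a else 0 := by
    rw [overlap, cluster, Finset.sum_filter]
  rw [hov] at hz
  set u := ∑ a, if (z a).2 = 0 then w a else 0
  set v := ∑ a, expect (seeded μ s b b' a) fun x => choiceProb b b' 0 x * w a
  -- The given seeds shift the expected overlap by at most 2, which `θ n ≥ 2` absorbs into the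
  -- second `θ n`.
  have h2 : |u - n / 2 * firstProb p q D i b b'| ≤ |u - v| + 2 := by
    refine (abs_sub_le u v _).trans (add_le_add le_rfl ?_)
    rw [abs_le]
    constructor <;> linarith
  linarith

/-- Good seeds from the same planted cluster give a good split. -/
theorem GoodSeeds.expect_prob_not_goodSplit_le {p q : unitInterval} {C : Fin n → Fin 2}
    (hC : Balanced C) {D : Fin d → Fin 2} {i : Fin 2} {c τ : ℝ} {b b' : Fin d → Bool}
    (h : GoodSeeds p q D i c τ b b') (hc : 0 < c) (hn : 64 ≤ c * n) (s : Fin 2 ↪ Fin n) :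
    (expect (piPMF (seeded (fun a => rowLaw p q D (C a)) s b b')) fun X =>
      prob (assign X fun k => X (s k)) {σ | ¬ ∃ π, GoodSplit C (c / 2) (c * n / 4) π σ}) ≤
      4 * Real.exp (-((c / 32) ^ 2 / 16 * n)) := by
  have hc1 : c ≤ 1 := by linarith [h.le_first, h.first_le]
  have hn0 : 0 < n := by
    by_contra hcon
    have : n = 0 := by omega
    rw [this, Nat.cast_zero, mul_zero] at hn
    linarith
  rw [expect_congr_support (g := fun X => prob (piPMF fun a => choice ![b, b'] (X a))
    {σ | ¬ ∃ π, GoodSplit C (c / 2) (c * n / 4) π σ}) _ fun X hX => by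
      rw [seeded_support _ s hX]; rfl]
  rw [prob_piPMF_bind _ (fun _ => choice ![b, b']) fun _ σ =>
    ¬ ∃ π, GoodSplit C (c / 2) (c * n / 4) π σ]
  have h1 := fun l => prob_overlap_le (p := p) (q := q) hC D b b' s l (θ := c / 32)
    (by linarith) (by linarith) (by linarith)
  refine (prob_mono _ fun z hz => ?_).trans ((prob_exists_le_card _ _ h1).trans_eq ?_)
  · by_contra hcon
    simp only [Set.mem_ofPred_eq, not_exists, not_lt] at hcon
    refine hz (goodSplit_of_overlap hC hn0 hc (P := fun l => firstProb p q D l b b') h.le_first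
      h.first_le h.diff fun l => ?_)
    have := hcon l
    linarith
  · rw [Fintype.card_fin]
    push_cast
    ring

end SameSeeds

/-- `SoftModes(1)` finds the planted clusters. -/
theorem exists_soft_solved {p q : unitInterval} (hp0 : 0 < (p : ℝ)) (hp : (p : ℝ) < 1 / 2)
    (hqp : q < p) {ε : ℝ} (hε : 0 < ε) :
    ∃ N : ℕ, ∀ n d : ℕ, N ≤ n → Real.log n ^ 2 ≤ d →
      ∀ (C : Fin n → Fin 2) (D : Fin d → Fin 2), Balanced C → Balanced D →
      ∀ (s : Fin 2 ↪ Fin n) (T : ℕ), 2 ≤ T → (expect (bbm C D !![p, q; q, p]) fun X =>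
        prob (stateAfter (fun _ => softRound 1) X (fun k => X (s k)) T) (Solved X C)ᶜ) ≤ ε := by
  have hqp' : (q : ℝ) < p := hqp
  obtain ⟨c, hc, Hgood⟩ := exists_goodSeeds hp0 hp hqp (ε := ε / 4) (by linarith)
  -- Points in the middle are harmless here, so `τ = 1` makes that condition empty.
  obtain ⟨d₀, hd₀⟩ := Hgood 1 one_pos
  -- If good seeds exist then `c ≤ 1` and `c₁ = c`; the minimum is needed for the bounds that do not
  -- refer to seeds.
  set c₁ := min c 1 with hc₁
  have hc₁0 : 0 < c₁ := lt_min hc one_pos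
  have hc₁1 : c₁ ≤ 1 := min_le_right _ _
  set Γ := ((p : ℝ) - q) ^ 2 with hΓ
  have hΓ0 : 0 < Γ := sq_pos_of_pos (sub_pos.2 hqp')
  have hΓ1 : Γ ≤ 1 := by nlinarith [q.2.1]
  have hΓc : Γ * c₁ ≤ Γ := by nlinarith
  have hΓc0 : 0 < Γ * c₁ := by positivity
  -- Balance of the drift: shares differing by `c₁/2` give `Γ c₁/2`, of which `2θ` costs `Γ c₁/8`
  -- and `2/M` at most `Γ c₁/4`. What is left is `θ₀`.
  set θ := Γ * c₁ / 16 with hθ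
  set θ₀ := Γ * c₁ / 8 with hθ₀
  obtain ⟨N₁, hN₁⟩ := exists_sq_mul_exp_neg_le (c := θ ^ 2 / 16) (by positivity)
    (ε := ε / 8) (by linarith)
  obtain ⟨N₂, hN₂⟩ := exists_sq_mul_exp_neg_le (c := θ₀ ^ 2 / 16) (by positivity)
    (ε := ε / 8) (by linarith)
  obtain ⟨N₃, hN₃⟩ := exists_log_sq_large (max d₀ 1)
  obtain ⟨N₄, hN₄⟩ := exists_nat_ge (64 / (Γ * c₁ ^ 2))
  obtain ⟨N₅, hN₅⟩ := exists_pow_mul_exp_neg_le 0 (c := (c / 32) ^ 2 / 16) (by positivity)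
    (ε := ε / 16) (by linarith)
  refine ⟨max (max N₁ N₂) (max N₃ (max N₄ (max N₅ 1))), fun n d hn hd C D hC hD s T hT => ?_⟩
  have hdl : d₀ ≤ d := by
    have := hN₃ n d (by omega) hd
    exact_mod_cast (le_max_left _ _).trans this
  have hd0 : 0 < d := by
    have := hN₃ n d (by omega) hd
    exact_mod_cast (zero_lt_one.trans_le (le_max_right (d₀ : ℝ) 1)).trans_le this
  have hn0 : 0 < n := by omega
  have hn1 : (1 : ℝ) ≤ n := by exact_mod_cast hn0
  have hlarge : 64 ≤ Γ * c₁ ^ 2 * n := by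
    rw [← div_le_iff₀' (by positivity)]
    exact hN₄.trans (by exact_mod_cast (by omega : N₄ ≤ n))
  have hlarge' : 64 ≤ c₁ * n := by
    have h1 : Γ * c₁ ^ 2 ≤ c₁ := by nlinarith
    nlinarith
  set M := c₁ * n / 4 with hM
  have hM0 : 0 < M := by positivity
  have hMn : M ≤ n / 2 := by nlinarith
  have hMΓ : 2 / M ≤ Γ * c₁ / 4 := by
    rw [div_le_iff₀ hM0, hM]
    linarith
  have hsmall : (n : ℝ) * Real.exp (-(θ₀ ^ 2 / 16 * d)) ≤ ε / 8 := by
    refine le_trans (mul_le_mul_of_nonneg_right ?_ (Real.exp_nonneg _)) (hN₂ n d (by omega) hd)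
    nlinarith
  have hreg : prob (bbm C D !![p, q; q, p]) {X | ¬ Regular p q C θ X} ≤ ε / 4 := by
    have h1 := prob_not_regular_le p q C hD (θ := θ) (by positivity) (by linarith)
    have h2 := hN₁ n d (by omega) hd
    linarith
  -- Regularity is kept inside the splitting event, because for seeds from different planted
  -- clusters the split is known to be good for regular data only.
  have hrun : ∀ X : Fin n → Fin d → Bool,
      prob (stateAfter (fun _ => softRound 1) X (fun k => X (s k)) T) (Solved X C)ᶜ ≤
        prob (PMF.pure X) {X | ¬ Regular p q C θ X} + prob (assign X fun k => X (s k))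
          {σ | Regular p q C θ X ∧ ¬ ∃ π, GoodSplit C (c₁ / 2) M π σ} + ε / 4 := by
    intro X
    by_cases hX : Regular p q C θ X
    · have h1 := hX.prob_not_solved_le hC hn0 (by positivity) (δ := c₁ / 2) hM0 hMn
        (by linarith) (θ₀ := θ₀) (by positivity) (by linarith) (by linarith) (fun k => X (s k)) hT
      have h2 := prob_nonneg (PMF.pure X) {X | ¬ Regular p q C θ X}
      have h3 : prob (assign X fun k => X (s k)) {σ | ¬ ∃ π, GoodSplit C (c₁ / 2) M π σ} ≤
          prob (assign X fun k => X (s k))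
            {σ | Regular p q C θ X ∧ ¬ ∃ π, GoodSplit C (c₁ / 2) M π σ} :=
        prob_mono _ fun σ hσ => ⟨hX, hσ⟩
      linarith
    · rw [prob_pure_of_mem (S := {X | ¬ Regular p q C θ X}) hX]
      have h1 := prob_le_one (stateAfter (fun _ => softRound 1) X (fun k => X (s k)) T)
        (Solved X C)ᶜ
      have h2 := prob_nonneg (assign X fun k => X (s k))
        {σ | Regular p q C θ X ∧ ¬ ∃ π, GoodSplit C (c₁ / 2) M π σ}
      linarith
  refine (expect_mono _ hrun).trans ?_
  rw [expect_add, expect_add, ← prob_bind, PMF.bind_pure, expect_const]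
  suffices hsplit : (expect (bbm C D !![p, q; q, p]) fun X => prob (assign X fun k => X (s k))
      {σ | Regular p q C θ X ∧ ¬ ∃ π, GoodSplit C (c₁ / 2) M π σ}) ≤ ε / 2 by linarith
  by_cases hs : C (s 0) = C (s 1)
  · have hmono : ∀ X : Fin n → Fin d → Bool, prob (assign X fun k => X (s k))
        {σ | Regular p q C θ X ∧ ¬ ∃ π, GoodSplit C (c₁ / 2) M π σ} ≤
        prob (assign X fun k => X (s k)) {σ | ¬ ∃ π, GoodSplit C (c₁ / 2) M π σ} := fun X =>
      prob_mono _ fun σ hσ => hσ.2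
    refine (expect_mono _ hmono).trans ?_
    rw [bbm_eq, expect_piPMF_seeded _ s, ← hs]
    have h1 : ∀ b, (expect (rowLaw p q D (C (s 0))) fun b' =>
        expect (piPMF (seeded (fun a => rowLaw p q D (C a)) s b b')) fun X =>
          prob (assign X fun k => X (s k)) {σ | ¬ ∃ π, GoodSplit C (c₁ / 2) M π σ}) ≤
        prob (rowLaw p q D (C (s 0))) {b' | ¬ GoodSeeds p q D (C (s 0)) c 1 b b'} + ε / 4 := by
      classical
      intro b
      rw [prob_eq_expect, ← expect_const (rowLaw p q D (C (s 0))) (ε / 4), ← expect_add]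
      refine expect_mono _ fun b' => ?_
      by_cases hg : GoodSeeds p q D (C (s 0)) c 1 b b'
      · rw [if_neg (by simpa using hg), zero_add]
        have hcc : c₁ = c := min_eq_left (by linarith [hg.le_first, hg.first_le])
        rw [hM, hcc]
        rw [hcc] at hlarge'
        refine (hg.expect_prob_not_goodSplit_le hC hc hlarge' s).trans ?_
        have := hN₅ n (by omega)
        rw [pow_zero, one_mul] at this
        linarith
      · rw [if_pos (by simpa using hg)]
        have := expect_le_const (piPMF (seeded (fun a => rowLaw p q D (C a)) s b b'))
          fun X => prob_le_one (assign X fun k => X (s k))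
            {σ | ¬ ∃ π, GoodSplit C (c₁ / 2) M π σ}
        linarith
    refine (expect_mono _ h1).trans ?_
    rw [expect_add, expect_const]
    linarith [hd₀ d hdl D hD (C (s 0))]
  · obtain ⟨π, hπ⟩ := exists_perm (i := fun k => C (s k)) hs
    refine (expect_le_const _ fun X => ?_).trans (by linarith : (0 : ℝ) ≤ ε / 2)
    classical
    by_cases hX : Regular p q C θ X
    · have hsep := hX.separates (by rw [← hΓ]; linarith) (by positivity) hd0 s hπ
      rw [prob_eq_expect, hsep.expect_assign, if_neg]
      exact fun hcon => hcon.2 ⟨π, hC.goodSplit hn0 π (by linarith) hMn⟩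
    · rw [prob_eq_expect]
      refine expect_le_const _ fun σ => ?_
      rw [if_neg fun hcon => hX hcon.1]

end BooleanBlock

/-! ### Assembly of the three statements -/

open BooleanBlock in
theorem theorem3 :
    ∃ κ : ℕ, ∀ p : unitInterval, 0 < (p : ℝ) → (p : ℝ) < 1 / 2 →
      -- `k`-modes
      (∀ q : unitInterval, q < p → ∀ K : ℕ, ∀ ε : ℝ, 0 < ε →
        ∃ η : ℝ, 0 < η ∧ ∃ N : ℕ, ∀ n d : ℕ, N ≤ n → ∀ hn : 2 ≤ n,
          Real.log n ^ κ ≤ d → (d : ℝ) ≤ Real.exp (η * n) →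
          ∀ (C : Fin n → Fin 2) (D : Fin d → Fin 2), Balanced C → Balanced D →
          ∀ T : ℕ, 2 ≤ T → T ≤ n ^ K →
            1 - ε ≤ prob ((bbm C D !![p, q; q, p]).bind fun X => kModes hn X T)
              {σ | accuracy C σ ≤ 0.51} ∧
            1 - ε ≤ prob (bbm C D !![p, q; q, p])
              {X | expect (kModes hn X T) (accuracy C) ≤ 0.51}) ∧
      -- `SoftModes(t)`
      (∀ q : unitInterval, q < p → ∀ t : ℝ, 1 ≤ t → ∀ K : ℕ, ∀ ε : ℝ, 0 < ε →
        ∃ N : ℕ, ∀ n d : ℕ, N ≤ n → ∀ hn : 2 ≤ n, Real.log n ^ κ ≤ d →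
          ∀ (C : Fin n → Fin 2) (D : Fin d → Fin 2), Balanced C → Balanced D →
          ∀ T : ℕ, 2 ≤ T → T ≤ n ^ K →
            1 - ε ≤ prob (bbm C D !![p, q; q, p])
              {X | 0.74 ≤ expect (softModes t hn X T) (accuracy C)}) ∧
      -- `SoftModes(1)` for small `q`
      (∃ q₀ : ℝ, 0 < q₀ ∧ ∀ q : unitInterval, q < p → (q : ℝ) < q₀ →
        ∀ K : ℕ, ∀ ε : ℝ, 0 < ε →
        ∃ N : ℕ, ∀ n d : ℕ, N ≤ n → ∀ hn : 2 ≤ n, Real.log n ^ κ ≤ d →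
          ∀ (C : Fin n → Fin 2) (D : Fin d → Fin 2), Balanced C → Balanced D →
          ∀ T : ℕ, 2 ≤ T → T ≤ n ^ K →
            1 - ε ≤ prob ((bbm C D !![p, q; q, p]).bind fun X => softModes 1 hn X T)
              {σ | MisclassifiesNoPoint C σ}) := by
  -- `κ = 2` is what `exists_sq_mul_exp_neg_le` uses. The argument for `SoftModes(1)` covers every
  -- `q < p`, hence `q₀ = 1`.
  refine ⟨2, fun p hp0 hp => ⟨fun q hqp K ε hε => ?_, fun q hqp t ht K ε hε => ?_,
    1, one_pos, fun q hqp _ K ε hε => ?_⟩⟩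
  -- The factor 0.005 serves the mean accuracy: by Markov's inequality the conditional probability
  -- of accuracy above 0.505 is below 0.005 except with probability `ε`.
  · obtain ⟨η, hη, N, hN⟩ := exists_kModes_accuracy hp0 hp hqp K (ε := ε * 0.005) (by positivity)
    refine ⟨η, hη, N, fun n d hNn hn hd hdη C D hC hD T hT hTK => ?_⟩
    have hE := hN n d hNn hn hd hdη C D hC hD T hT hTK
    constructor
    · have h1 := prob_compl ((bbm C D !![p, q; q, p]).bind fun X => kModes hn X T)
        {σ | ¬ accuracy C σ ≤ 0.505}
      rw [prob_bind (bbm C D !![p, q; q, p]) _ {σ | ¬ accuracy C σ ≤ 0.505}] at h1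
      refine le_trans (by linarith : 1 - ε ≤ _) (h1.symm.trans_le (prob_mono _ fun σ hσ => ?_))
      have h2 : accuracy C σ ≤ 0.505 := not_not.1 hσ
      exact h2.trans (by norm_num)
    · set B := fun X : Fin n → Fin d → Bool =>
        prob (kModes hn X T) {σ | ¬ accuracy C σ ≤ 0.505} with hB
      have hM := prob_ge_le_expect_div (bbm C D !![p, q; q, p]) (f := B)
        (fun X => prob_nonneg _ _) (t := 0.005) (by norm_num)
      have h1 : expect (bbm C D !![p, q; q, p]) B / 0.005 ≤ ε := by
        rw [div_le_iff₀ (by norm_num)]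
        exact hE
      have h2 := prob_compl (bbm C D !![p, q; q, p]) {X | 0.005 ≤ B X}
      refine le_trans (by linarith : 1 - ε ≤ _) (h2.symm.trans_le (prob_mono _ fun X hX => ?_))
      have hX' : B X < 0.005 := not_le.1 hX
      -- As accuracy is at most 1, its excess over 0.505 is at most the indicator of the bad event,
      -- so the mean is at most `0.505 + 0.005`.
      have h3 := expect_le_prob (kModes hn X T) {σ | ¬ accuracy C σ ≤ 0.505}
        (f := fun σ => accuracy C σ - 0.505) (fun σ => by linarith [accuracy_le_one C σ])
        fun σ hσ => sub_nonpos.2 (not_not.1 hσ)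
      rw [expect_sub, expect_const] at h3
      refine (sub_le_iff_le_add.1 h3).trans ?_
      change B X + 0.505 ≤ 0.51
      norm_num at hX' ⊢
      linarith
  · obtain ⟨N, hN⟩ := exists_softModes_accuracy hp hqp (by linarith : 0 < t) hε
    exact ⟨N, fun n d hNn hn hd C D hC hD T hT _ =>
      hN n d hNn hn hd C D hC hD T (by omega)⟩
  · obtain ⟨N, hN⟩ := exists_soft_solved hp0 hp hqp hε
    refine ⟨N, fun n d hNn hn hd C D hC hD T hT _ => ?_⟩
    have h1 := prob_compl ((bbm C D !![p, q; q, p]).bind fun X => softModes 1 hn X T)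
      {σ | ¬ MisclassifiesNoPoint C σ}
    have h2 : prob ((bbm C D !![p, q; q, p]).bind fun X => softModes 1 hn X T)
        {σ | ¬ MisclassifiesNoPoint C σ} ≤ ε := by
      rw [prob_bind]
      have h3 : ∀ X : Fin n → Fin d → Bool, prob (softModes 1 hn X T) {σ | ¬ MisclassifiesNoPoint C σ} ≤
          expect (seeding hn) fun s =>
            prob (stateAfter (fun _ => softRound 1) X (fun k => X (s k)) T) (Solved X C)ᶜ :=
        fun X => by
          rw [softModes, prob_output]
          exact expect_mono _ fun s => prob_not_misclassifiesNoPoint_le _ X _ T C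
      refine (expect_mono _ h3).trans ?_
      rw [expect_comm]
      exact expect_le_const _ fun s => hN n d hNn hd C D hC hD s T hT
    refine le_trans (by linarith : 1 - ε ≤ _) (h1.symm.trans_le (prob_mono _ fun σ hσ => ?_))
    exact not_not.1 hσ
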